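/- Let $X$ and $Y$ be smooth projective varieties (integral schemes) over $\mathbb{C}$, and let $\pi : X \to Y$ be a finite surjective morphism over $\mathbb{C}$ whose degree $r = [\mathbb{C}(X):\mathbb{C}(Y)]$ is a prime number. Let $V$ be a locally free sheaf of finite rank on $Y$, let $M$ be a vector bundle of positive rank on $X$, and let $\sigma \in H^0(X,\pi^*V)$ be a section which is not of the form $\pi^*s$ with $s \in H^0(Y,V)$. Let $\Phi : \pi_*M \to \pi_*M \otimes V$ be the $V$-twisted Higgs field that is the pushforward along $\pi$ of the map $M \to M \otimes \pi^*V$, $m \mapsto m \otimes \sigma$. Then there is exactly one polynomial $$f_\Phi(\eta) = \eta^r + s_1\eta^{r-1} + \dots + s_{r-1}\eta + s_r, \qquad s_i \in H^0(Y,\mathrm{Sym}^i V),$$ of degree $r$ that annihilates $\Phi$, that is, with $f_\Phi(\Phi) = 0$ in $\mathcal{E}nd(\pi_*M) \otimes \mathrm{Sym}^r V$. Let $\mathrm{Tot}(V)$ be the total space of $V$ (whose sections over $Y$ are the sections of $V$), let $p : \mathrm{Tot}(V) \to Y$ be the projection, let $\eta$ be the tautological section of $p^*V$, and let $C_\Phi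 \subseteq \mathrm{Tot}(V)$ be the spectral cover, i.e. the closed subscheme of zeros of the section $f_\Phi(\eta)$ of $p^*\mathrm{Sym}^r V$. Then the map $X \to \mathrm{Tot}(V)$, $x \mapsto (\pi(x),\sigma(x))$, factors through a morphism $\psi : X \to C_\Phi$, and $\psi$ is birational: it restricts to an isomorphism from a dense open subscheme of $X$ onto a dense open subscheme of $C_\Phi$. In particular $C_\Phi$ is birational to $X$ over $\mathbb{C}$. -/

import Mathlib

open CategoryTheory AlgebraicGeometry Limits
namespace SpectralCover

/-- A trivialisation of rank `n` of the sheaf of modules `V` over an open set `U`: sections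
`vec 0, …, vec (n - 1)` of `V` over `U` such that over every open `W ≤ U` every section of `V` is
a unique linear combination of their restrictions, i.e. an isomorphism `𝒪_U ^ n ≅ V|_U`. -/
structure Frame {Y : Scheme.{0}} (V : Y.Modules) (n : ℕ) where
  U : Y.Opens
  vec : Fin n → Γ(V, U)
  existsUnique_coord : ∀ (W : Y.Opens) (h : W ≤ U) (s : Γ(V, W)),
    ∃! c : Fin n → Γ(Y, W), s = ∑ i, c i • V.presheaf.map (homOfLE h).op (vec i)

namespace Frame
variable {Y : Scheme.{0}} {V : Y.Modules} {n : ℕ}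

/-- The coordinates of a section of `V` over `W ≤ F.U` in the frame `F`. -/
noncomputable def coord (F : Frame V n) {W : Y.Opens} (h : W ≤ F.U) (s : Γ(V, W)) :
    Fin n → Γ(Y, W) := (F.existsUnique_coord W h s).choose

lemma coord_spec (F : Frame V n) {W : Y.Opens} (h : W ≤ F.U) (s : Γ(V, W)) :
    s = ∑ i, F.coord h s i • V.presheaf.map (homOfLE h).op (F.vec i) :=
  (F.existsUnique_coord W h s).choose_spec.1

lemma coord_eq (F : Frame V n) {W : Y.Opens} (h : W ≤ F.U) (s : Γ(V, W)) (c : Fin n → Γ(Y, W))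
    (hc : s = ∑ i, c i • V.presheaf.map (homOfLE h).op (F.vec i)) : c = F.coord h s :=
  (F.existsUnique_coord W h s).choose_spec.2 c hc

/-- Frames are (pre)ordered by inclusion of their domains. -/
instance : Preorder (Frame V n) := Preorder.lift Frame.U

lemma res_res {W₁ W₂ W₃ : Y.Opens} (h : W₁ ≤ W₂) (h' : W₂ ≤ W₃) (s : Γ(V, W₃)) :
    V.presheaf.map (homOfLE h).op (V.presheaf.map (homOfLE h').op s) =
      V.presheaf.map (homOfLE (h.trans h')).op s := by
  rw [← ConcreteCategory.comp_apply, ← Functor.map_comp]; rfl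

/-- The restriction of a frame to a smaller open set. -/
@[simps] noncomputable def restrict (F : Frame V n) (W : Y.Opens) (h : W ≤ F.U) : Frame V n where
  U := W
  vec i := V.presheaf.map (homOfLE h).op (F.vec i)
  existsUnique_coord W' h' s := by
    simp only [res_res]
    exact F.existsUnique_coord W' (h'.trans h) s

/-- The transition matrix `T` from the frame `F` to the frame `G`, where `F.U ≤ G.U`:
over `F.U` one has `F.vec j = ∑ i, T i j • G.vec i`. -/
noncomputable def transition {F G : Frame V n} (h : F.U ≤ G.U) (i j : Fin n) : Γ(Y, F.U) :=
  G.coord h (F.vec j) i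

lemma transition_spec {F G : Frame V n} (h : F.U ≤ G.U) (j : Fin n) :
    F.vec j = ∑ i, transition h i j • V.presheaf.map (homOfLE h).op (G.vec i) :=
  G.coord_spec h (F.vec j)

lemma transition_refl (F : Frame V n) (i j : Fin n) :
    transition (le_refl F.U) i j = if i = j then 1 else 0 := by
  refine (congrFun (F.coord_eq (le_refl _) (F.vec j) (fun i => if i = j then 1 else 0) ?_) i).symm
  simp

lemma transition_eq_of_restrict (G : Frame V n) (W : Y.Opens) (h : W ≤ G.U) (i j : Fin n) :
    transition (F := G.restrict W h) (G := G) h i j = if i = j then 1 else 0 := by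
  refine (congrFun (G.coord_eq h _ (fun i => if i = j then 1 else 0) ?_) i).symm
  simp

lemma transition_comp {F G H : Frame V n} (h : F.U ≤ G.U) (h' : G.U ≤ H.U) (i k : Fin n) :
    transition (h.trans h') i k =
      ∑ j, Y.presheaf.map (homOfLE h).op (transition h' i j) * transition h j k := by
  refine (congrFun (H.coord_eq (h.trans h') (F.vec k) (fun i =>
     ∑ j, Y.presheaf.map (homOfLE h).op (transition h' i j) * transition h j k) ?_) i).symm
  conv_lhs => rw [transition_spec h k]
  have (j : Fin n) : V.presheaf.map (homOfLE h).op (G.vec j) =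
      ∑ i, Y.presheaf.map (homOfLE h).op (transition h' i j) • V.presheaf.map (homOfLE (h.trans h')).op (H.vec i) := by
    conv_lhs => rw [transition_spec h' j]
    rw [map_sum]
    refine Finset.sum_congr rfl fun i _ => ?_
    erw [Scheme.Modules.map_smul, res_res]
  simp only [this, Finset.smul_sum, Finset.sum_smul, smul_smul]
  rw [Finset.sum_comm]
  simp only [mul_comm]


lemma coord_add (F : Frame V n) {W : Y.Opens} (h : W ≤ F.U) (s t : Γ(V, W)) :
    F.coord h (s + t) = F.coord h s + F.coord h t := by
  refine (F.coord_eq h _ _ ?_).symm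
  conv_lhs => rw [F.coord_spec h s, F.coord_spec h t]
  simp [add_smul, Finset.sum_add_distrib]

lemma coord_smul (F : Frame V n) {W : Y.Opens} (h : W ≤ F.U) (a : Γ(Y, W)) (s : Γ(V, W)) :
    F.coord h (a • s) = a • F.coord h s := by
  refine (F.coord_eq h _ _ ?_).symm
  conv_lhs => rw [F.coord_spec h s]
  simp [mul_smul, Finset.smul_sum]

lemma coord_res (F : Frame V n) {W W' : Y.Opens} (h : W ≤ F.U) (h' : W' ≤ W) (s : Γ(V, W))
    (i : Fin n) :
    F.coord (h'.trans h) (V.presheaf.map (homOfLE h').op s) i =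
      Y.presheaf.map (homOfLE h').op (F.coord h s i) := by
  refine (congrFun (F.coord_eq (h'.trans h) _
    (fun i => Y.presheaf.map (homOfLE h').op (F.coord h s i)) ?_) i).symm
  conv_lhs => rw [F.coord_spec h s]
  simp only [map_sum, Scheme.Modules.map_smul, res_res]

lemma coord_spec_self (F : Frame V n) (s : Γ(V, F.U)) :
    s = ∑ i, F.coord le_rfl s i • F.vec i := by
  refine (F.coord_spec le_rfl s).trans (Finset.sum_congr rfl fun i _ => ?_)
  rw [show (homOfLE le_rfl : F.U ⟶ F.U) = 𝟙 _ from rfl, op_id, V.presheaf.map_id]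
  rfl

lemma coord_vec (F : Frame V n) (i j : Fin n) :
    F.coord le_rfl (F.vec j) i = if i = j then 1 else 0 :=
  transition_refl F i j

end Frame

/-- `V` is locally free of rank `n` (a vector bundle of rank `n`). -/
def IsLocallyFreeOfRank {Y : Scheme.{0}} (V : Y.Modules) (n : ℕ) : Prop :=
  ∀ y : Y, ∃ F : Frame V n, y ∈ F.U


section Pullback

lemma res_smul {Y : Scheme.{0}} {V : Y.Modules} {W W' : Y.Opens} (h : W' ≤ W) (a : Γ(Y, W)) (s : Γ(V, W)) :
    V.presheaf.map (homOfLE h).op (a • s) =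
      Y.presheaf.map (homOfLE h).op a • V.presheaf.map (homOfLE h).op s :=
  Scheme.Modules.map_smul V _ _ _

lemma exists_hom {Y : Scheme.{0}} {V Q : Y.Modules} {n : ℕ} (F : Frame V n) (hQ : ∀ W : Y.Opens, Function.Bijective
      (Q.presheaf.map (homOfLE (inf_le_left : W ⊓ F.U ≤ W)).op)) (k : Fin n → Γ(Q, F.U)) :
    ∃ φ : V ⟶ Q, ∀ i, φ.app F.U (F.vec i) = k i := by
  let g (W : Y.Opens) (s : Γ(V, W)) : Γ(Q, W ⊓ F.U) :=
    ∑ i, F.coord inf_le_right (V.presheaf.map (homOfLE (inf_le_left : W ⊓ F.U ≤ W)).op s) i •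
      Q.presheaf.map (homOfLE (inf_le_right : W ⊓ F.U ≤ F.U)).op (k i)
  have hg (W) (s : Γ(V, W)) := (hQ W).2 (g W s)
  choose ρ hρ using hg
  have ρadd (W) (s t : Γ(V, W)) : ρ W (s + t) = ρ W s + ρ W t := by
    apply (hQ W).1
    rw [map_add, hρ, hρ, hρ]
    simp [g, Frame.coord_add, add_smul, Finset.sum_add_distrib]
  have ρsmul (W) (a : Γ(Y, W)) (s : Γ(V, W)) : ρ W (a • s) = a • ρ W s := by
    apply (hQ W).1
    rw [res_smul, hρ, hρ]
    simp only [g]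
    rw [res_smul, Frame.coord_smul]
    simp [Finset.smul_sum, mul_smul]
  have ρres (W W' : Y.Opens) (h : W' ≤ W) (s : Γ(V, W)) :
      ρ W' (V.presheaf.map (homOfLE h).op s) = Q.presheaf.map (homOfLE h).op (ρ W s) := by
    apply (hQ W').1
    rw [hρ, Frame.res_res]
    rw [← Frame.res_res (inf_le_inf_right F.U h) inf_le_left, hρ]
    simp only [g, map_sum, res_smul, Frame.res_res]
    refine Finset.sum_congr rfl fun i _ => ?_
    rw [← Frame.coord_res, Frame.res_res]
  let φ : V ⟶ Q :=
    { val := PresheafOfModules.homMk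
        { app W := AddCommGrpCat.ofHom (AddMonoidHom.mk' (ρ W.unop) (ρadd W.unop))
          naturality W W' h := by
            ext s
            exact ρres W.unop W'.unop (leOfHom h.unop) s } (fun W => ρsmul W.unop) }
  refine ⟨φ, fun i => ?_⟩
  change ρ F.U (F.vec i) = k i
  apply (hQ F.U).1
  rw [hρ]
  simp only [g, Frame.coord_res F le_rfl, Frame.coord_vec]
  simp

lemma hom_ext_of_frame {Y : Scheme.{0}} {V Q : Y.Modules} {n : ℕ} (F : Frame V n) (hQ : ∀ W : Y.Opens, Function.Bijective
      (Q.presheaf.map (homOfLE (inf_le_left : W ⊓ F.U ≤ W)).op)) (φ ψ : V ⟶ Q)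
     (h : ∀ i, φ.app F.U (F.vec i) = ψ.app F.U (F.vec i)) : φ = ψ := by
  have nat (χ : V ⟶ Q) {W W' : Y.Opens} (h : W' ≤ W) (s : Γ(V, W)) :
      χ.app W' (V.presheaf.map (homOfLE h).op s) = Q.presheaf.map (homOfLE h).op (χ.app W s) :=
    ConcreteCategory.congr_hom (χ.mapPresheaf.naturality (homOfLE h).op) s
  ext W s
  apply (hQ W).1
  rw [← nat, ← nat]
  rw [F.coord_spec inf_le_right (V.presheaf.map (homOfLE (inf_le_left : W ⊓ F.U ≤ W)).op s)]
  simp only [map_sum, Scheme.Modules.Hom.app_smul, nat, h]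

/-- The structure sheaf as a module over itself. -/
noncomputable def structMod (X : Scheme.{0}) : X.Modules := SheafOfModules.unit X.ringCatSheaf
/-- The free module `𝒪_X ^ n`. -/
noncomputable def freeMod (X : Scheme.{0}) (n : ℕ) : X.Modules := ∏ᶜ fun _ : Fin n => structMod X
/-- The projections of `𝒪_X ^ n`. -/
noncomputable def freePr (X : Scheme.{0}) (n : ℕ) (i : Fin n) : freeMod X n ⟶ structMod X :=
  Pi.π (fun _ : Fin n => structMod X) i
/-- The projections of `𝒪_X ^ n` on sections. -/
noncomputable def freePrApp (X : Scheme.{0}) (n : ℕ) (i : Fin n) (W : X.Opens) : Γ(freeMod X n, W) →+ Γ(X, W) :=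
  ((freePr X n i).app W).hom

lemma freePr_smul (X : Scheme.{0}) (n : ℕ) (i : Fin n) (W : X.Opens) (a : Γ(X, W)) (s : Γ(freeMod X n, W)) :
   freePrApp X n i W (a • s) = a * freePrApp X n i W s := Scheme.Modules.Hom.app_smul (freePr X n i) a s
lemma freePr_res (X : Scheme.{0}) (n : ℕ) (i : Fin n) {W W' : X.Opens} (h : W' ≤ W) (s : Γ(freeMod X n, W)) :
   freePrApp X n i W' ((freeMod X n).presheaf.map (homOfLE h).op s) = X.presheaf.map (homOfLE h).op (freePrApp X n i W s) :=
    ConcreteCategory.congr_hom ((freePr X n i).mapPresheaf.naturality (homOfLE h).op) s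
lemma freePr_bij (X : Scheme.{0}) (n : ℕ) (W : X.Opens) :
   Function.Bijective (fun (s : Γ(freeMod X n, W)) (i : Fin n) => freePrApp X n i W s) := by
  let G : X.Modules ⥤ Ab := Scheme.Modules.toPresheaf X ⋙ (evaluation _ _).obj (.op W)
  have : PreservesLimitsOfShape (Discrete (Fin n)) (Scheme.Modules.toPresheaf X) := inferInstance
  have : PreservesLimitsOfShape (Discrete (Fin n)) ((evaluation (TopologicalSpace.Opens X)ᵒᵖ Ab).obj (.op W)) := inferInstance
  have : PreservesLimitsOfShape (Discrete (Fin n)) G := comp_preservesLimitsOfShape (Scheme.Modules.toPresheaf X) ((evaluation (TopologicalSpace.Opens X)ᵒᵖ Ab).obj (.op W))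
  have h := (Concrete.productEquiv (fun _ : Fin n => G.obj (structMod X))).bijective.comp
    (ConcreteCategory.bijective_of_isIso (PreservesProduct.iso G (fun _ : Fin n => structMod X)).hom)
  convert! h using 1
  ext s i
  refine Eq.trans ?_ (Concrete.productEquiv_apply_apply (fun _ : Fin n => G.obj (structMod X)) _ i).symm
  have h1 : (PreservesProduct.iso G (fun _ : Fin n => structMod X)).hom ≫
      Pi.π (fun _ : Fin n => G.obj (structMod X)) i = G.map (freePr X n i) := by
    rw [PreservesProduct.iso_hom, piComparison_comp_π]; rfl
  exact (ConcreteCategory.congr_hom h1 s).symm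

lemma res_bij_of_ge {Y : Scheme.{0}} (Q : Y.Modules) {W U : Y.Opens} (h : W ≤ U) (h' : U ≤ W) :
   Function.Bijective (Q.presheaf.map (homOfLE h).op) := by
  obtain rfl := le_antisymm h h'
  have : (homOfLE h) = 𝟙 W := rfl
  rw [this, op_id, Q.presheaf.map_id]
  exact Function.bijective_id

lemma exists_freeFrame (X : Scheme.{0}) (n : ℕ) : ∃ F : Frame (freeMod X n) n, F.U = ⊤ := by
  choose e he using fun i : Fin n => (freePr_bij X n ⊤).2 (fun j => if j = i then 1 else 0)
  have key (W : X.Opens) (c : Fin n → Γ(X, W)) (j : Fin n) :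
      freePrApp X n j W (∑ i, c i • (freeMod X n).presheaf.map (homOfLE (le_top : W ≤ ⊤)).op (e i)) = c j := by
    have h2 (i : Fin n) : freePrApp X n j ⊤ (e i) = if j = i then 1 else 0 := congrFun (he i) j
    simp only [map_sum, freePr_smul, freePr_res, h2]
    simp [apply_ite]
  refine ⟨⟨⊤, e, fun W h s => ⟨fun i => freePrApp X n i W s, ?_, fun c hc => ?_⟩⟩, rfl⟩
  · apply (freePr_bij X n W).1
    funext j
    exact (key W (fun i => freePrApp X n i W s) j).symm
  · funext j
    rw [hc, key]


/-- The pullback `f^* s` of a section `s` of `V` over `U`, a section of `f^* V` over `f⁻¹ U`. -/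
noncomputable def pullbackSection {X Y : Scheme.{0}} (f : X ⟶ Y) {V : Y.Modules} {U : Y.Opens} (s : Γ(V, U)) :
    Γ((Scheme.Modules.pullback f).obj V, f ⁻¹ᵁ U) :=
  ((Scheme.Modules.pullbackPushforwardAdjunction f).unit.app V).app U s


section
variable {X Y : Scheme.{0}} (f : X ⟶ Y) {V : Y.Modules} {n : ℕ} (F : Frame V n)

lemma opens_image_le {X : Scheme.{0}} (U : X.Opens) (W : U.toScheme.Opens) : U.ι ''ᵁ W ≤ U := by
  rintro _ ⟨x, _, rfl⟩
  exact x.2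

/-- The pullbacks of the vectors of a frame, on the open subscheme `f⁻¹ U`. -/
noncomputable def pbVec (i : Fin n) : Γ(((Scheme.Modules.pullback f).obj V).restrict (f ⁻¹ᵁ F.U).ι, (f ⁻¹ᵁ F.U).ι ⁻¹ᵁ f ⁻¹ᵁ F.U) :=
  ((Scheme.Modules.pullback f).obj V).presheaf.map (homOfLE (opens_image_le _ _)).op
          (pullbackSection f (F.vec i))

/-- The adjunction between `V ↦ (f^* V)|_{f⁻¹ U}` and the pushforward along `f⁻¹ U → X → Y`. -/
noncomputable def pbAdj : Scheme.Modules.pullback f ⋙ Scheme.Modules.restrictFunctor (f ⁻¹ᵁ F.U).ι ⊣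
    Scheme.Modules.pushforward (f ⁻¹ᵁ F.U).ι ⋙ Scheme.Modules.pushforward f :=
  (Scheme.Modules.pullbackPushforwardAdjunction f).comp
    (Scheme.Modules.restrictAdjunction (f ⁻¹ᵁ F.U).ι)

lemma pbAdj_apply (K : (f ⁻¹ᵁ F.U).toScheme.Modules)
    (φ : ((Scheme.Modules.pullback f).obj V).restrict (f ⁻¹ᵁ F.U).ι ⟶ K) (i : Fin n) :
    ((pbAdj f F).homEquiv V K φ).app F.U (F.vec i) = φ.app _ (pbVec f F i) := by
  rw [Adjunction.homEquiv_unit]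
  simp only [pbAdj, Adjunction.comp_unit_app]
  rfl

lemma pb_hQ (K : (f ⁻¹ᵁ F.U).toScheme.Modules) (W : Y.Opens) : Function.Bijective
      (((Scheme.Modules.pushforward (f ⁻¹ᵁ F.U).ι ⋙ Scheme.Modules.pushforward f).obj K).presheaf.map (homOfLE (inf_le_left : W ⊓ F.U ≤ W)).op) := by
  apply res_bij_of_ge K (W := (f ⁻¹ᵁ F.U).ι ⁻¹ᵁ f ⁻¹ᵁ (W ⊓ F.U))  (U := (f ⁻¹ᵁ F.U).ι ⁻¹ᵁ f ⁻¹ᵁ W)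
  intro x hx
  exact ⟨hx, x.2⟩

lemma pb_exists (K : (f ⁻¹ᵁ F.U).toScheme.Modules) (k : Fin n → Γ(K, (f ⁻¹ᵁ F.U).ι ⁻¹ᵁ f ⁻¹ᵁ F.U)) :
    ∃ φ : ((Scheme.Modules.pullback f).obj V).restrict (f ⁻¹ᵁ F.U).ι ⟶ K,
      ∀ i, φ.app _ (pbVec f F i) = k i := by
  obtain ⟨φ, hφ⟩ := exists_hom F (pb_hQ f F K) k
  refine ⟨((pbAdj f F).homEquiv V K).symm φ, fun i => ?_⟩
  rw [← pbAdj_apply, Equiv.apply_symm_apply]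
  exact hφ i

lemma pb_unique (K : (f ⁻¹ᵁ F.U).toScheme.Modules)
    (φ ψ : ((Scheme.Modules.pullback f).obj V).restrict (f ⁻¹ᵁ F.U).ι ⟶ K)
    (h : ∀ i, φ.app _ (pbVec f F i) = ψ.app _ (pbVec f F i)) : φ = ψ := by
  apply ((pbAdj f F).homEquiv V K).injective
  apply hom_ext_of_frame F (pb_hQ f F K)
  intro i
  rw [pbAdj_apply, pbAdj_apply, h]

lemma app_res {Y : Scheme.{0}} {V Q : Y.Modules} (χ : V ⟶ Q) {W W' : Y.Opens} (h : W' ≤ W) (s : Γ(V, W)) :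
      χ.app W' (V.presheaf.map (homOfLE h).op s) = Q.presheaf.map (homOfLE h).op (χ.app W s) :=
    ConcreteCategory.congr_hom (χ.mapPresheaf.naturality (homOfLE h).op) s

lemma pb_basis (W : (f ⁻¹ᵁ F.U).toScheme.Opens) (hW : W ≤ (f ⁻¹ᵁ F.U).ι ⁻¹ᵁ f ⁻¹ᵁ F.U)
    (s : Γ(((Scheme.Modules.pullback f).obj V).restrict (f ⁻¹ᵁ F.U).ι, W)) :
    ∃! c : Fin n → Γ((f ⁻¹ᵁ F.U).toScheme, W),
      s = ∑ i, c i • (((Scheme.Modules.pullback f).obj V).restrict (f ⁻¹ᵁ F.U).ι).presheaf.map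
        (homOfLE hW).op (pbVec f F i) := by
  obtain ⟨P, E, hE⟩ : ∃ (P : (f ⁻¹ᵁ F.U).toScheme.Modules) (E : Frame P n),
      E.U = (f ⁻¹ᵁ F.U).ι ⁻¹ᵁ f ⁻¹ᵁ F.U := by
    obtain ⟨E, hE⟩ := exists_freeFrame (f ⁻¹ᵁ F.U).toScheme n
    exact ⟨_, E.restrict _ (by rw [hE]; exact le_top), rfl⟩
  obtain ⟨U, e, he⟩ := E
  dsimp at hE
  subst hE
  obtain ⟨φ, hφ⟩ := pb_exists f F P e
  have hT (Q : (f ⁻¹ᵁ F.U).toScheme.Modules) (W) : Function.Bijective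
      (Q.presheaf.map (homOfLE (inf_le_left : W ⊓ ((f ⁻¹ᵁ F.U).ι ⁻¹ᵁ f ⁻¹ᵁ F.U) ≤ W)).op) :=
    res_bij_of_ge Q _ fun x hx => ⟨hx, x.2⟩
  obtain ⟨χ, hχ⟩ := exists_hom ⟨_, e, he⟩ (hT _) (pbVec f F)
  dsimp at hχ
  have h1 : φ ≫ χ = 𝟙 _ := pb_unique f F _ _ _ fun i => by
    rw [Scheme.Modules.Hom.comp_app, ConcreteCategory.comp_apply, hφ, hχ]; rfl
  have h2 : χ ≫ φ = 𝟙 _ := hom_ext_of_frame ⟨_, e, he⟩ (hT _) _ _ fun i => by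
    dsimp only
    rw [Scheme.Modules.Hom.comp_app, ConcreteCategory.comp_apply, hχ, hφ]; rfl
  have inj : Function.Injective (φ.app W) := by
    have : IsIso φ := ⟨χ, h1, h2⟩
    exact (ConcreteCategory.bijective_of_isIso (φ.app W)).1
  have key (c : Fin n → Γ((f ⁻¹ᵁ F.U).toScheme, W)) : φ.app W (∑ i, c i • (((Scheme.Modules.pullback f).obj V).restrict (f ⁻¹ᵁ F.U).ι).presheaf.map
        (homOfLE hW).op (pbVec f F i)) = ∑ i, c i • P.presheaf.map (homOfLE hW).op (e i) := by
    simp only [map_sum, Scheme.Modules.Hom.app_smul, app_res, hφ]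
  obtain ⟨c, hc, huniq⟩ := he W hW (φ.app W s)
  refine ⟨c, inj (by rw [key]; exact hc), fun c' hc' => huniq c' ((congrArg (φ.app W) hc').trans (key c'))⟩

lemma pb_basis' (W : X.Opens) (hW : W ≤ f ⁻¹ᵁ F.U)
    (s : Γ((Scheme.Modules.pullback f).obj V, W)) :
    ∃! c : Fin n → Γ(X, W),
      s = ∑ i, c i • ((Scheme.Modules.pullback f).obj V).presheaf.map
        (homOfLE hW).op (pullbackSection f (F.vec i)) := by
  obtain ⟨W', rfl⟩ : ∃ W' : (f ⁻¹ᵁ F.U).toScheme.Opens, (f ⁻¹ᵁ F.U).ι ''ᵁ W' = W :=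
    ⟨(f ⁻¹ᵁ F.U).ι ⁻¹ᵁ W, by
      rw [Scheme.Hom.image_preimage_eq_opensRange_inf, Scheme.Opens.opensRange_ι]
      exact inf_eq_right.mpr hW⟩
  have hW' : W' ≤ (f ⁻¹ᵁ F.U).ι ⁻¹ᵁ f ⁻¹ᵁ F.U := fun x _ => x.2
  have h := pb_basis f F W' hW' s
  have e (c : Fin n → Γ(X, (f ⁻¹ᵁ F.U).ι ''ᵁ W')) :
      ∑ i, c i • ((Scheme.Modules.pullback f).obj V).presheaf.map
        (homOfLE hW).op (pullbackSection f (F.vec i)) =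
      (∑ i, (show Γ((f ⁻¹ᵁ F.U).toScheme, W') from c i) • (((Scheme.Modules.pullback f).obj V).restrict (f ⁻¹ᵁ F.U).ι).presheaf.map
        (homOfLE hW').op (pbVec f F i)) := by
    refine Finset.sum_congr rfl fun i _ => ?_
    refine Eq.trans ?_ (Scheme.Modules.smul_restrictAppIso_hom_apply (f ⁻¹ᵁ F.U).ι ((Scheme.Modules.pullback f).obj V) W' (show Γ((f ⁻¹ᵁ F.U).toScheme, W') from c i)
      ((((Scheme.Modules.pullback f).obj V).restrict (f ⁻¹ᵁ F.U).ι).presheaf.map (homOfLE hW').op (pbVec f F i))).symm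
    rw [Scheme.Opens.ι_appIso]
    have hv : ((Scheme.Modules.pullback f).obj V).presheaf.map (homOfLE hW).op
        (pullbackSection f (F.vec i)) =
        ((Scheme.Modules.pullback f).obj V).presheaf.map
          ((f ⁻¹ᵁ F.U).ι.opensFunctor.map (homOfLE hW')).op
          (((Scheme.Modules.pullback f).obj V).presheaf.map (homOfLE (opens_image_le _ _)).op
            (pullbackSection f (F.vec i))) := (Frame.res_res _ _ _).symm
    rw [hv]
    rfl
  obtain ⟨c, hc, hu⟩ := h
  exact ⟨c, hc.trans (e c).symm, fun c' hc' => hu c' (hc'.trans (e c'))⟩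

/-- The pullback of a frame of `V` is a frame of `f^* V`. -/
noncomputable def Frame.pullback : Frame ((Scheme.Modules.pullback f).obj V) n where
  U := f ⁻¹ᵁ F.U
  vec i := pullbackSection f (F.vec i)
  existsUnique_coord := pb_basis' f F

end

end Pullback

section TotalSpace
variable {Y : Scheme.{0}} {V : Y.Modules} {n : ℕ}

/-- The open cover of `Y` by the domains of all frames of `V`. -/
noncomputable def frameCover (hV : IsLocallyFreeOfRank V n) : Y.OpenCover where
  I₀ := Frame V n
  X F := F.U
  f F := F.U.ι
  mem₀ := by
    rw [Scheme.presieve₀_mem_precoverage_iff]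
    refine ⟨fun y ↦ ?_, inferInstance⟩
    obtain ⟨F, hF⟩ := hV y
    exact ⟨F, by simpa using hF⟩

instance (hV : IsLocallyFreeOfRank V n) : Preorder (frameCover hV).I₀ :=
  inferInstanceAs (Preorder (Frame V n))

noncomputable instance (hV : IsLocallyFreeOfRank V n) : (frameCover hV).LocallyDirected :=
  .ofIsBasisOpensRange (by intro F G; simp [frameCover]; rfl) <| by
    rw [TopologicalSpace.Opens.isBasis_iff_nbhd]
    intro W y hy
    obtain ⟨F, hF⟩ := hV y
    exact ⟨W ⊓ F.U, ⟨F.restrict (W ⊓ F.U) inf_le_right, by simp [frameCover]⟩, ⟨hy, hF⟩, inf_le_left⟩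

/-- The pullback of functions from `U` to the affine space `𝔸ⁿ_U`. -/
noncomputable def baseFunction (n : ℕ) (U : Y.Opens) : Γ(Y, U) →+* Γ(𝔸(Fin n; U), ⊤) :=
  ((𝔸(Fin n; U) ↘ U.toScheme).appTop.hom).comp U.topIso.inv.hom

/-- The change of fibre coordinates: the point `∑ j, x j • F.vec j` of the fibre of `V` has
coordinates `∑ j, T i j * x j` in the frame `G`, where `T` is the transition matrix. -/
noncomputable def chartTransition {F G : Frame V n} (h : F.U ≤ G.U) :
    𝔸(Fin n; F.U) ⟶ 𝔸(Fin n; G.U) :=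
  AffineSpace.homOfVector ((𝔸(Fin n; F.U) ↘ F.U.toScheme) ≫ Y.homOfLE h) fun i =>
    ∑ j, baseFunction n F.U (Frame.transition h i j) * AffineSpace.coord _ j

lemma chartTransition_over {F G : Frame V n} (h : F.U ≤ G.U) :
    chartTransition h ≫ (𝔸(Fin n; G.U) ↘ G.U.toScheme) =
      (𝔸(Fin n; F.U) ↘ F.U.toScheme) ≫ Y.homOfLE h := by
  simp [chartTransition]

lemma chartTransition_over_assoc {F G : Frame V n} (h : F.U ≤ G.U) {Z : Scheme.{0}}
    (k : G.U.toScheme ⟶ Z) :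
    chartTransition h ≫ (𝔸(Fin n; G.U) ↘ G.U.toScheme) ≫ k =
      (𝔸(Fin n; F.U) ↘ F.U.toScheme) ≫ Y.homOfLE h ≫ k := by
  rw [← Category.assoc, chartTransition_over, Category.assoc]

lemma chartTransition_coord {F G : Frame V n} (h : F.U ≤ G.U) (i : Fin n) :
    (chartTransition h).appTop (AffineSpace.coord _ i) =
    ∑ j, baseFunction n F.U (Frame.transition h i j) * AffineSpace.coord _ j := by
  simp [chartTransition]

lemma baseFunction_res {F G : Frame V n} (h : F.U ≤ G.U) (a : Γ(Y, G.U)) :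
    (chartTransition h).appTop (baseFunction n G.U a) =
      baseFunction n F.U (Y.presheaf.map (homOfLE h).op a) := by
  have h1 := congr(Scheme.Hom.appTop $(chartTransition_over h))
  have h2 := congr($h1 (G.U.topIso.inv a))
  simp only [Scheme.Hom.comp_appTop, CommRingCat.comp_apply] at h2
  refine h2.trans ?_
  simp only [baseFunction, RingHom.comp_apply]
  congr 1
  simp only [← CommRingCat.comp_apply]
  congr 2
  simp only [Scheme.homOfLE_appTop, Scheme.Opens.topIso_inv]
  erw [← Y.presheaf.map_comp, ← Y.presheaf.map_comp]
  rfl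

lemma chartTransition_refl (F : Frame V n) : chartTransition (le_refl F.U) = 𝟙 _ := by
  apply AffineSpace.hom_ext
  · rw [chartTransition_over]; simp
  · intro i
    rw [chartTransition_coord]
    simp [Frame.transition_refl]

lemma chartTransition_comp {F G H : Frame V n} (h : F.U ≤ G.U) (h' : G.U ≤ H.U) :
    chartTransition (h.trans h') = chartTransition h ≫ chartTransition h' := by
  apply AffineSpace.hom_ext
  · simp [chartTransition_over, chartTransition_over_assoc]
  · intro i
    rw [chartTransition_coord, Scheme.Hom.comp_appTop, CommRingCat.comp_apply, chartTransition_coord]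
    simp only [map_sum, map_mul, chartTransition_coord, baseFunction_res, Frame.transition_comp h h']
    simp only [Finset.sum_mul, Finset.mul_sum, mul_assoc]
    exact Finset.sum_comm

lemma chartTransition_eq_map {R G : Frame V n} (h : R.U ≤ G.U)
    (hT : ∀ i j, Frame.transition h i j = if i = j then 1 else 0) :
    chartTransition h = AffineSpace.map (Fin n) (Y.homOfLE h) := by
  apply AffineSpace.hom_ext
  · rw [chartTransition_over, AffineSpace.map_over]
  · intro i
    rw [chartTransition_coord, AffineSpace.map_appTop_coord]
    simp [hT]

lemma isIso_homOfLE {U W : Y.Opens} (h : U ≤ W) (h' : W ≤ U) : IsIso (Y.homOfLE h) :=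
  ⟨Y.homOfLE h', by simp, by simp⟩

lemma isIso_chartTransition {F G : Frame V n} (h : F.U ≤ G.U) (h' : G.U ≤ F.U) :
    IsIso (chartTransition h) :=
  ⟨chartTransition h', by rw [← chartTransition_comp, chartTransition_refl],
    by rw [← chartTransition_comp, chartTransition_refl]⟩

lemma isPullback_chartTransition {F G : Frame V n} (h : F.U ≤ G.U) :
    IsPullback (chartTransition h) (𝔸(Fin n; F.U) ↘ F.U.toScheme) (𝔸(Fin n; G.U) ↘ G.U.toScheme)
      (Y.homOfLE h) := by
  obtain ⟨R, hFR, hRF, hRG, hT⟩ : ∃ (R : Frame V n) (_ : F.U ≤ R.U) (_ : R.U ≤ F.U)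
      (hRG : R.U ≤ G.U), ∀ i j, Frame.transition hRG i j = if i = j then 1 else 0 :=
    ⟨G.restrict F.U h, le_rfl, le_rfl, h, Frame.transition_eq_of_restrict G F.U h⟩
  have := isIso_chartTransition hFR hRF
  have := isIso_homOfLE (Y := Y) hFR hRF
  have p1 : IsPullback (chartTransition hFR) (𝔸(Fin n; F.U) ↘ F.U.toScheme)
      (𝔸(Fin n; R.U) ↘ R.U.toScheme) (Y.homOfLE hFR) :=
    IsPullback.of_horiz_isIso ⟨chartTransition_over hFR⟩
  have p2 : IsPullback (chartTransition hRG) (𝔸(Fin n; R.U) ↘ R.U.toScheme)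
      (𝔸(Fin n; G.U) ↘ G.U.toScheme) (Y.homOfLE hRG) := by
    rw [chartTransition_eq_map hRG hT]
    exact AffineSpace.isPullback_map _
  have p := p1.paste_horiz p2
  rwa [← chartTransition_comp, Scheme.homOfLE_homOfLE] at p

lemma frameCover_trans (hV : IsLocallyFreeOfRank V n) {F G : (frameCover hV).I₀} (h : F ⟶ G) :
    (frameCover hV).trans h = Y.homOfLE (show Frame.U F ≤ Frame.U G from leOfHom h) := by
  refine (cancel_mono (Scheme.Opens.ι (Frame.U G))).mp ?_
  exact (Scheme.Cover.trans_map (frameCover hV) h).trans (Scheme.homOfLE_ι _ _).symm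

/-- The gluing data of the total space: the affine spaces `𝔸ⁿ_U`, one for every frame of `V`, and the
changes of fibre coordinates. -/
noncomputable def totData (hV : IsLocallyFreeOfRank V n) :
    (frameCover hV).RelativeGluingData where
  functor :=
    { obj F := 𝔸(Fin n; Scheme.Opens.toScheme (Frame.U F))
      map {F G} h := chartTransition (F := F) (G := G) (leOfHom h)
      map_id F := chartTransition_refl F
      map_comp h h' := chartTransition_comp _ _ }
  natTrans :=
    { app F := 𝔸(Fin n; Scheme.Opens.toScheme (Frame.U F)) ↘ (Frame.U F).toScheme
      naturality F G h := by
        rw [Scheme.Cover.functorOfLocallyDirected_map, frameCover_trans]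
        exact chartTransition_over _ }
  equifibered F G h := by
    rw [Scheme.Cover.functorOfLocallyDirected_map, frameCover_trans]
    exact isPullback_chartTransition _

/-- The total space of the vector bundle `V` (its sections over `Y` are the sections of `V`). A frame
of `V` over `U` identifies its restriction to `U` with `𝔸ⁿ_U`. -/
noncomputable def Tot (hV : IsLocallyFreeOfRank V n) : Scheme.{0} := (totData hV).glued

/-- The bundle projection. -/
noncomputable def Tot.proj (hV : IsLocallyFreeOfRank V n) : Tot hV ⟶ Y := (totData hV).toBase

/-- The open immersion `𝔸ⁿ_U → Tot V` given by a frame over `U`. -/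
noncomputable def Tot.chart (hV : IsLocallyFreeOfRank V n) (F : Frame V n) :
    𝔸(Fin n; F.U) ⟶ Tot hV :=
  Limits.colimit.ι (totData hV).functor F

instance (hV : IsLocallyFreeOfRank V n) (F : Frame V n) : IsOpenImmersion (Tot.chart hV F) :=
  (totData hV).cover.map_prop F

lemma Tot.chart_proj (hV : IsLocallyFreeOfRank V n) (F : Frame V n) :
   Tot.chart hV F ≫ Tot.proj hV = (𝔸(Fin n; F.U) ↘ F.U.toScheme) ≫ F.U.ι :=
  (totData hV).ι_toBase F

lemma Tot.chartTransition_chart (hV : IsLocallyFreeOfRank V n) {F G : Frame V n} (h : F.U ≤ G.U) :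
   chartTransition h ≫ Tot.chart hV G = Tot.chart hV F :=
  Limits.colimit.w (totData hV).functor (homOfLE (show (F : (frameCover hV).I₀) ≤ G from h))

lemma Tot.isPullback_chart (hV : IsLocallyFreeOfRank V n) (F : Frame V n) :
   IsPullback (𝔸(Fin n; F.U) ↘ F.U.toScheme) (Tot.chart hV F) F.U.ι (Tot.proj hV) :=
  (totData hV).isPullback_natTrans_ι_toBase F
end TotalSpace

section Components
variable {X Y : Scheme.{0}} {V : Y.Modules} {n : ℕ}

lemma pullbackSection_sum_smul (π : X ⟶ Y) {U : Y.Opens} (a : Fin n → Γ(Y, U)) (s : Fin n → Γ(V, U)) :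
    pullbackSection π (∑ i, a i • s i) = ∑ i, π.app U (a i) • pullbackSection π (s i) := by
  unfold pullbackSection
  rw [map_sum]
  refine Finset.sum_congr rfl fun i _ => ?_
  exact Scheme.Modules.Hom.app_smul _ _ _

lemma pullbackSection_res (π : X ⟶ Y) {U W : Y.Opens} (h : W ≤ U) (s : Γ(V, U)) :
    pullbackSection π (V.presheaf.map (homOfLE h).op s) =
      ((Scheme.Modules.pullback π).obj V).presheaf.map
        (homOfLE (show π ⁻¹ᵁ W ≤ π ⁻¹ᵁ U from fun _ hx => h hx)).op (pullbackSection π s) :=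
  app_res ((Scheme.Modules.pullbackPushforwardAdjunction π).unit.app V) h s

/-- The components `σ_1, …, σ_n` of a section `σ` of `π^* V` in a frame `v_1, …, v_n` of `V`:
over `π⁻¹ U` one has `σ = ∑ i, σ_i • π^* v_i`. -/
noncomputable def components (π : X ⟶ Y) (σ : Γ((Scheme.Modules.pullback π).obj V, ⊤)) (F : Frame V n) :
    Fin n → Γ(X, π ⁻¹ᵁ F.U) :=
  (F.pullback π).coord le_rfl
    (((Scheme.Modules.pullback π).obj V).presheaf.map (homOfLE le_top).op σ)

lemma components_spec (π : X ⟶ Y) (σ : Γ((Scheme.Modules.pullback π).obj V, ⊤)) (F : Frame V n) :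
    ((Scheme.Modules.pullback π).obj V).presheaf.map (homOfLE (le_top : π ⁻¹ᵁ F.U ≤ ⊤)).op σ =
      ∑ i, components π σ F i • pullbackSection π (F.vec i) :=
  (F.pullback π).coord_spec_self _

lemma components_res (π : X ⟶ Y) (σ : Γ((Scheme.Modules.pullback π).obj V, ⊤)) {F G : Frame V n}
    (h : F.U ≤ G.U) (i : Fin n) :
    X.presheaf.map (homOfLE (show π ⁻¹ᵁ F.U ≤ π ⁻¹ᵁ G.U from fun _ hx => h hx)).op
      (components π σ G i) = ∑ j, π.app F.U (Frame.transition h i j) * components π σ F j := by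
  have h' : π ⁻¹ᵁ F.U ≤ π ⁻¹ᵁ G.U := fun _ hx => h hx
  have e1 := congrArg (((Scheme.Modules.pullback π).obj V).presheaf.map (homOfLE h').op)
    (components_spec π σ G)
  rw [Frame.res_res] at e1
  simp only [map_sum, res_smul] at e1
  have e2 := components_spec π σ F
  have this (j : Fin n) : pullbackSection π (F.vec j) =
      ∑ i, π.app F.U (Frame.transition h i j) •
        ((Scheme.Modules.pullback π).obj V).presheaf.map (homOfLE h').op
          (pullbackSection π (G.vec i)) := by
    conv_lhs => rw [Frame.transition_spec h j, pullbackSection_sum_smul]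
    simp only [pullbackSection_res]
  simp only [this, Finset.smul_sum, smul_smul] at e2
  rw [Finset.sum_comm] at e2
  simp only [← Finset.sum_smul] at e2
  have u := ((G.pullback π).existsUnique_coord (π ⁻¹ᵁ F.U) h' _).unique e1 e2
  refine (congrFun u i).trans (Finset.sum_congr rfl fun j _ => mul_comm _ _)

end Components

section Graph
variable {X Y : Scheme.{0}} {V : Y.Modules} {n : ℕ}

/-- The map `x ↦ (π x, σ_1 x, …, σ_n x)` from `π⁻¹ U` to `𝔸ⁿ_U`, for a frame of `V` over `U`. -/
noncomputable def localGraph (π : X ⟶ Y) (σ : Γ((Scheme.Modules.pullback π).obj V, ⊤))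
    (F : Frame V n) : (π ⁻¹ᵁ F.U).toScheme ⟶ 𝔸(Fin n; F.U) :=
  AffineSpace.homOfVector (π ∣_ F.U) fun i => (π ⁻¹ᵁ F.U).topIso.inv (components π σ F i)

lemma homOfLE_morphismRestrict (π : X ⟶ Y) {U W : Y.Opens} (h : U ≤ W) :
    X.homOfLE (show π ⁻¹ᵁ U ≤ π ⁻¹ᵁ W from fun _ hx => h hx) ≫ (π ∣_ W) =
      (π ∣_ U) ≫ Y.homOfLE h := by
  simp [← cancel_mono W.ι]

lemma topIso_inv_res {X : Scheme.{0}} {U W : X.Opens} (h : U ≤ W) (a : Γ(X, W)) :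
    (X.homOfLE h).appTop (W.topIso.inv a) = U.topIso.inv (X.presheaf.map (homOfLE h).op a) := by
  simp only [← CommRingCat.comp_apply]
  congr 2
  simp only [Scheme.homOfLE_appTop, Scheme.Opens.topIso_inv]
  erw [← X.presheaf.map_comp, ← X.presheaf.map_comp]
  rfl

lemma restrict_baseFunction (π : X ⟶ Y) (U : Y.Opens) (a : Γ(Y, U)) :
    (π ∣_ U).appTop (U.topIso.inv a) = (π ⁻¹ᵁ U).topIso.inv (π.app U a) := by
  simp only [← CommRingCat.comp_apply]
  congr 2
  simp only [Scheme.Opens.topIso_inv, Scheme.Hom.app_eq_appLE, Scheme.Hom.appTop,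
    morphismRestrict_appLE]
  erw [Scheme.Hom.map_appLE, Scheme.Hom.appLE_map]
  rfl

lemma localGraph_compat (π : X ⟶ Y) (σ : Γ((Scheme.Modules.pullback π).obj V, ⊤))
    {F G : Frame V n} (h : F.U ≤ G.U) :
    X.homOfLE (show π ⁻¹ᵁ F.U ≤ π ⁻¹ᵁ G.U from fun _ hx => h hx) ≫ localGraph π σ G =
      localGraph π σ F ≫ chartTransition h := by
  apply AffineSpace.hom_ext
  · have := homOfLE_morphismRestrict π h
    simp [localGraph, chartTransition_over, this]
  · intro i
    simp only [Scheme.Hom.comp_appTop, CommRingCat.comp_apply, chartTransition_coord]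
    simp only [localGraph, AffineSpace.homOfVector_appTop_coord, topIso_inv_res,
      map_sum, map_mul, baseFunction, RingHom.comp_apply]
    rw [components_res π σ h, map_sum]
    simp only [map_mul]
    refine Finset.sum_congr rfl fun j _ => ?_
    congr 1
    have e1 := congr(Scheme.Hom.appTop $(AffineSpace.homOfVector_over (π ∣_ F.U) (fun i => (π ⁻¹ᵁ F.U).topIso.inv (components π σ F i))))
    rw [Scheme.Hom.comp_appTop] at e1
    refine Eq.trans ?_ (congr($e1 (F.U.topIso.inv (Frame.transition h i j)))).symm
    exact (restrict_baseFunction π F.U _).symm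

/-- The open cover of `X` by the preimages of the domains of the frames of `V`. -/
noncomputable def pullbackFrameCover (hV : IsLocallyFreeOfRank V n) (π : X ⟶ Y) : X.OpenCover where
  I₀ := Frame V n
  X F := π ⁻¹ᵁ F.U
  f F := (π ⁻¹ᵁ F.U).ι
  mem₀ := by
    rw [Scheme.presieve₀_mem_precoverage_iff]
    refine ⟨fun x ↦ ?_, inferInstance⟩
    obtain ⟨F, hF⟩ := hV (π x)
    exact ⟨F, by simpa using hF⟩

/-- The map `X → Tot V`, `x ↦ (π x, σ x)`. -/
noncomputable def graph (hV : IsLocallyFreeOfRank V n) (π : X ⟶ Y)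
    (σ : Γ((Scheme.Modules.pullback π).obj V, ⊤)) : X ⟶ Tot hV :=
  (pullbackFrameCover hV π).glueMorphisms (fun F => localGraph π σ F ≫ Tot.chart hV F) <| by
    intro F G
    change Frame V n at F G
    refine (cancel_epi (isPullback_opens_inf (π ⁻¹ᵁ F.U) (π ⁻¹ᵁ G.U)).isoPullback.hom).mp ?_
    refine ((isPullback_opens_inf (π ⁻¹ᵁ F.U) (π ⁻¹ᵁ G.U)).isoPullback_hom_fst_assoc _).trans
      (Eq.trans ?_ ((isPullback_opens_inf (π ⁻¹ᵁ F.U) (π ⁻¹ᵁ G.U)).isoPullback_hom_snd_assoc _).symm)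
    have hF : (F.restrict (F.U ⊓ G.U) inf_le_left).U ≤ F.U := inf_le_left
    have hG : (F.restrict (F.U ⊓ G.U) inf_le_left).U ≤ G.U := inf_le_right
    have e1 := localGraph_compat π σ hF =≫ Tot.chart hV F
    have e2 := localGraph_compat π σ hG =≫ Tot.chart hV G
    rw [Category.assoc, Category.assoc, Tot.chartTransition_chart] at e1 e2
    exact e1.trans e2.symm

lemma ι_graph (hV : IsLocallyFreeOfRank V n) (π : X ⟶ Y)
    (σ : Γ((Scheme.Modules.pullback π).obj V, ⊤)) (F : Frame V n) :
    (π ⁻¹ᵁ F.U).ι ≫ graph hV π σ = localGraph π σ F ≫ Tot.chart hV F :=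
  (pullbackFrameCover hV π).ι_glueMorphisms _ _ F

lemma graph_proj (hV : IsLocallyFreeOfRank V n) (π : X ⟶ Y)
    (σ : Γ((Scheme.Modules.pullback π).obj V, ⊤)) : graph hV π σ ≫ Tot.proj hV = π := by
  apply (pullbackFrameCover hV π).hom_ext
  intro F
  change Frame V n at F
  refine (Category.assoc _ _ _).symm.trans ((ι_graph hV π σ F =≫ _).trans ?_)
  have h : localGraph π σ F ≫ (𝔸(Fin n; F.U) ↘ F.U.toScheme) = π ∣_ F.U := by simp [localGraph]
  refine (Category.assoc _ _ _).trans ((localGraph π σ F ≫= Tot.chart_proj hV F).trans ?_)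
  rw [reassoc_of% h, morphismRestrict_ι]
  rfl

end Graph


section Higgs
open TensorProduct
variable {X Y : Scheme.{0}}

/-- A `V`-twisted Higgs field on `E`, i.e. a map `Φ : E → E ⊗ V` of `𝒪_Y`-modules with `Φ ∧ Φ = 0`,
for `V` locally free of rank `n`. Over the domain of a frame `v_1, …, v_n` of `V` it is
`Φ = ∑ j, Φ_j ⊗ v_j` with endomorphisms `Φ_j = comp F j` of `E`, which transform like the components
of a section of `V` (restriction of a frame is one of these transformations, so that the `Φ_j` are
compatible with restriction). The condition `Φ ∧ Φ = 0` says that the `Φ_j` commute. -/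
structure HiggsField (E V : Y.Modules) (n : ℕ) where
  comp (F : Frame V n) : Fin n → Module.End Γ(Y, F.U) Γ(E, F.U)
  comp_res {F G : Frame V n} (h : F.U ≤ G.U) (i : Fin n) (s : Γ(E, G.U)) :
    E.presheaf.map (homOfLE h).op (comp G i s) =
      ∑ j, Frame.transition h i j • comp F j (E.presheaf.map (homOfLE h).op s)
  comm (F : Frame V n) (i j : Fin n) : Commute (comp F i) (comp F j)

/-- The Higgs field on `π_* M` which is the pushforward of `m ↦ m ⊗ σ`: its component `Φ_j` is
multiplication by `σ_j`. -/
noncomputable def pushforwardHiggs (π : X ⟶ Y) (M : X.Modules) {V : Y.Modules} {n : ℕ}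
    (σ : Γ((Scheme.Modules.pullback π).obj V, ⊤)) :
    HiggsField ((Scheme.Modules.pushforward π).obj M) V n where
  comp F j :=
    { toFun := fun (s : Γ(M, π ⁻¹ᵁ F.U)) => (components π σ F j • s : Γ(M, π ⁻¹ᵁ F.U))
      map_add' := fun (s t : Γ(M, π ⁻¹ᵁ F.U)) => smul_add (components π σ F j) s t
      map_smul' := fun a (s : Γ(M, π ⁻¹ᵁ F.U)) => smul_comm (components π σ F j) (π.app F.U a) s }
  comp_res {F G} h i s := by
    have h' : π ⁻¹ᵁ F.U ≤ π ⁻¹ᵁ G.U := fun _ hx => h hx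
    refine (res_smul (V := M) h' (components π σ G i) s).trans ?_
    rw [components_res π σ h, Finset.sum_smul]
    simp only [mul_smul]
    rfl
  comm F i j := LinearMap.ext fun (s : Γ(M, π ⁻¹ᵁ F.U)) =>
    smul_comm (components π σ F i) (components π σ F j) s

/-- The global sections of `Sym^d V` for `V` locally free of rank `n`: in every frame
`v_1, …, v_n` of `V` over `U` such a section is a homogeneous polynomial `poly F` of degree `d` in
`v_1, …, v_n` with coefficients in `𝒪_Y(U)`, and these agree under changes of frame,
`F.vec j = ∑ i, T i j • G.vec i`. -/
@[ext]
structure SymSection (V : Y.Modules) (n d : ℕ) where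
  poly (F : Frame V n) : MvPolynomial (Fin n) Γ(Y, F.U)
  isHomogeneous (F : Frame V n) : (poly F).IsHomogeneous d
  poly_res {F G : Frame V n} (h : F.U ≤ G.U) :
    MvPolynomial.map (Y.presheaf.map (homOfLE h).op).hom (poly G) =
      MvPolynomial.aeval (fun j => ∑ i, MvPolynomial.C (Frame.transition h i j) * MvPolynomial.X i)
        (poly F)

/-- The polynomials `η^r + s_1 η^(r-1) + … + s_r` with `s_i ∈ H⁰(Y, Sym^i V)`; the value at `i : Fin r`
is the coefficient `s_(i+1)`. -/
def SpectralPolynomial (V : Y.Modules) (n r : ℕ) := (i : Fin r) → SymSection V n (i + 1)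

/-- The expression of `η^r + s_1 η^(r-1) + … + s_r` in a frame. -/
noncomputable def SpectralPolynomial.toPolynomial {V : Y.Modules} {n r : ℕ}
    (f : SpectralPolynomial V n r) (F : Frame V n) :
    Polynomial (MvPolynomial (Fin n) Γ(Y, F.U)) :=
  Polynomial.X ^ r + ∑ i : Fin r, Polynomial.C ((f i).poly F) * Polynomial.X ^ (r - 1 - i)

/-- A Higgs field in a frame, as the element `∑ j, v_j ⊗ Φ_j` of `Sym V ⊗ End E`. -/
noncomputable def HiggsField.toTensor {E V : Y.Modules} {n : ℕ} (Φ : HiggsField E V n) (F : Frame V n) :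
    MvPolynomial (Fin n) Γ(Y, F.U) ⊗[Γ(Y, F.U)] Module.End Γ(Y, F.U) Γ(E, F.U) :=
  ∑ j, MvPolynomial.X j ⊗ₜ Φ.comp F j

/-- `Φ^r + s_1 Φ^(r-1) + … + s_r = 0` in `Sym^r V ⊗ End E`. -/
def SpectralPolynomial.Annihilates {E V : Y.Modules} {n r : ℕ}
    (f : SpectralPolynomial V n r) (Φ : HiggsField E V n) : Prop :=
  ∀ F : Frame V n, Polynomial.aeval (Φ.toTensor F) (f.toPolynomial F) = 0

/-- The section `f(η)` of the pullback of `Sym^r V` to `Tot V`, in the chart given by a frame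
`v_1, …, v_n`: here `η = ∑ j, x_j v_j` is the tautological section, with `x_j` the fibre
coordinates. -/
noncomputable def SpectralPolynomial.evalTautological {V : Y.Modules} {n r : ℕ}
    (f : SpectralPolynomial V n r) (F : Frame V n) :
    MvPolynomial (Fin n) Γ(𝔸(Fin n; F.U), ⊤) :=
  Polynomial.eval₂ (MvPolynomial.map (baseFunction n F.U))
    (∑ j, MvPolynomial.C (AffineSpace.coord F.U.toScheme j) * MvPolynomial.X j) (f.toPolynomial F)

/-- The ideal sheaf of the zero scheme of the section `f(η)` on `Tot V`: the smallest
quasi-coherent ideal sheaf which contains the coefficients of `f(η)` in all frames. -/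
noncomputable def SpectralPolynomial.idealSheaf {V : Y.Modules} {n r : ℕ}
    (hV : IsLocallyFreeOfRank V n) (f : SpectralPolynomial V n r) : (Tot hV).IdealSheafData :=
  sInf {I | ∀ (F : Frame V n) (α : Fin n →₀ ℕ) (W : (Tot hV).affineOpens)
    (hW : W.1 ≤ Tot.chart hV F ''ᵁ ⊤),
    (Tot hV).presheaf.map (homOfLE hW).op
      (((Tot.chart hV F).appIso ⊤).inv ((f.evalTautological F).coeff α)) ∈ I.ideal W}

/-- The spectral cover: the closed subscheme of `Tot V` cut out by `f(η) = 0`. -/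
noncomputable def SpectralPolynomial.spectralCover {V : Y.Modules} {n r : ℕ}
    (hV : IsLocallyFreeOfRank V n) (f : SpectralPolynomial V n r) : Scheme.{0} :=
  (f.idealSheaf hV).subscheme

/-- The inclusion of the spectral cover in `Tot V`. -/
noncomputable def SpectralPolynomial.spectralCoverι {V : Y.Modules} {n r : ℕ}
    (hV : IsLocallyFreeOfRank V n) (f : SpectralPolynomial V n r) :
    f.spectralCover hV ⟶ Tot hV :=
  (f.idealSheaf hV).subschemeι

end Higgs

section Varieties

attribute [local instance] MvPolynomial.gradedAlgebra

/-- Projective space `ℙᴺ` over `ℂ`. -/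
noncomputable def projectiveSpace (N : ℕ) : Scheme.{0} :=
  Proj (MvPolynomial.homogeneousSubmodule (Fin (N + 1)) ℂ)

/-- The structure morphism of `ℙᴺ`. -/
noncomputable def projectiveSpaceToSpec (N : ℕ) : projectiveSpace N ⟶ Spec (.of ℂ) :=
  Proj.toSpecZero (MvPolynomial.homogeneousSubmodule (Fin (N + 1)) ℂ) ≫
    Spec.map (CommRingCat.ofHom
      (algebraMap ℂ (MvPolynomial.homogeneousSubmodule (Fin (N + 1)) ℂ 0)))

/-- Smooth projective schemes over `ℂ`. -/
structure IsSmoothProjective {X : Scheme.{0}} (s : X ⟶ Spec (.of ℂ)) : Prop where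
  smooth : Smooth s
  projective : ∃ (N : ℕ) (i : X ⟶ projectiveSpace N), IsClosedImmersion i ∧
    i ≫ projectiveSpaceToSpec N = s

/-- The degree of a finite surjective morphism of integral schemes: the degree of the extension of
function fields (the stalks at the generic points). -/
noncomputable def degree {X Y : Scheme.{0}} [IsIntegral X] (π : X ⟶ Y) : ℕ :=
  letI : Algebra (Y.presheaf.stalk (π (genericPoint X))) (X.presheaf.stalk (genericPoint X)) :=
    (π.stalkMap (genericPoint X)).hom.toAlgebra
  Module.finrank (Y.presheaf.stalk (π (genericPoint X))) (X.presheaf.stalk (genericPoint X))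

/-- A birational morphism: it restricts to an isomorphism between dense open subschemes. -/
def IsBirationalMorphism {X Z : Scheme.{0}} (ψ : X ⟶ Z) : Prop :=
  ∃ e : X.PartialIso Z, e.iso.hom ≫ e.target.ι = e.source.ι ≫ ψ

end Varieties

end SpectralCover

open SpectralCover

/-! Let `K = ℂ(Y)` and `L = ℂ(X)` (`BaseField π` and `TopField X`), so that `[L : K] = r`, and write
`σ = ∑ j, s_j v_j` in a frame of `V`, with germs `s_j ∈ L` at the generic point.

Some `s_i` generates `L` over `K` (`exists_adjoin_eq_top`). Indeed, if all `s_j` lay in `K`, they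
would be integral over the functions on affine opens of `Y`, because `π` is finite. They would then
be regular because `Y` is normal, and `σ` would be a pullback (`exists_pullbackSection_eq`). So some
`s_i` is not in `K`, and an extension of prime degree has no proper intermediate fields.

The Higgs field acts through multiplication by `σ`, and functions act faithfully on `M` near the
generic point. Hence `f(Φ) = 0` amounts to `f(∑ j, s_j v_j) = 0` in `L[v]`. The `r` embeddings `τ`
of `L` in the algebraic closure of `K` turn this root into `r` distinct roots `∑ j, τ(s_j) v_j`,
which determine a monic `f` of degree `r` (`eq_of_linEval_eq_zero`). It has to be the norm `∏ τ, (η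
- ∑ j, τ(s_j) v_j)`. Conversely, the coefficients of the norm are Galois invariant, hence in `K`,
and they are integral over functions on `Y`, hence regular. Uniqueness over `K` makes the norms in
different frames compatible.

For the spectral cover there are two points.

Generically it is `X`. Setting `v = e_i` in `f(∑ j, x_j v_j) = 0` gives the minimal polynomial
equation of `s_i` for `x_i`. The derivative in direction `v_j` at `e_i` then expresses `x_j` through
`x_i`, since the minimal polynomial is separable. So the zero scheme over `K` is `Spec L`, with its
reduced structure (`exists_algHom_of_linEval_eq_zero`). Clearing finitely many denominators extends
this to a nonempty affine open of `Y` (`exists_frame`), over which the graph of `σ` is a closed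
immersion onto the zero scheme.

No component lies over a proper closed subset of `Y`. Let `x` be a point of the zero scheme with
values in a field `k`, over `φ : A → k`. Extend `φ` to the integral closure of `A` in the algebraic
closure of `K`. There `f` splits into linear factors, so `x` is the specialisation of a conjugate of
`s` and satisfies every polynomial relation that `s` satisfies (`eval₂_eq_zero_of_linEval_eq_zero`).
Hence `x` lies in the closure of the graph, which is closed because `π` is finite. So `ψ` is
surjective, and the open set found above has dense image. -/

namespace SpectralCover

/-! ### Evaluation of polynomials at linear forms -/

section ConjugatePolynomial

variable {ι R S T : Type*} [Fintype ι] [CommRing R] [CommRing S] [CommRing T]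

/-- The linear form `∑ j, s_j v_j` with coefficients `s_j`. -/
noncomputable def linearForm (s : ι → R) : MvPolynomial ι R :=
  ∑ j, MvPolynomial.C (s j) * MvPolynomial.X j

/-- Evaluation of a polynomial in `η` over `R[v]` at `η = ∑ j, s_j v_j`. -/
noncomputable def linEval (φ : R →+* S) (s : ι → S) :
    Polynomial (MvPolynomial ι R) →+* MvPolynomial ι S :=
  Polynomial.eval₂RingHom (MvPolynomial.map φ) (linearForm s)

lemma map_linearForm (φ : R →+* S) (s : ι → R) :
    MvPolynomial.map φ (linearForm s) = linearForm (φ ∘ s) := by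
  simp [linearForm]

lemma isHomogeneous_linearForm (s : ι → R) : (linearForm s).IsHomogeneous 1 :=
  MvPolynomial.IsHomogeneous.sum _ _ _ fun _ _ => by
    simpa using (MvPolynomial.isHomogeneous_C _ _).mul (MvPolynomial.isHomogeneous_X _ _)

lemma coeff_linearForm [DecidableEq ι] (s : ι → R) (j : ι) :
    (linearForm s).coeff (Finsupp.single j 1) = s j := by
  simp only [linearForm, MvPolynomial.coeff_sum, MvPolynomial.coeff_C_mul, MvPolynomial.coeff_X]
  simp [Finsupp.single_left_inj]

lemma linearForm_injective : Function.Injective (linearForm : (ι → R) → MvPolynomial ι R) := by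
  classical
  intro s t h
  funext j
  rw [← coeff_linearForm s, h, coeff_linearForm]

lemma map_linEval (ψ : S →+* T) (φ : R →+* S) (s : ι → S) (f : Polynomial (MvPolynomial ι R)) :
    MvPolynomial.map ψ (linEval φ s f) = linEval (ψ.comp φ) (ψ ∘ s) f := by
  simp only [linEval, Polynomial.coe_eval₂RingHom, Polynomial.hom_eval₂, map_linearForm]
  congr 1
  ext <;> simp

lemma linEval_map (ψ : S →+* T) (φ : R →+* S) (s : ι → T) (f : Polynomial (MvPolynomial ι R)) :
    linEval ψ s (f.map (MvPolynomial.map φ)) = linEval (ψ.comp φ) s f := by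
  simp only [linEval, Polynomial.coe_eval₂RingHom, Polynomial.eval₂_map]
  congr 1
  ext <;> simp

lemma linEval_prod {κ : Type*} (T : Finset κ) (t : κ → ι → S) (φ : S →+* R) (s : ι → R) :
    linEval φ s (∏ k ∈ T, (Polynomial.X - Polynomial.C (linearForm (t k)))) =
      ∏ k ∈ T, linearForm (s - φ ∘ t k) := by
  rw [map_prod]
  refine Finset.prod_congr rfl fun k _ => ?_
  rw [map_sub]
  simp only [linEval, Polynomial.coe_eval₂RingHom, Polynomial.eval₂_X, Polynomial.eval₂_C,
    map_linearForm]
  simp [linearForm, sub_mul, Finset.sum_sub_distrib]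

omit [Fintype ι] in
lemma exists_map_map_eq (φ : R →+* S) (f : Polynomial (MvPolynomial ι S))
    (h : ∀ i α, (f.coeff i).coeff α ∈ φ.range) :
    ∃ g : Polynomial (MvPolynomial ι R), g.map (MvPolynomial.map φ) = f := by
  change f ∈ (Polynomial.mapRingHom (MvPolynomial.map (σ := ι) φ)).range
  rw [Polynomial.mem_map_range]
  intro i
  change f.coeff i ∈ Set.range (MvPolynomial.map (σ := ι) φ)
  rw [MvPolynomial.mem_range_map_iff_coeffs_subset]
  intro c hc
  obtain ⟨α, _, rfl⟩ := MvPolynomial.mem_coeffs_iff.mp hc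
  exact h i α

/-- If `η` has weight 1 like the `v_j`, each factor is homogeneous of weight 1, so the coefficient
of `η^i` has the remaining degree. -/
lemma isHomogeneous_coeff_prod [Nontrivial R] {κ : Type*} (T : Finset κ) (t : κ → ι → R) (i d : ℕ)
    (h : i + d = T.card) :
    ((∏ k ∈ T, (Polynomial.X - Polynomial.C (linearForm (t k)))).coeff i).IsHomogeneous d := by
  classical
  induction T using Finset.induction generalizing i d with
  | empty =>
    obtain ⟨rfl, rfl⟩ : i = 0 ∧ d = 0 := by simpa using h
    simpa using MvPolynomial.isHomogeneous_one _ _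
  | insert k T hk ih =>
    rw [Finset.card_insert_of_notMem hk] at h
    rw [Finset.prod_insert hk]
    set p := ∏ k ∈ T, (Polynomial.X - Polynomial.C (linearForm (t k))) with hp
    rw [sub_mul, Polynomial.coeff_sub, Polynomial.coeff_C_mul]
    have h2 : (linearForm (t k) * p.coeff i).IsHomogeneous d := by
      -- For `d = 0` the index `i` exceeds the degree of the product over `T`, and the induction
      -- hypothesis has nothing to say.
      rcases d with _ | d
      · have : p.coeff i = 0 := by
          apply Polynomial.coeff_eq_zero_of_natDegree_lt
          rw [hp, Polynomial.natDegree_finsetProd_X_sub_C_eq_card]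
          omega
        rw [this, mul_zero]
        exact MvPolynomial.isHomogeneous_zero _ _ _
      · rw [add_comm d 1]
        exact (isHomogeneous_linearForm _).mul (ih i d (by omega))
    rcases i with _ | i
    · simpa using h2.neg
    · rw [Polynomial.coeff_X_mul]
      exact (ih i d (by omega)).sub h2

end ConjugatePolynomial

/-! ### The norm of a linear form over a field -/

section Fields
variable {ι : Type*} [Fintype ι] {K L : Type*} [Field K] [Field L] [Algebra K L]
  [FiniteDimensional K L]

/-- The product of `η - ∑ j, τ(s_j) v_j` over all embeddings `τ` of `L` over `K`. -/
noncomputable def conjProd (K : Type*) {L : Type*} [Field K] [Field L] [Algebra K L]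
    [FiniteDimensional K L] (s : ι → L) : Polynomial (MvPolynomial ι (AlgebraicClosure K)) :=
  ∏ τ : L →ₐ[K] AlgebraicClosure K, (Polynomial.X - Polynomial.C (linearForm (τ ∘ s)))

/-- The polynomial `f` over `K[v]` is the norm of `η - ∑ j, s_j v_j`. -/
def IsConjPoly (s : ι → L) (f : Polynomial (MvPolynomial ι K)) : Prop :=
  f.map (MvPolynomial.map (algebraMap K (AlgebraicClosure K))) = conjProd K s

/-- The Galois group of the algebraic closure permutes the embeddings of `L`, hence the factors. In
characteristic zero the invariants are `K`. -/
theorem exists_isConjPoly [CharZero K] (s : ι → L) :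
    ∃ f : Polynomial (MvPolynomial ι K), IsConjPoly s f := by
  classical
  have key (g : AlgebraicClosure K ≃ₐ[K] AlgebraicClosure K) :
      (conjProd K s).map (MvPolynomial.map (g : AlgebraicClosure K →+* AlgebraicClosure K)) =
        conjProd K s := by
    rw [conjProd, Polynomial.map_prod]
    refine Fintype.prod_equiv ⟨fun τ => (g : AlgebraicClosure K →ₐ[K] _).comp τ,
      fun τ => (g.symm : AlgebraicClosure K →ₐ[K] _).comp τ, fun τ => ?_, fun τ => ?_⟩ _ _ fun τ => ?_
    · ext; simp
    · ext; simp
    · simp only [Polynomial.map_sub, Polynomial.map_X, Polynomial.map_C, map_linearForm]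
      rfl
  have h (i : ℕ) (α : ι →₀ ℕ) : ((conjProd K s).coeff i).coeff α ∈
      (algebraMap K (AlgebraicClosure K)).range := by
    apply (InfiniteGalois.mem_range_algebraMap_iff_fixed _).mpr
    intro g
    conv_rhs => rw [← key g]
    rw [Polynomial.coeff_map, MvPolynomial.coeff_map]
    rfl
  exact exists_map_map_eq _ _ h

omit [Fintype ι] in
lemma map_algebraMap_injective : Function.Injective
    (MvPolynomial.map (σ := ι) (algebraMap K (AlgebraicClosure K))) :=
  MvPolynomial.map_injective _ (algebraMap K (AlgebraicClosure K)).injective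

variable [CharZero K] {s : ι → L} {f : Polynomial (MvPolynomial ι K)}

lemma card_embeddings : Fintype.card (L →ₐ[K] AlgebraicClosure K) = Module.finrank K L :=
  AlgHom.card K L (AlgebraicClosure K)

omit [CharZero K] in
lemma IsConjPoly.monic (hf : IsConjPoly s f) : f.Monic := by
  apply Polynomial.monic_of_injective map_algebraMap_injective
  rw [hf]
  exact Polynomial.monic_prod_of_monic _ _ fun _ _ => Polynomial.monic_X_sub_C _

lemma IsConjPoly.natDegree (hf : IsConjPoly s f) : f.natDegree = Module.finrank K L := by
  rw [← Polynomial.natDegree_map_eq_of_injective map_algebraMap_injective, hf, conjProd,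
    Polynomial.natDegree_finsetProd_X_sub_C_eq_card, Finset.card_univ, card_embeddings]

lemma IsConjPoly.isHomogeneous (hf : IsConjPoly s f) {i d : ℕ}
    (h : i + d = Module.finrank K L) : (f.coeff i).IsHomogeneous d := by
  apply MvPolynomial.IsHomogeneous.of_map (algebraMap K (AlgebraicClosure K)).injective
  rw [← Polynomial.coeff_map, hf]
  exact isHomogeneous_coeff_prod _ _ _ _ (by rw [h, Finset.card_univ, card_embeddings])

/-- After applying one embedding `τ`, the factor of the norm indexed by `τ` vanishes; `τ` is
injective on coefficients. -/
lemma IsConjPoly.linEval_eq_zero (hf : IsConjPoly s f) : linEval (algebraMap K L) s f = 0 := by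
  let τ : L →ₐ[K] AlgebraicClosure K := IsAlgClosed.lift
  apply MvPolynomial.map_injective (τ : L →+* AlgebraicClosure K) τ.toRingHom.injective
  rw [map_linEval, map_zero]
  have : (τ : L →+* AlgebraicClosure K).comp (algebraMap K L) =
    (RingHom.id _).comp (algebraMap K (AlgebraicClosure K)) := by ext; simp
  rw [this, ← linEval_map, hf, conjProd, linEval_prod]
  refine Finset.prod_eq_zero (Finset.mem_univ τ) ?_
  simp [linearForm]

/-- Two monic polynomials of degree `[L : K]` with root `∑ j, s_j v_j` agree if `s_i` generates
`L`. -/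
theorem eq_of_linEval_eq_zero {i : ι} (hi : IntermediateField.adjoin K {s i} = ⊤)
    {f g : Polynomial (MvPolynomial ι K)}
    (hf : f.Monic) (hfd : f.natDegree = Module.finrank K L) (hf0 : linEval (algebraMap K L) s f = 0)
    (hg : g.Monic) (hgd : g.natDegree = Module.finrank K L)
    (hg0 : linEval (algebraMap K L) s g = 0) : f = g := by
  apply Polynomial.map_injective _ map_algebraMap_injective
  rw [← sub_eq_zero, ← Polynomial.map_sub]
  have hd : Polynomial.degree (f - g) < Module.finrank K L := by
    rw [← hfd, ← Polynomial.degree_eq_natDegree hf.ne_zero]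
    refine Polynomial.degree_sub_lt_left ?_ hf.ne_zero (hf.trans hg.symm)
    rw [Polynomial.degree_eq_natDegree hf.ne_zero, Polynomial.degree_eq_natDegree hg.ne_zero, hfd, hgd]
  -- An embedding is determined by its value at the generator `s i`. So `f - g`, of degree less than
  -- `[L : K]`, has `[L : K]` distinct roots in a domain.
  have hinj : Function.Injective fun τ : L →ₐ[K] AlgebraicClosure K => linearForm (τ ∘ s) := by
    intro τ τ' h
    have h1 : τ (s i) = τ' (s i) := congrFun (linearForm_injective h) i
    refine AlgHom.ext_of_adjoin_eq_top (s := {s i}) ?_ (by simpa [Set.EqOn] using h1)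
    rw [← IntermediateField.adjoin_simple_toSubalgebra_of_isAlgebraic (Algebra.IsAlgebraic.isAlgebraic _), hi]
    rfl
  refine Polynomial.eq_zero_of_degree_lt_of_eval_index_eq_zero (s := Finset.univ)
    (v := fun τ : L →ₐ[K] AlgebraicClosure K => linearForm (τ ∘ s)) hinj.injOn ?_ ?_
  · rw [Finset.card_univ, card_embeddings]
    exact Polynomial.degree_map_le.trans_lt hd
  · intro τ _
    have h1 : linEval (algebraMap K L) s (f - g) = 0 := by rw [map_sub, hf0, hg0, sub_zero]
    have h2 := congrArg (MvPolynomial.map (τ : L →+* AlgebraicClosure K)) h1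
    rw [map_linEval, map_zero] at h2
    rw [Polynomial.eval_map]
    refine Eq.trans ?_ h2
    simp only [linEval, Polynomial.coe_eval₂RingHom]
    congr 2
    ext; simp

end Fields

/-! ### Specialisation of conjugates along integral extensions -/

lemma exists_extension_of_injective {A R Ω : Type*} [CommRing A] [CommRing R] [IsDomain R] [Field Ω]
    [IsAlgClosed Ω] (i : A →+* R) (hi : i.IsIntegral) (hinj : Function.Injective i)
    (φ : A →+* Ω) (hφ : Function.Injective φ) : ∃ ψ : R →+* Ω, ψ.comp i = φ := by
  let : Algebra A R := i.toAlgebra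
  let : Algebra A Ω := φ.toAlgebra
  have : FaithfulSMul A Ω := (faithfulSMul_iff_algebraMap_injective _ _).mpr hφ
  have : FaithfulSMul A R := (faithfulSMul_iff_algebraMap_injective _ _).mpr hinj
  have : IsDomain A := hinj.isDomain i
  have : Module.IsTorsionFree A R := Module.isTorsionFree_iff_faithfulSMul.mpr inferInstance
  have : Algebra.IsIntegral A R := ⟨hi⟩
  let θ : R →ₐ[A] Ω := IsAlgClosed.lift
  exact ⟨θ, θ.comp_algebraMap⟩

/-- A homomorphism from `A` to an algebraically closed field extends to an integral extension of
`A`. -/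
lemma exists_extension_of_isIntegral {A R Ω : Type*} [CommRing A] [CommRing R] [Field Ω]
    [IsAlgClosed Ω] [Algebra A R] [Algebra.IsIntegral A R]
    (hinj : Function.Injective (algebraMap A R)) (φ : A →+* Ω) :
    ∃ ψ : R →+* Ω, ψ.comp (algebraMap A R) = φ := by
  -- Dividing by the kernel of `φ` and by a prime of `R` above it reduces to injective maps between
  -- domains.
  obtain ⟨P, hP⟩ : ∃ P, P = RingHom.ker φ := ⟨_, rfl⟩
  have : P.IsPrime := hP ▸ RingHom.ker_isPrime φ
  obtain ⟨Q, _, hQ, hQP⟩ := Ideal.exists_ideal_over_prime_of_isIntegral P (⊥ : Ideal R)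
    (by rw [← RingHom.ker_eq_comap_bot, (RingHom.injective_iff_ker_eq_bot _).mp hinj]; exact bot_le)
  subst hQP
  have hint : (Ideal.quotientMap Q (algebraMap A R) le_rfl).IsIntegral :=
    (algebraMap_isIntegral_iff.mpr inferInstance).quotient
  have hφ (a) (ha : a ∈ Q.comap (algebraMap A R)) : φ a = 0 := by rwa [hP] at ha
  have hφ' : Function.Injective (Ideal.Quotient.lift _ φ hφ) := by
    rw [injective_iff_map_eq_zero]
    intro a ha
    obtain ⟨a, rfl⟩ := Ideal.Quotient.mk_surjective a
    rw [Ideal.Quotient.lift_mk] at ha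
    rw [Ideal.Quotient.eq_zero_iff_mem, hP]
    exact ha
  obtain ⟨θ, hθ⟩ := exists_extension_of_injective _ hint
    (Ideal.quotientMap_injective' le_rfl) _ hφ'
  refine ⟨θ.comp (Ideal.Quotient.mk Q), ?_⟩
  refine RingHom.ext fun a => ?_
  have h := RingHom.congr_fun hθ (Ideal.Quotient.mk _ a)
  rwa [RingHom.comp_apply, Ideal.quotientMap_mk, Ideal.Quotient.lift_mk] at h

section Fields
variable {ι : Type*} [Fintype ι] {K L : Type*} [Field K] [Field L] [Algebra K L]
  [FiniteDimensional K L] {s : ι → L} {f : Polynomial (MvPolynomial ι K)}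
  {A : Type*} [CommRing A] [Algebra A K] [Algebra A L] [IsScalarTower A K L]

/-- The conjugates of integral elements, as elements of the integral closure. -/
noncomputable def integralConj (K : Type*) {L : Type*} [Field K] [Field L] [Algebra K L] [Algebra A K]
    [Algebra A L] [IsScalarTower A K L] {s : ι → L} (hs : ∀ j, IsIntegral A (s j))
    (τ : L →ₐ[K] AlgebraicClosure K) (j : ι) :
    integralClosure A (AlgebraicClosure K) :=
  ⟨τ (s j), (hs j).map (τ.restrictScalars A)⟩

/-- The product of `η - ∑ j, τ(s_j) v_j` over the integral closure. -/
noncomputable def integralConjProd (K : Type*) {L : Type*} [Field K] [Field L] [Algebra K L]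
    [Algebra A K] [FiniteDimensional K L]
    [Algebra A L] [IsScalarTower A K L] {s : ι → L} (hs : ∀ j, IsIntegral A (s j)) :
    Polynomial (MvPolynomial ι (integralClosure A (AlgebraicClosure K))) :=
  ∏ τ : L →ₐ[K] AlgebraicClosure K,
    (Polynomial.X - Polynomial.C (linearForm (integralConj K hs τ)))

lemma map_integralConjProd (hs : ∀ j, IsIntegral A (s j)) :
    (integralConjProd K hs).map (MvPolynomial.map
      (algebraMap (integralClosure A (AlgebraicClosure K)) (AlgebraicClosure K))) =
      conjProd K s := by
  rw [integralConjProd, conjProd, Polynomial.map_prod]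
  refine Finset.prod_congr rfl fun τ _ => ?_
  rw [Polynomial.map_sub, Polynomial.map_X, Polynomial.map_C, map_linearForm]
  rfl

/-- The conjugates of integral elements are integral, so the norm is already defined over the
integral closure. -/
lemma IsConjPoly.isIntegral_coeff (hf : IsConjPoly s f) (hs : ∀ j, IsIntegral A (s j)) (i : ℕ)
    (α : ι →₀ ℕ) : IsIntegral A ((f.coeff i).coeff α) := by
  rw [← isIntegral_algebraMap_iff (algebraMap K (AlgebraicClosure K)).injective,
    ← MvPolynomial.coeff_map, ← Polynomial.coeff_map, hf, ← map_integralConjProd hs,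
    Polynomial.coeff_map, MvPolynomial.coeff_map]
  exact (((integralConjProd K hs).coeff i).coeff α).2

/-- A point `x` of the fibre over `φ : A → k` with `f(∑ j, x_j v_j) = 0` is a conjugate of `s`, so that
every polynomial relation of `s` holds for `x`. -/
theorem eval₂_eq_zero_of_linEval_eq_zero [FaithfulSMul A K] {f : Polynomial (MvPolynomial ι A)}
    (hf : IsConjPoly s (f.map (MvPolynomial.map (algebraMap A K)))) (hs : ∀ j, IsIntegral A (s j))
    {k : Type*} [Field k] (φ : A →+* k) (x : ι → k) (hx : linEval φ x f = 0)
    (g : MvPolynomial ι A) (hg : MvPolynomial.aeval s g = 0) :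
    MvPolynomial.eval₂ φ x g = 0 := by
  let R := integralClosure A (AlgebraicClosure K)
  have hAΩ : Function.Injective (algebraMap A (AlgebraicClosure K)) := by
    rw [IsScalarTower.algebraMap_eq A K (AlgebraicClosure K)]
    exact (algebraMap K (AlgebraicClosure K)).injective.comp (FaithfulSMul.algebraMap_injective A K)
  have hAR : Function.Injective (algebraMap A R) := by
    rw [IsScalarTower.algebraMap_eq A R (AlgebraicClosure K), RingHom.coe_comp] at hAΩ
    exact Function.Injective.of_comp hAΩ
  obtain ⟨ψ, hψ⟩ := exists_extension_of_isIntegral hAR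
    ((algebraMap k (AlgebraicClosure k)).comp φ)
  have hfR : f.map (MvPolynomial.map (algebraMap A R)) = integralConjProd K hs := by
    apply Polynomial.map_injective _ (MvPolynomial.map_injective (σ := ι)
      (algebraMap R (AlgebraicClosure K)) Subtype.val_injective)
    rw [map_integralConjProd, ← hf, Polynomial.map_map, Polynomial.map_map]
    congr 1
    ext <;> simp [← IsScalarTower.algebraMap_apply]
  have h0 : linEval ψ (algebraMap k (AlgebraicClosure k) ∘ x) (integralConjProd K hs) = 0 := by
    rw [← hfR, linEval_map, hψ, ← map_linEval, hx, map_zero]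
  -- The specialised norm is a product in a polynomial ring over a field. Some factor vanishes, and
  -- the coefficients of this linear form identify `x` with the specialisation of `τ ∘ s`.
  rw [integralConjProd, linEval_prod, Finset.prod_eq_zero_iff] at h0
  obtain ⟨τ, -, hτ⟩ := h0
  have hx' : algebraMap k (AlgebraicClosure k) ∘ x = ψ ∘ integralConj K hs τ := by
    rw [← sub_eq_zero]
    apply linearForm_injective
    rw [hτ]
    simp [linearForm]
  apply (algebraMap k (AlgebraicClosure k)).injective
  rw [map_zero, MvPolynomial.hom_eval₂, ← hψ]
  change MvPolynomial.eval₂ _ (algebraMap k (AlgebraicClosure k) ∘ x) g = 0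
  rw [hx']
  refine (MvPolynomial.hom_eval₂ g (algebraMap A R) ψ (integralConj K hs τ)).symm.trans ?_
  -- The relation `g` passes from `s` to its conjugate by applying `τ`, and holds in the integral
  -- closure because that is a subring of the algebraic closure.
  rw [show MvPolynomial.eval₂ (algebraMap A R) (integralConj K hs τ) g = 0 from ?_, map_zero]
  apply Subtype.val_injective
  have h1 : (algebraMap R (AlgebraicClosure K)) (MvPolynomial.eval₂ (algebraMap A R) (integralConj K hs τ) g) =
      τ (MvPolynomial.aeval s g) := by
    rw [MvPolynomial.hom_eval₂, MvPolynomial.aeval_def, ← AlgHom.coe_toRingHom, MvPolynomial.hom_eval₂,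
      ← IsScalarTower.algebraMap_eq]
    congr 1
    ext a
    simp [IsScalarTower.algebraMap_apply A K (AlgebraicClosure K)]
  exact h1.trans (by rw [hg, map_zero]; rfl)

end Fields

/-! ### The zero scheme of the norm over the function field -/

section Reducedness
variable {ι : Type*} [Fintype ι] [DecidableEq ι] {K : Type*} [Field K]

/-- The coefficients of the derivative of `f` in the direction of `v_j` at the `i`-th unit vector. -/
noncomputable def pderivAt (f : Polynomial (MvPolynomial ι K)) (i j : ι) : Polynomial K :=
  ∑ k ∈ f.support, Polynomial.monomial k
    (MvPolynomial.eval (Pi.single i 1) (MvPolynomial.pderiv j (f.coeff k)))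

/-- The value of `f` at the `i`-th unit vector. -/
noncomputable def valueAt (f : Polynomial (MvPolynomial ι K)) (i : ι) : Polynomial K :=
  f.map (MvPolynomial.eval (Pi.single i 1))

lemma eval_single_linearForm {E : Type*} [CommRing E] (x : ι → E) (i : ι) :
    MvPolynomial.eval (Pi.single i 1) (linearForm x) = x i := by
  simp [linearForm, Pi.single_apply]

lemma pderiv_linearForm {E : Type*} [CommRing E] (x : ι → E) (j : ι) :
    MvPolynomial.pderiv j (linearForm x) = MvPolynomial.C (x j) := by
  simp only [linearForm, map_sum, MvPolynomial.pderiv_C_mul, MvPolynomial.pderiv_X]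
  simp [Pi.single_apply]

variable {E : Type*} [CommRing E] [Algebra K E] (x : ι → E) (f : Polynomial (MvPolynomial ι K))

omit [Fintype ι] in
lemma eval_single_map (i : ι) (a : MvPolynomial ι K) :
    MvPolynomial.eval (Pi.single i 1) (MvPolynomial.map (algebraMap K E) a) =
      algebraMap K E (MvPolynomial.eval (Pi.single i 1) a) := by
  rw [MvPolynomial.eval_map, MvPolynomial.eval, MvPolynomial.coe_eval₂Hom, MvPolynomial.hom_eval₂]
  congr 1
  ext j
  by_cases h : j = i
  · subst h; simp
  · simp [h]

lemma eval_single_linEval (i : ι) :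
    MvPolynomial.eval (Pi.single i 1) (linEval (algebraMap K E) x f) =
      Polynomial.aeval (x i) (valueAt f i) := by
  rw [linEval, Polynomial.coe_eval₂RingHom, Polynomial.hom_eval₂, eval_single_linearForm, valueAt,
    Polynomial.aeval_def, Polynomial.eval₂_map]
  congr 1
  exact RingHom.ext fun a => eval_single_map i a

/-- Chain rule: `v_j` enters through the coefficients of `f` and through the linear form, whose
derivative is `x j` and whose value at the unit vector is `x i`. -/
lemma eval_single_pderiv_linEval (i j : ι) :
    MvPolynomial.eval (Pi.single i 1) (MvPolynomial.pderiv j (linEval (algebraMap K E) x f)) =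
      Polynomial.aeval (x i) (pderivAt f i j) +
        x j * Polynomial.aeval (x i) (Polynomial.derivative (valueAt f i)) := by
  rw [linEval, Polynomial.coe_eval₂RingHom, Polynomial.eval₂_eq_sum, Polynomial.sum]
  have h : Polynomial.aeval (x i) (Polynomial.derivative (valueAt f i)) =
      ∑ k ∈ f.support, algebraMap K E (MvPolynomial.eval (Pi.single i 1) (f.coeff k)) *
        (k * x i ^ (k - 1)) := by
    conv_lhs => rw [valueAt, f.as_sum_support_C_mul_X_pow]
    simp [Polynomial.map_sum, Polynomial.derivative_X_pow]
  rw [h, map_sum, map_sum, pderivAt, map_sum, Finset.mul_sum, ← Finset.sum_add_distrib]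
  refine Finset.sum_congr rfl fun k _ => ?_
  rw [Derivation.leibniz, Derivation.leibniz_pow, pderiv_linearForm, MvPolynomial.pderiv_map]
  simp only [smul_eq_mul, map_add, map_mul, map_pow, eval_single_linearForm, eval_single_map,
    Polynomial.aeval_monomial, MvPolynomial.eval_C, nsmul_eq_mul, map_natCast]
  ring

/-- If `f(∑ j, x_j v_j) = 0` then `x` is the image of `s` under a homomorphism from `L`. -/
theorem exists_algHom_of_linEval_eq_zero {L : Type*} [Field L] [Algebra K L] [FiniteDimensional K L]
    [CharZero K] {s : ι → L} {i : ι} (hi : IntermediateField.adjoin K {s i} = ⊤)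
    (hf : f.Monic) (hfd : f.natDegree = Module.finrank K L) (hf0 : linEval (algebraMap K L) s f = 0)
    (hx : linEval (algebraMap K E) x f = 0) : ∃ θ : L →ₐ[K] E, θ ∘ s = x := by
  -- The value of `f` at the `i`-th unit vector is monic of degree `[L : K]` and kills the primitive
  -- element `s i`.
  have hv : valueAt f i = minpoly K (s i) := by
    apply minpoly.unique _ _ (hf.map _)
    · change Polynomial.aeval (s i) (valueAt f i) = 0
      rw [← eval_single_linEval, hf0, map_zero]
    · intro q hq hq0
      have h := (Field.primitive_element_iff_minpoly_natDegree_eq K (s i)).mp hi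
      rw [Polynomial.degree_eq_natDegree hq.ne_zero,
        Polynomial.degree_eq_natDegree (hf.map _).ne_zero, hf.natDegree_map, hfd, ← h,
        Nat.cast_le]
      exact Polynomial.natDegree_le_natDegree (minpoly.min K _ hq hq0)
  have hxi : Polynomial.aeval (x i) (minpoly K (s i)) = 0 := by
    rw [← hv, ← eval_single_linEval, hx, map_zero]
  obtain ⟨θ, hθ⟩ : ∃ θ : L →ₐ[K] E, θ (s i) = x i := by
    have hint : IsIntegral K (s i) := Algebra.IsIntegral.isIntegral _
    let e : AdjoinRoot (minpoly K (s i)) ≃ₐ[K] L :=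
      (IntermediateField.adjoinRootEquivAdjoin K hint).trans
        ((IntermediateField.equivOfEq hi).trans IntermediateField.topEquiv)
    have he : e (AdjoinRoot.root _) = s i := by
      simp [e, IntermediateField.adjoinRootEquivAdjoin_apply_root]
    refine ⟨(AdjoinRoot.liftAlgHom _ (Algebra.ofId K E) (x i) hxi).comp e.symm.toAlgHom, ?_⟩
    have he' : e.symm (s i) = AdjoinRoot.root _ := (AlgEquiv.symm_apply_eq e).mpr he.symm
    exact (congrArg _ he').trans (AdjoinRoot.liftAlgHom_root (minpoly K (s i)) (Algebra.ofId K E) (x i) hxi)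
  refine ⟨θ, ?_⟩
  -- Separability makes the derivative a unit at `s i`, and hence at its image `x i` in `E`. This is
  -- what allows division in `E`, which need not be reduced.
  have hu : Polynomial.aeval (s i) (Polynomial.derivative (valueAt f i)) ≠ 0 := by
    rw [hv]
    exact (Algebra.IsSeparable.isSeparable K (s i)).aeval_derivative_ne_zero (minpoly.aeval K _)
  have hu' : IsUnit (Polynomial.aeval (x i) (Polynomial.derivative (valueAt f i))) := by
    rw [← hθ, Polynomial.aeval_algHom_apply]
    exact (IsUnit.mk0 _ hu).map θ
  -- The chain rule for `s`, mapped by `θ`, and the chain rule for `x` have the same first summand,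
  -- and the unit `f'(x_i)` can be cancelled in the second.
  funext j
  have h1 := eval_single_pderiv_linEval s f i j
  have h2 := eval_single_pderiv_linEval x f i j
  rw [hf0, map_zero, map_zero] at h1
  rw [hx, map_zero, map_zero] at h2
  have h3 := congrArg θ h1
  rw [map_add, map_mul, map_zero, ← Polynomial.aeval_algHom_apply, ← Polynomial.aeval_algHom_apply, hθ] at h3
  apply hu'.mul_left_injective
  exact add_left_cancel (h3.symm.trans h2)

end Reducedness

/-! ### Normality of smooth algebras -/

section Normality
open TensorProduct

/-- A domain which is standard étale over an integrally closed domain is integrally closed. -/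
theorem isIntegrallyClosed_of_isStandardEtale {P S : Type*} [CommRing P] [IsDomain P]
    [IsIntegrallyClosed P] [CommRing S] [IsDomain S] [Algebra P S] [Algebra.IsStandardEtale P S] :
    IsIntegrallyClosed S := by
  let F := FractionRing P
  have : Algebra.Etale P S := inferInstance
  have : Module.Flat P S := inferInstance
  have hPS : Function.Injective (algebraMap P S) := FaithfulSMul.algebraMap_injective P S
  have hM : Algebra.algebraMapSubmonoid S (nonZeroDivisors P) ≤ nonZeroDivisors S := by
    rintro _ ⟨p, hp, rfl⟩
    exact mem_nonZeroDivisors_of_ne_zero fun h =>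
      nonZeroDivisors.ne_zero hp (hPS (h.trans (map_zero _).symm))
  have hloc : IsLocalization (Algebra.algebraMapSubmonoid S (nonZeroDivisors P)) (S ⊗[P] F) :=
    inferInstance
  have hdom : IsDomain (S ⊗[P] F) := IsLocalization.isDomain_of_le_nonZeroDivisors (S ⊗[P] F) hM
  let e : F ⊗[P] S ≃ₐ[P] S ⊗[P] F := Algebra.TensorProduct.comm P F S
  have hdom' : IsDomain (F ⊗[P] S) := e.toMulEquiv.isDomain _
  -- The étale base change to `F` is finite-dimensional. Being a domain, it is a field, and it is
  -- the fraction field of `S`.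
  have hfin : Module.Finite F (F ⊗[P] S) := Algebra.FormallyUnramified.finite_of_free F (F ⊗[P] S)
  have hfield' : IsField (F ⊗[P] S) := isField_of_isIntegral_of_isField' (Field.toIsField F)
  have hfield : IsField (S ⊗[P] F) := e.symm.toMulEquiv.isField hfield'
  let := hfield.toField
  have hfrac : IsFractionRing S (S ⊗[P] F) :=
    IsFractionRing.of_field S _ fun z => by
      obtain ⟨⟨x, y⟩, h⟩ := IsLocalization.surj (Algebra.algebraMapSubmonoid S (nonZeroDivisors P)) z
      have hy : algebraMap S (S ⊗[P] F) y ≠ 0 := (IsLocalization.map_units _ y).ne_zero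
      exact ⟨x, y, by rw [eq_div_iff hy, h]⟩
  rw [isIntegrallyClosed_iff (S ⊗[P] F)]
  intro x hx
  -- Integral closure commutes with smooth base change, and the integral closure of `P` in `F` is
  -- `P` itself.
  obtain ⟨y, hy⟩ := (TensorProduct.toIntegralClosure_bijective_of_smooth (R := P) (S := S) (B := F)).2 ⟨x, hx⟩
  have hx' : Algebra.TensorProduct.map (.id S S) (integralClosure P F).val y = x :=
    congrArg Subtype.val hy
  rw [← hx']
  clear hx' hy
  induction y with
  | zero => exact ⟨0, by simp⟩
  | add y z h1 h2 =>
    obtain ⟨a, ha⟩ := h1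
    obtain ⟨b, hb⟩ := h2
    exact ⟨a + b, by rw [map_add, map_add, ha, hb]⟩
  | tmul a z =>
    obtain ⟨p, hp⟩ := IsIntegrallyClosed.isIntegral_iff.mp z.2
    refine ⟨p • a, ?_⟩
    rw [Algebra.TensorProduct.map_tmul]
    change (p • a) ⊗ₜ 1 = a ⊗ₜ (z : F)
    rw [← hp, Algebra.algebraMap_eq_smul_one, TensorProduct.smul_tmul]

/-- Near each maximal ideal a smooth algebra is standard étale over a polynomial ring, which is
integrally closed. Being integrally closed can be checked at the maximal ideals. -/
theorem isIntegrallyClosed_of_smooth (k S : Type*) [Field k] [CommRing S] [IsDomain S]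
    [Algebra k S] [Algebra.Smooth k S] : IsIntegrallyClosed S := by
  apply IsIntegrallyClosed.of_localization_maximal
  intro p hp0 hp
  obtain ⟨f, hfp, n, _, _, _⟩ :=
    Algebra.IsSmoothAt.exists_isStandardEtale_mvPolynomial (R := k) (p := p)
  have hf0 : f ≠ 0 := fun h => hfp (h ▸ p.zero_mem)
  have : IsDomain (Localization.Away f) :=
    IsLocalization.isDomain_localization (powers_le_nonZeroDivisors_of_noZeroDivisors hf0)
  have : IsIntegrallyClosed (Localization.Away f) :=
    isIntegrallyClosed_of_isStandardEtale (P := MvPolynomial (Fin n) k)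
  have hle : Submonoid.powers f ≤ p.primeCompl := by
    rw [Submonoid.powers_le]; exact hfp
  let : Algebra (Localization.Away f) (Localization.AtPrime p) :=
    IsLocalization.localizationAlgebraOfSubmonoidLe _ _ (Submonoid.powers f) p.primeCompl hle
  have := IsLocalization.localization_isScalarTower_of_submonoid_le (Localization.Away f) (Localization.AtPrime p) (Submonoid.powers f) p.primeCompl hle
  have := IsLocalization.isLocalization_of_submonoid_le (Localization.Away f) (Localization.AtPrime p) (Submonoid.powers f) p.primeCompl hle
  refine isIntegrallyClosed_of_isLocalization (Localization.AtPrime p) (p.primeCompl.map (algebraMap S (Localization.Away f))) ?_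
  rintro _ ⟨x, hx, rfl⟩
  refine mem_nonZeroDivisors_of_ne_zero fun h => hx ?_
  rw [(map_eq_zero_iff _ (IsLocalization.injective _
    (powers_le_nonZeroDivisors_of_noZeroDivisors hf0))).mp h]
  exact p.zero_mem
end Normality

/-! ### Clearing denominators -/

section Spreading
open TensorProduct

lemma exists_ne_zero_of_forall {A α : Type*} [CommRing A] [IsDomain A] (T : Finset α)
    (P : α → A → Prop) (hmul : ∀ x a c, P x a → P x (c * a))
    (h : ∀ x ∈ T, ∃ a ≠ 0, P x a) : ∃ a ≠ 0, ∀ x ∈ T, P x a := by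
  classical
  induction T using Finset.induction with
  | empty => exact ⟨1, one_ne_zero, by simp⟩
  | insert y T hy ih =>
    obtain ⟨a, ha, h1⟩ := ih fun x hx => h x (Finset.mem_insert_of_mem hx)
    obtain ⟨b, hb, h2⟩ := h y (Finset.mem_insert_self _ _)
    refine ⟨a * b, mul_ne_zero ha hb, fun x hx => ?_⟩
    obtain rfl | hx := Finset.mem_insert.mp hx
    · exact hmul _ _ _ h2
    · rw [mul_comm]; exact hmul _ _ _ (h1 x hx)

variable {ι : Type*} [Fintype ι] {A B K L : Type*} [CommRing A] [IsDomain A] [IsNoetherianRing A]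
  [CommRing B] [Field K] [Field L] [Algebra A B] [Algebra A K] [Algebra A L] [Algebra B L]
  [Algebra K L] [IsScalarTower A K L] [IsScalarTower A B L] [IsFractionRing A K]
  [FiniteDimensional K L] [CharZero K]

/-- The ideal of `A[x]` generated by the coefficients of `f(∑ j, x_j v_j)`. -/
noncomputable def coeffIdeal {A : Type*} [CommRing A] (f : Polynomial (MvPolynomial ι A)) :
    Ideal (MvPolynomial ι A) :=
  Ideal.span (Set.range fun α => (linEval MvPolynomial.C MvPolynomial.X f).coeff α)

/-- Over `K` the relations of `s` form exactly the ideal of coefficients. The relations over `A` are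
finitely generated, so a single denominator suffices. -/
theorem exists_smul_mem_coeffIdeal {s : ι → L} {i : ι} (hi : IntermediateField.adjoin K {s i} = ⊤)
    {f : Polynomial (MvPolynomial ι A)} (hf : f.Monic) (hfd : f.natDegree = Module.finrank K L)
    (hf0 : linEval (algebraMap A L) s f = 0) :
    ∃ a : A, a ≠ 0 ∧ ∀ g : MvPolynomial ι A, MvPolynomial.aeval s g = 0 →
      MvPolynomial.C a * g ∈ coeffIdeal f := by
  classical
  obtain ⟨T, hT⟩ := IsNoetherian.noetherian (RingHom.ker (MvPolynomial.aeval (R := A) s))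
  suffices key : ∀ g ∈ T, ∃ a : A, a ≠ 0 ∧ MvPolynomial.C a * g ∈ coeffIdeal f by
    obtain ⟨a, ha, h⟩ := exists_ne_zero_of_forall T
      (fun g (a : A) => MvPolynomial.C a * g ∈ coeffIdeal f)
      (fun x a c h => by rw [map_mul, mul_assoc]; exact Ideal.mul_mem_left _ _ h) key
    refine ⟨a, ha, fun g hg => ?_⟩
    have hg' : g ∈ Submodule.span (MvPolynomial ι A) (T : Set (MvPolynomial ι A)) := hT ▸ hg
    induction hg' using Submodule.span_induction with
    | mem x hx => exact h x hx
    | zero => simp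
    | add x y hx hy h1 h2 =>
      rw [mul_add]
      exact add_mem (h1 (hT.le hx)) (h2 (hT.le hy))
    | smul c x hx h1 =>
      rw [smul_eq_mul, mul_left_comm]
      exact Ideal.mul_mem_left _ _ (h1 (hT.le hx))
  · intro g hg
    have hg0 : MvPolynomial.aeval s g = 0 := hT.le (Submodule.subset_span hg)
    let m := MvPolynomial.map (σ := ι) (algebraMap A K)
    let I := (coeffIdeal f).map m
    -- The universal zero: its tautological point `x` is `θ ∘ s` for a homomorphism `θ` from `L`, so
    -- each relation of `s` vanishes in `E`, that is, lies in `I`.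
    let E := MvPolynomial ι K ⧸ I
    let x : ι → E := fun j => Ideal.Quotient.mk I (MvPolynomial.X j)
    have hx : linEval (algebraMap K E) x (f.map m) = 0 := by
      have h1 : linEval (algebraMap K E) x (f.map m) = MvPolynomial.map
          ((Ideal.Quotient.mk I).comp m) (linEval MvPolynomial.C MvPolynomial.X f) := by
        rw [linEval_map, map_linEval]
        have hx : x = (Ideal.Quotient.mk I).comp m ∘ MvPolynomial.X := by
          funext j
          simp only [Function.comp_apply, RingHom.comp_apply, m, MvPolynomial.map_X, x]
        rw [hx]
        congr 2
        ext a
        simp only [RingHom.comp_apply, m, MvPolynomial.map_C]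
        rfl
      rw [h1]
      ext α
      rw [MvPolynomial.coeff_map, MvPolynomial.coeff_zero, RingHom.comp_apply,
        Ideal.Quotient.eq_zero_iff_mem]
      exact Ideal.mem_map_of_mem _ (Ideal.subset_span ⟨α, rfl⟩)
    obtain ⟨θ, hθ⟩ := exists_algHom_of_linEval_eq_zero x (f.map m) hi (hf.map _)
      ((hf.natDegree_map _).trans hfd) (by
        rw [linEval_map, ← IsScalarTower.algebraMap_eq, hf0]) hx
    have hgI : m g ∈ I := by
      rw [← Ideal.Quotient.eq_zero_iff_mem]
      have h1 : Ideal.Quotient.mk I (m g) = MvPolynomial.aeval x (m g) := by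
        induction m g using MvPolynomial.induction_on with
        | C a => rw [MvPolynomial.aeval_C]; rfl
        | add p q hp hq => rw [map_add, map_add, hp, hq]
        | mul_X p j hp => rw [map_mul, map_mul, hp, MvPolynomial.aeval_X]
      have h2 : MvPolynomial.aeval s (m g) = MvPolynomial.aeval s g :=
        MvPolynomial.aeval_map_algebraMap K s g
      rw [h1, ← hθ]
      change MvPolynomial.aeval (fun j => θ (s j)) (m g) = 0
      rw [← MvPolynomial.comp_aeval_apply, h2, hg0, map_zero]
    let := MvPolynomial.algebraMvPolynomial (σ := ι) (R := A) (S := K)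
    have hloc : IsLocalization ((nonZeroDivisors A).map (MvPolynomial.C (σ := ι)))
      (MvPolynomial ι K) := inferInstance
    obtain ⟨⟨⟨p, hp⟩, ⟨_, a, ha, rfl⟩⟩, h⟩ := (IsLocalization.mem_map_algebraMap_iff
      ((nonZeroDivisors A).map (MvPolynomial.C (σ := ι))) (MvPolynomial ι K)).mp hgI
    refine ⟨a, nonZeroDivisors.ne_zero ha, ?_⟩
    have hinj : Function.Injective m := MvPolynomial.map_injective _ (IsFractionRing.injective A K)
    have h' : m (g * MvPolynomial.C a) = m p := (map_mul m g (MvPolynomial.C a)).trans h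
    rw [mul_comm, hinj h']
    exact hp

-- Each of the finitely many generators of `B` over `A` is a polynomial in `s i` over `K`; multiply
-- by a common denominator.
omit [Fintype ι] [IsNoetherianRing A] in
theorem exists_smul_mem_range [Module.Finite A B] (hBL : Function.Injective (algebraMap B L))
    {s : ι → B} {i : ι} (hi : IntermediateField.adjoin K {algebraMap B L (s i)} = ⊤) :
    ∃ a : A, a ≠ 0 ∧ ∀ b : B, ∃ p : MvPolynomial ι A, MvPolynomial.aeval s p = a • b := by
  obtain ⟨T, hT⟩ := Module.Finite.fg_top (R := A) (M := B)
  suffices key : ∀ b ∈ T, ∃ a : A, a ≠ 0 ∧ a • b ∈ (MvPolynomial.aeval (R := A) s).range by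
    obtain ⟨a, ha, h⟩ := exists_ne_zero_of_forall T
      (fun b (a : A) => a • b ∈ (MvPolynomial.aeval (R := A) s).range)
      (fun x a c h => by rw [mul_smul]; exact Subalgebra.smul_mem _ h _) key
    refine ⟨a, ha, fun b => ?_⟩
    have hb : b ∈ Submodule.span A (T : Set B) := hT ▸ Submodule.mem_top
    change a • b ∈ (MvPolynomial.aeval (R := A) s).range
    induction hb using Submodule.span_induction with
    | mem x hx => exact h x hx
    | zero => rw [smul_zero]; exact zero_mem _
    | add x y hx hy h1 h2 => rw [smul_add]; exact add_mem h1 h2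
    | smul c x hx h1 => rw [smul_comm]; exact Subalgebra.smul_mem _ h1 _
  · intro b _
    have htop : Algebra.adjoin K {algebraMap B L (s i)} = ⊤ := by
      rw [← IntermediateField.adjoin_simple_toSubalgebra_of_isAlgebraic
        (Algebra.IsAlgebraic.isAlgebraic _), hi]
      rfl
    have hb : algebraMap B L b ∈ Algebra.adjoin K {algebraMap B L (s i)} := htop ▸ Algebra.mem_top
    rw [Algebra.adjoin_singleton_eq_range_aeval] at hb
    obtain ⟨q, hq⟩ := hb
    obtain ⟨a, ha, h⟩ := IsLocalization.integerNormalization_spec (nonZeroDivisors A) q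
    refine ⟨a, nonZeroDivisors.ne_zero ha,
      Polynomial.aeval (MvPolynomial.X i) (IsLocalization.integerNormalization (nonZeroDivisors A) q), ?_⟩
    apply hBL
    change algebraMap B L (MvPolynomial.aeval s _) = _
    rw [← Polynomial.aeval_algHom_apply, MvPolynomial.aeval_X, ← Polynomial.aeval_algebraMap_apply,
      ← Polynomial.aeval_map_algebraMap K, h, ← algebraMap_smul K a q, map_smul, algebraMap_smul]
    refine (congrArg (fun z : L => a • z) hq).trans ?_
    rw [Algebra.smul_def, Algebra.smul_def, map_mul, ← IsScalarTower.algebraMap_apply]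
end Spreading

/-! ### The function fields and germs at the generic point -/

section FunctionFields
variable {X Y : Scheme.{0}} [IsIntegral X] [IsIntegral Y] (π : X ⟶ Y)

/-- The stalk of `Y` at the image of the generic point of `X`. -/
def BaseField (π : X ⟶ Y) : Type := Y.presheaf.stalk (π (genericPoint X))

/-- The function field of `X`. -/
def TopField (X : Scheme.{0}) [IsIntegral X] : Type := X.presheaf.stalk (genericPoint X)

noncomputable instance : Field (TopField X) := inferInstanceAs (Field X.functionField)

lemma map_genericPoint [Surjective π] : π (genericPoint X) = genericPoint Y := by
  apply ((genericPoint_spec Y).eq _).symm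
  have h := (genericPoint_spec X).image π.continuous
  rwa [Set.image_univ, π.surjective.range_eq, closure_univ] at h

lemma genericPoint_mem_of_nonempty {U : X.Opens} (hU : (U : Set X).Nonempty) :
    genericPoint X ∈ U :=
  ((genericPoint_spec X).mem_open_set_iff U.isOpen).mpr (by simpa using hU)

variable [Surjective π]

lemma map_genericPoint_mem_of_nonempty {U : Y.Opens} (hU : (U : Set Y).Nonempty) :
    π (genericPoint X) ∈ U :=
  map_genericPoint π ▸ genericPoint_mem_of_nonempty hU

noncomputable instance : Field (BaseField π) :=
  (isField_stalk_of_closure_mem_irreducibleComponents Y (π (genericPoint X))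
    (by simp [map_genericPoint π, irreducibleComponents_eq_singleton])).toField

/-- The germ at the generic point of a function on `Y`. -/
noncomputable def germBase (U : Y.Opens) (hU : π (genericPoint X) ∈ U) : Γ(Y, U) →+* BaseField π :=
  (Y.presheaf.germ U _ hU).hom

/-- The germ at the generic point of a function on the preimage of an open set of `Y`. -/
noncomputable def germTop (U : Y.Opens) (hU : π (genericPoint X) ∈ U) :
    Γ(X, π ⁻¹ᵁ U) →+* TopField X :=
  (X.presheaf.germ (π ⁻¹ᵁ U) _ hU).hom

noncomputable instance : Algebra (BaseField π) (TopField X) :=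
  RingHom.toAlgebra (R := BaseField π) (S := TopField X) (π.stalkMap (genericPoint X)).hom

lemma germBase_injective (U : Y.Opens) (hU : π (genericPoint X) ∈ U) :
    Function.Injective (germBase π U hU) :=
  germ_injective_of_isIntegral _ _ hU

omit [IsIntegral Y] [Surjective π] in
lemma germTop_injective (U : Y.Opens) (hU : π (genericPoint X) ∈ U) :
    Function.Injective (germTop π U hU) :=
  germ_injective_of_isIntegral X (genericPoint X) (show genericPoint X ∈ π ⁻¹ᵁ U from hU)

lemma germBase_res {U W : Y.Opens} (h : W ≤ U) (hW : π (genericPoint X) ∈ W) (a : Γ(Y, U)) :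
    germBase π W hW (Y.presheaf.map (homOfLE h).op a) = germBase π U (h hW) a :=
  Y.presheaf.germ_res_apply (homOfLE h) _ hW a

omit [IsIntegral Y] [Surjective π] in
lemma germTop_res {U W : Y.Opens} (h : W ≤ U) (hW : π (genericPoint X) ∈ W) (a : Γ(X, π ⁻¹ᵁ U)) :
    germTop π W hW (X.presheaf.map
      (homOfLE (show π ⁻¹ᵁ W ≤ π ⁻¹ᵁ U from fun _ hx => h hx)).op a) = germTop π U (h hW) a :=
  X.presheaf.germ_res_apply (homOfLE _) _ hW a

lemma algebraMap_germBase (U : Y.Opens) (hU : π (genericPoint X) ∈ U) (a : Γ(Y, U)) :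
    algebraMap (BaseField π) (TopField X) (germBase π U hU a) = germTop π U hU (π.app U a) :=
  Scheme.Hom.germ_stalkMap_apply π U (genericPoint X) hU a

lemma finrank_eq_degree : Module.finrank (BaseField π) (TopField X) = degree π := rfl

lemma isFractionRing_germ {y : Y} (hy : y = genericPoint Y) {U : Y.Opens} (hU : IsAffineOpen U)
    (hyU : y ∈ U) :
    @IsFractionRing Γ(Y, U) _ (Y.presheaf.stalk y) _ (Y.presheaf.germ U y hyU).hom.toAlgebra := by
  subst hy
  have : Nonempty U := ⟨⟨_, hyU⟩⟩
  exact functionField_isFractionRing_of_isAffineOpen Y U hU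

lemma isFractionRing_germBase {U : Y.Opens} (hU : IsAffineOpen U) (h : π (genericPoint X) ∈ U) :
    @IsFractionRing Γ(Y, U) _ (BaseField π) _ (germBase π U h).toAlgebra :=
  isFractionRing_germ (map_genericPoint π) hU h

lemma charZero_baseField (s : Y ⟶ Spec (.of ℂ)) : CharZero (BaseField π) := by
  let φ : ℂ →+* BaseField π := (germBase π ⊤ trivial).comp
    (((Scheme.ΓSpecIso (.of ℂ)).inv ≫ s.appTop).hom)
  exact charZero_of_injective_ringHom φ.injective

end FunctionFields

/-! ### Regularity of integral rational functions -/

section Normality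
variable {Y : Scheme.{0}} [IsIntegral Y]

theorem isIntegrallyClosed_of_smooth_scheme (s : Y ⟶ Spec (.of ℂ)) [Smooth s] {U : Y.Opens}
    (hU : IsAffineOpen U) (hne : (U : Set Y).Nonempty) : IsIntegrallyClosed Γ(Y, U) := by
  have : Nonempty U := hne.to_subtype
  have h := s.smooth_appLE (isAffineOpen_top _) hU (le_top : U ≤ s ⁻¹ᵁ ⊤)
  let e := (Scheme.ΓSpecIso (.of ℂ)).symm.commRingCatIsoToRingEquiv
  have h2 : RingHom.Smooth ((s.appLE ⊤ U le_top).hom.comp e.toRingHom) := by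
    exact RingHom.Smooth.respectsIso.2 _ e h
  let _ : Algebra ℂ Γ(Y, U) := ((s.appLE ⊤ U le_top).hom.comp e.toRingHom).toAlgebra
  have : Algebra.Smooth ℂ Γ(Y, U) := h2
  exact isIntegrallyClosed_of_smooth ℂ _
end Normality

section Gluing
variable {X Y : Scheme.{0}} [IsIntegral X] [IsIntegral Y] (π : X ⟶ Y) [Surjective π]

lemma exists_affine_le {Z : Scheme.{0}} {U : Z.Opens} {y : Z} (hy : y ∈ U) :
    ∃ W : Z.Opens, IsAffineOpen W ∧ y ∈ W ∧ W ≤ U := by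
  obtain ⟨_, ⟨W, hW, rfl⟩, hyW, hWU⟩ := Z.isBasis_affineOpens.exists_subset_of_mem_open hy U.isOpen
  exact ⟨W, hW, hyW, hWU⟩

/-- Functions on an integral scheme are determined by their germ at the generic point, so local
functions with the same germ glue. -/
theorem mem_range_germBase_of_affine {U : Y.Opens} (hU : π (genericPoint X) ∈ U) (k : BaseField π)
    (h : ∀ (W : Y.Opens) (hW : π (genericPoint X) ∈ W), IsAffineOpen W → W ≤ U →
      k ∈ (germBase π W hW).range) : k ∈ (germBase π U hU).range := by
  choose W hW hyW hWU using fun y : U => exists_affine_le y.2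
  have hg (y : U) : π (genericPoint X) ∈ W y := map_genericPoint_mem_of_nonempty π ⟨_, hyW y⟩
  choose a ha using fun y : U => h (W y) (hg y) (hW y) (hWU y)
  obtain ⟨b, hb, -⟩ := Y.sheaf.existsUnique_gluing' W U (fun y => homOfLE (hWU y))
    (fun y hy => TopologicalSpace.Opens.mem_iSup.mpr ⟨⟨y, hy⟩, hyW _⟩) a fun y z => by
      have hm : π (genericPoint X) ∈ W y ⊓ W z := ⟨hg y, hg z⟩
      apply germBase_injective π _ hm
      exact (germBase_res π inf_le_left hm (a y)).trans
        ((ha y).trans ((ha z).symm.trans (germBase_res π inf_le_right hm (a z)).symm))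
  refine ⟨b, ?_⟩
  have y : U := ⟨_, hU⟩
  refine (germBase_res π (hWU y) (hg y) b).symm.trans (Eq.trans ?_ (ha y))
  exact congrArg (germBase π (W y) (hg y)) (hb y)

variable [IsFinite π]

lemma isIntegral_germTop {W : Y.Opens} (hW : IsAffineOpen W) (hg : π (genericPoint X) ∈ W)
    (b : Γ(X, π ⁻¹ᵁ W)) : ((algebraMap (BaseField π) (TopField X)).comp
      (germBase π W hg)).IsIntegralElem (germTop π W hg b) := by
  have h := (π.finite_app W hW).to_isIntegral b
  have e : (algebraMap (BaseField π) (TopField X)).comp (germBase π W hg) =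
      (germTop π W hg).comp (π.app W).hom :=
    RingHom.ext fun a => algebraMap_germBase π W hg a
  rw [e]
  obtain ⟨p, hp, h0⟩ := h
  exact ⟨p, hp, by rw [← Polynomial.hom_eval₂, h0, map_zero]⟩

omit [IsFinite π] in
/-- Normality of `Y`: a rational function which is integral over every affine open is regular. -/
theorem mem_range_germBase_of_isIntegral (s : Y ⟶ Spec (.of ℂ)) [Smooth s] {W : Y.Opens}
    (hW : IsAffineOpen W) (hg : π (genericPoint X) ∈ W) {k : BaseField π}
    (hk : (germBase π W hg).IsIntegralElem k) : k ∈ (germBase π W hg).range := by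
  have : IsIntegrallyClosed Γ(Y, W) := isIntegrallyClosed_of_smooth_scheme s hW ⟨_, hg⟩
  let _ := (germBase π W hg).toAlgebra
  have := isFractionRing_germBase π hW hg
  exact IsIntegrallyClosed.isIntegral_iff.mp hk

/-- A function on the preimage is integral over each affine open of `Y` because `π` is finite. An
equation for it in `L` descends to `K`, and normality of `Y` applies. -/
theorem mem_range_germBase_of_germTop (s : Y ⟶ Spec (.of ℂ)) [Smooth s] {U : Y.Opens}
    (hU : π (genericPoint X) ∈ U) {k : BaseField π} (b : Γ(X, π ⁻¹ᵁ U))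
    (hk : algebraMap (BaseField π) (TopField X) k = germTop π U hU b) :
    k ∈ (germBase π U hU).range := by
  refine mem_range_germBase_of_affine π hU k fun W hg hW hWU =>
    mem_range_germBase_of_isIntegral π s hW hg ?_
  have hWU' : π ⁻¹ᵁ W ≤ π ⁻¹ᵁ U := fun _ hx => hWU hx
  have h := isIntegral_germTop π hW hg (X.presheaf.map (homOfLE hWU').op b)
  rw [germTop_res π hWU hg, ← hk] at h
  obtain ⟨p, hp, h0⟩ := h
  refine ⟨p, hp, (algebraMap (BaseField π) (TopField X)).injective ?_⟩
  rw [Polynomial.hom_eval₂, h0, map_zero]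

end Gluing

/-! ### Descent of sections and a primitive component -/

section Components
variable {X Y : Scheme.{0}} [IsIntegral X] [IsIntegral Y] (π : X ⟶ Y) [Surjective π]
variable {V : Y.Modules} {n : ℕ}

lemma app_injective {U : Y.Opens} (hU : π (genericPoint X) ∈ U) :
    Function.Injective (π.app U) := by
  intro a b h
  apply germBase_injective π U hU
  apply (algebraMap (BaseField π) (TopField X)).injective
  rw [algebraMap_germBase, algebraMap_germBase, h]

/-- In the pulled back frame this is the injectivity of `Γ(Y, U) → Γ(X, π⁻¹ U)` on coordinates. -/
lemma pullbackSection_injective (F : Frame V n) (hF : π (genericPoint X) ∈ F.U) :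
    Function.Injective (pullbackSection π : Γ(V, F.U) → _) := by
  intro s t h
  rw [F.coord_spec_self s, F.coord_spec_self t] at h ⊢
  rw [pullbackSection_sum_smul, pullbackSection_sum_smul] at h
  have e (c : Fin n → Γ(X, π ⁻¹ᵁ F.U)) : ∑ i, c i • pullbackSection π (F.vec i) =
      ∑ i, c i • ((Scheme.Modules.pullback π).obj V).presheaf.map
        (homOfLE (le_refl (π ⁻¹ᵁ F.U))).op ((F.pullback π).vec i) := by
    refine Finset.sum_congr rfl fun i _ => ?_
    rw [show (homOfLE le_rfl : π ⁻¹ᵁ F.U ⟶ π ⁻¹ᵁ F.U) = 𝟙 _ from rfl, op_id, CategoryTheory.Functor.map_id]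
    rfl
  have := ((F.pullback π).existsUnique_coord (π ⁻¹ᵁ F.U) le_rfl _).unique (e _) (h.trans (e _))
  refine Finset.sum_congr rfl fun i _ => ?_
  rw [app_injective π hF (congrFun this i)]

/-- The germs at the generic point of the components of `σ`. -/
noncomputable def genComponents (σ : Γ((Scheme.Modules.pullback π).obj V, ⊤)) (F : Frame V n)
    (hF : π (genericPoint X) ∈ F.U) (i : Fin n) : TopField X :=
  germTop π F.U hF (components π σ F i)

lemma genComponents_res (σ : Γ((Scheme.Modules.pullback π).obj V, ⊤)) {F G : Frame V n}
    (h : F.U ≤ G.U) (hF : π (genericPoint X) ∈ F.U) (i : Fin n) :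
    genComponents π σ G (h hF) i = ∑ j, algebraMap (BaseField π) (TopField X)
      (germBase π F.U hF (Frame.transition h i j)) * genComponents π σ F hF j := by
  have e := congrArg (germTop π F.U hF) (components_res π σ h i)
  rw [germTop_res π h hF, map_sum] at e
  refine e.trans (Finset.sum_congr rfl fun j _ => ?_)
  rw [map_mul, ← algebraMap_germBase]
  rfl

variable [IsFinite π]

/-- Transition matrices have entries in `K`, so the hypothesis passes to every frame. There
normality makes the components regular on `Y`, and the resulting local sections of `V` glue because
pullback is injective. -/
theorem exists_pullbackSection_eq (hV : IsLocallyFreeOfRank V n) (s : Y ⟶ Spec (.of ℂ)) [Smooth s]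
    (σ : Γ((Scheme.Modules.pullback π).obj V, ⊤)) (F : Frame V n) (hF : π (genericPoint X) ∈ F.U)
    (h : ∀ i, genComponents π σ F hF i ∈ (algebraMap (BaseField π) (TopField X)).range) :
    ∃ t : Γ(V, ⊤), pullbackSection π t = σ := by
  have key (G : Frame V n) (hG : π (genericPoint X) ∈ G.U) (i : Fin n) :
      ∃ a : Γ(Y, G.U), π.app G.U a = components π σ G i := by
    have hm : π (genericPoint X) ∈ F.U ⊓ G.U := ⟨hF, hG⟩
    let R := F.restrict (F.U ⊓ G.U) inf_le_left
    have hR : ∀ i, genComponents π σ R hm i = genComponents π σ F hF i := fun i => by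
      rw [genComponents_res π σ (F := R) (G := F) inf_le_left hm i]
      simp [R, Frame.transition_eq_of_restrict F (F.U ⊓ G.U) inf_le_left]
    have : genComponents π σ G hG i ∈ (algebraMap (BaseField π) (TopField X)).range := by
      rw [genComponents_res π σ (F := R) (G := G) inf_le_right hm i]
      exact sum_mem fun j _ => mul_mem ⟨_, rfl⟩ (hR j ▸ h j)
    obtain ⟨k, hk⟩ := this
    obtain ⟨a, rfl⟩ := mem_range_germBase_of_germTop π s hG _ hk
    refine ⟨a, germTop_injective π _ hG ?_⟩
    rw [← algebraMap_germBase, hk]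
    rfl
  choose G hG using hV
  have hg (y : Y) : π (genericPoint X) ∈ (G y).U := map_genericPoint_mem_of_nonempty π ⟨_, hG y⟩
  choose a ha using fun y => key (G y) (hg y)
  let t (y : Y) : Γ(V, (G y).U) := ∑ i, a y i • (G y).vec i
  have ht (y : Y) : pullbackSection π (t y) =
      ((Scheme.Modules.pullback π).obj V).presheaf.map (homOfLE le_top).op σ := by
    rw [components_spec, pullbackSection_sum_smul]
    simp only [ha]
  obtain ⟨b, hb, -⟩ := TopCat.Sheaf.existsUnique_gluing'
    (⟨V.presheaf, V.isSheaf⟩ : TopCat.Sheaf _ _)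
    (fun y => (G y).U) ⊤ (fun y => homOfLE le_top)
    (fun y _ => TopologicalSpace.Opens.mem_iSup.mpr ⟨y, hG y⟩) t fun y z => by
      have hm : π (genericPoint X) ∈ (G y).U ⊓ (G z).U := ⟨hg y, hg z⟩
      apply pullbackSection_injective π ((G y).restrict ((G y).U ⊓ (G z).U) inf_le_left) hm
      refine (pullbackSection_res π inf_le_left (t y)).trans
        (Eq.trans ?_ (pullbackSection_res π inf_le_right (t z)).symm)
      rw [ht, ht, Frame.res_res, Frame.res_res]
  refine ⟨b, ?_⟩
  refine TopCat.Sheaf.eq_of_locally_eq' (⟨((Scheme.Modules.pullback π).obj V).presheaf,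
    ((Scheme.Modules.pullback π).obj V).isSheaf⟩ : TopCat.Sheaf _ _)
    (fun y => π ⁻¹ᵁ (G y).U) ⊤ (fun y => homOfLE le_top)
    (fun x _ => TopologicalSpace.Opens.mem_iSup.mpr ⟨π x, hG (π x)⟩) _ _ fun y => ?_
  refine ((pullbackSection_res π le_top b).symm.trans ?_).trans (ht y)
  exact congrArg (pullbackSection π) (hb y)

/-- In prime degree every component outside `K` is a primitive element; if there were none, `σ`
would descend. -/
theorem exists_adjoin_eq_top (hV : IsLocallyFreeOfRank V n) (s : Y ⟶ Spec (.of ℂ)) [Smooth s]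
    (hd : (degree π).Prime) (σ : Γ((Scheme.Modules.pullback π).obj V, ⊤))
    (hσ : ∀ t : Γ(V, ⊤), pullbackSection π t ≠ σ)
    (F : Frame V n) (hF : π (genericPoint X) ∈ F.U) :
    ∃ i, IntermediateField.adjoin (BaseField π) {genComponents π σ F hF i} = ⊤ := by
  by_contra! hcon
  obtain ⟨t, ht⟩ := exists_pullbackSection_eq π hV s σ F hF fun i => by
    have := IntermediateField.isSimpleOrder_of_finrank_prime (BaseField π) (TopField X) hd
    have := (eq_bot_or_eq_top (IntermediateField.adjoin (BaseField π)
      {genComponents π σ F hF i})).resolve_right (hcon i)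
    rw [IntermediateField.adjoin_simple_eq_bot_iff, IntermediateField.mem_bot] at this
    exact this
  exact hσ t ht

end Components

/-! ### Changes of frame as linear substitutions -/

section Substitution
variable {ι R S : Type*} [Fintype ι] [CommRing R] [CommRing S]

/-- The linear substitution `v_j ↦ ∑ i, T i j * v_i`. -/
noncomputable def linSubst (T : ι → ι → R) : MvPolynomial ι R →ₐ[R] MvPolynomial ι R :=
  MvPolynomial.aeval fun j => ∑ i, MvPolynomial.C (T i j) * MvPolynomial.X i

lemma linSubst_linearForm (T : ι → ι → R) (s : ι → R) :
    linSubst T (linearForm s) = linearForm fun i => ∑ j, T i j * s j := by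
  simp only [linearForm, linSubst, map_sum, map_mul, MvPolynomial.algHom_C, MvPolynomial.aeval_X,
    MvPolynomial.algebraMap_eq, Finset.mul_sum, Finset.sum_mul]
  rw [Finset.sum_comm]
  refine Finset.sum_congr rfl fun i _ => Finset.sum_congr rfl fun j _ => by ring

lemma map_linSubst (ψ : R →+* S) (T : ι → ι → R) (p : MvPolynomial ι R) :
    MvPolynomial.map ψ (linSubst T p) = linSubst (fun i j => ψ (T i j)) (MvPolynomial.map ψ p) := by
  have : (MvPolynomial.map ψ).comp (linSubst T : MvPolynomial ι R →+* MvPolynomial ι R) =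
      (linSubst (fun i j => ψ (T i j)) : MvPolynomial ι S →+* MvPolynomial ι S).comp
        (MvPolynomial.map ψ) := by
    apply MvPolynomial.ringHom_ext <;> intro <;> simp [linSubst]
  exact congr($this p)

/-- The substitution by `T` carries the linear form of `s` to that of `T s`, so a change of frame
commutes with evaluation. -/
lemma linEval_map_linSubst (ψ : R →+* S) (T : ι → ι → R) (s : ι → S)
    (P : Polynomial (MvPolynomial ι R)) :
    linEval ψ (fun i => ∑ j, ψ (T i j) * s j)
        (P.map (linSubst T : MvPolynomial ι R →+* MvPolynomial ι R)) =
      linSubst (fun i j => ψ (T i j)) (linEval ψ s P) := by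
  simp only [linEval, Polynomial.coe_eval₂RingHom, Polynomial.eval₂_map]
  rw [← linSubst_linearForm]
  refine Eq.trans ?_ (Polynomial.hom_eval₂ P (MvPolynomial.map ψ)
    (linSubst (fun i j => ψ (T i j)) : MvPolynomial ι S →+* MvPolynomial ι S) (linearForm s)).symm
  refine congrArg (fun z => Polynomial.eval₂ z _ P) ?_
  exact RingHom.ext fun p => map_linSubst ψ T p

lemma linSubst_one [DecidableEq ι] : linSubst (fun i j : ι => if i = j then (1 : R) else 0) =
    AlgHom.id R _ := by
  ext1 j
  simp [linSubst, apply_ite]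

end Substitution

/-! ### From endomorphisms to functions -/

section Tensor
open TensorProduct
variable {ι A B N : Type*} [Fintype ι] [CommRing A] [CommRing B] [Algebra A B] [AddCommGroup N]
  [Module A N] (ρ : B →ₐ[A] Module.End A N) (s : ι → B) (P : Polynomial (MvPolynomial ι A))

/-- Polynomials with coefficients in an `A`-algebra `B` as a tensor product over `A`. -/
noncomputable def polyTensor (ι A B : Type*) [CommRing A] [CommRing B] [Algebra A B] :
    MvPolynomial ι A ⊗[A] B ≃ₐ[A] MvPolynomial ι B :=
  (Algebra.TensorProduct.comm A _ _).trans
    ((MvPolynomial.algebraTensorAlgEquiv A B).restrictScalars A)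

omit [Fintype ι] in
lemma polyTensor_tmul (p : MvPolynomial ι A) (b : B) :
    polyTensor ι A B (p ⊗ₜ b) = b • MvPolynomial.map (algebraMap A B) p := by
  simp [polyTensor]

lemma polyTensor_aeval :
    polyTensor ι A B (Polynomial.aeval (∑ j, MvPolynomial.X j ⊗ₜ s j) P) =
      linEval (algebraMap A B) s P := by
  rw [Polynomial.aeval_def]
  refine (Polynomial.hom_eval₂ P _ (polyTensor ι A B : MvPolynomial ι A ⊗[A] B →+* MvPolynomial ι B) _).trans ?_
  simp only [linEval, Polynomial.coe_eval₂RingHom, RingHom.coe_coe, map_sum, polyTensor_tmul]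
  have h1 : (polyTensor ι A B : MvPolynomial ι A ⊗[A] B →+* MvPolynomial ι B).comp
      (algebraMap (MvPolynomial ι A) (MvPolynomial ι A ⊗[A] B)) =
      MvPolynomial.map (algebraMap A B) := by
    refine RingHom.ext fun p => ?_
    simp [Algebra.TensorProduct.algebraMap_apply, polyTensor_tmul]
  have h2 : ∑ j, s j • MvPolynomial.map (algebraMap A B) (MvPolynomial.X j) = linearForm s := by
    simp [linearForm, MvPolynomial.smul_eq_C_mul]
  rw [h1, h2]

lemma aeval_tensor_eq :
    Polynomial.aeval (∑ j, MvPolynomial.X j ⊗ₜ ρ (s j) :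
        MvPolynomial ι A ⊗[A] Module.End A N) P =
      Algebra.TensorProduct.map (AlgHom.id (MvPolynomial ι A) (MvPolynomial ι A)) ρ
        (Polynomial.aeval (∑ j, MvPolynomial.X j ⊗ₜ s j) P) := by
  rw [← Polynomial.aeval_algHom_apply]
  simp

lemma aeval_tensor_eq_zero (h : linEval (algebraMap A B) s P = 0) :
    Polynomial.aeval (∑ j, MvPolynomial.X j ⊗ₜ ρ (s j) :
        MvPolynomial ι A ⊗[A] Module.End A N) P = 0 := by
  rw [← polyTensor_aeval, map_eq_zero_iff _ (polyTensor ι A B).injective] at h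
  rw [aeval_tensor_eq, h, map_zero]

/-- `MvPolynomial ι A` is flat over `A`, so tensoring keeps `ρ` injective. -/
lemma linEval_eq_zero_of_aeval_tensor (hρ : Function.Injective ρ)
    (h : Polynomial.aeval (∑ j, MvPolynomial.X j ⊗ₜ ρ (s j) :
        MvPolynomial ι A ⊗[A] Module.End A N) P = 0) : linEval (algebraMap A B) s P = 0 := by
  rw [aeval_tensor_eq] at h
  have : Function.Injective (Algebra.TensorProduct.map
      (AlgHom.id (MvPolynomial ι A) (MvPolynomial ι A)) ρ) :=
    Module.Flat.lTensor_preserves_injective_linearMap (M := MvPolynomial ι A) ρ.toLinearMap hρ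
  rw [← polyTensor_aeval, (map_eq_zero_iff _ this).mp h, map_zero]

end Tensor

/-! ### Spectral polynomials in a frame -/

section Polynomial
variable {X Y : Scheme.{0}} {V : Y.Modules} {n r : ℕ} (f : SpectralPolynomial V n r)

lemma SpectralPolynomial.natDegree_sum_lt (F : Frame V n) : Polynomial.degree (∑ i : Fin r,
    Polynomial.C ((f i).poly F) * Polynomial.X ^ (r - 1 - (i : ℕ))) < r := by
  refine (Polynomial.degree_sum_le _ _).trans_lt ((Finset.sup_lt_iff (WithBot.bot_lt_coe r)).mpr
    fun i _ => (Polynomial.degree_C_mul_X_pow_le _ _).trans_lt ?_)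
  have : r - 1 - (i : ℕ) < r := by have := i.2; omega
  exact WithBot.coe_lt_coe.mpr this

lemma SpectralPolynomial.monic_toPolynomial (F : Frame V n) : (f.toPolynomial F).Monic :=
  Polynomial.monic_X_pow_add (f.natDegree_sum_lt F)

lemma SpectralPolynomial.natDegree_toPolynomial (F : Frame V n) [Nontrivial Γ(Y, F.U)] :
    (f.toPolynomial F).natDegree = r :=
  Polynomial.natDegree_eq_of_degree_eq_some <| by
    rw [toPolynomial, Polynomial.degree_add_eq_left_of_degree_lt, Polynomial.degree_X_pow]
    rw [Polynomial.degree_X_pow]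
    exact f.natDegree_sum_lt F

lemma SpectralPolynomial.coeff_toPolynomial (F : Frame V n) (i : Fin r) :
    (f.toPolynomial F).coeff (r - 1 - i) = (f i).poly F := by
  rw [toPolynomial, Polynomial.coeff_add, Polynomial.coeff_X_pow, if_neg (by omega), zero_add,
    Polynomial.finsetSum_coeff, Finset.sum_eq_single i]
  · simp
  · intro j _ hj
    rw [Polynomial.coeff_C_mul_X_pow, if_neg]
    have : (i : ℕ) ≠ j := fun h => hj (Fin.ext h.symm)
    omega
  · simp

lemma SpectralPolynomial.toPolynomial_eq_of_coeff (F : Frame V n)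
    {g : Polynomial (MvPolynomial (Fin n) Γ(Y, F.U))} (hg : g.Monic) (hd : g.natDegree = r)
    (h : ∀ i : Fin r, (f i).poly F = g.coeff (r - 1 - i)) : f.toPolynomial F = g := by
  rw [hg.as_sum, hd, toPolynomial, Finset.sum_range]
  congr 1
  -- The coefficients `s_(i+1)` are numbered from the top power of `η` downwards.
  rw [← Equiv.sum_comp Fin.revPerm]
  refine Finset.sum_congr rfl fun i _ => ?_
  have e : r - 1 - (Fin.revPerm i : ℕ) = i := by
    rw [Fin.revPerm_apply, Fin.val_rev]; omega
  rw [h, e]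

lemma SpectralPolynomial.toPolynomial_res {F G : Frame V n} (h : F.U ≤ G.U) :
    (f.toPolynomial G).map (MvPolynomial.map (Y.presheaf.map (homOfLE h).op).hom) =
      (f.toPolynomial F).map (linSubst (Frame.transition h) : _ →+* MvPolynomial _ _) := by
  simp only [toPolynomial, Polynomial.map_add, Polynomial.map_sum, Polynomial.map_mul,
    Polynomial.map_pow, Polynomial.map_X, Polynomial.map_C]
  congr 1
  refine Finset.sum_congr rfl fun i _ => ?_
  rw [(f i).poly_res h]
  rfl

end Polynomial

/-! ### Annihilating the Higgs field is vanishing at the generic point -/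

section Annihilates
variable {X Y : Scheme.{0}}

/-- The action of functions on `π⁻¹ U` on the sections of `π_* M` over `U`. -/
noncomputable def sectionMul (π : X ⟶ Y) (M : X.Modules) (U : Y.Opens) :
    letI := (π.app U).hom.toAlgebra
    Γ(X, π ⁻¹ᵁ U) →ₐ[Γ(Y, U)]
      Module.End Γ(Y, U) Γ((Scheme.Modules.pushforward π).obj M, U) :=
  letI := (π.app U).hom.toAlgebra
  { toFun b :=
      { toFun := fun (s : Γ(M, π ⁻¹ᵁ U)) => (b • s : Γ(M, π ⁻¹ᵁ U))
        map_add' := fun (s t : Γ(M, π ⁻¹ᵁ U)) => smul_add b s t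
        map_smul' := fun a (s : Γ(M, π ⁻¹ᵁ U)) => smul_comm b (π.app U a) s }
    map_one' := LinearMap.ext fun (s : Γ(M, π ⁻¹ᵁ U)) => one_smul Γ(X, π ⁻¹ᵁ U) s
    map_mul' b c := LinearMap.ext fun (s : Γ(M, π ⁻¹ᵁ U)) => mul_smul b c s
    map_zero' := LinearMap.ext fun (s : Γ(M, π ⁻¹ᵁ U)) => zero_smul Γ(X, π ⁻¹ᵁ U) s
    map_add' b c := LinearMap.ext fun (s : Γ(M, π ⁻¹ᵁ U)) => add_smul b c s
    commutes' _ := rfl }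

/-- A function `b` is recovered as a coordinate of `b • v` for a frame vector `v`, which exists
since the rank is positive. -/
lemma sectionMul_injective (π : X ⟶ Y) {M : X.Modules} {m : ℕ} (hm : 0 < m) (N : Frame M m)
    {U : Y.Opens} (hU : π ⁻¹ᵁ U ≤ N.U) : Function.Injective (sectionMul π M U) := by
  intro b c h
  let i₀ : Fin m := ⟨0, hm⟩
  let v : Γ(M, π ⁻¹ᵁ U) := (N.restrict _ hU).vec i₀
  have h0 : b • v = c • v := congr($h v)
  have hv : (N.restrict _ hU).coord (W := π ⁻¹ᵁ U) le_rfl v i₀ = 1 :=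
    ((N.restrict _ hU).coord_vec i₀ i₀).trans (if_pos rfl)
  have key (d : Γ(X, π ⁻¹ᵁ U)) : (N.restrict _ hU).coord (W := π ⁻¹ᵁ U) le_rfl (d • v) i₀ = d :=
    (congrFun ((N.restrict _ hU).coord_smul (W := π ⁻¹ᵁ U) le_rfl d v) i₀).trans
      ((congrArg (d * ·) hv).trans (mul_one d))
  rw [← key b, h0, key c]

variable [IsIntegral X] [IsIntegral Y] (π : X ⟶ Y) [Surjective π] {V : Y.Modules} {n r : ℕ}
  (σ : Γ((Scheme.Modules.pullback π).obj V, ⊤)) (M : X.Modules)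

/-- The equation `f(σ) = 0` at the generic point. -/
def SpectralPolynomial.VanishesAt (f : SpectralPolynomial V n r) (F : Frame V n)
    (hF : π (genericPoint X) ∈ F.U) : Prop :=
  linEval ((algebraMap (BaseField π) (TopField X)).comp (germBase π F.U hF))
    (genComponents π σ F hF) (f.toPolynomial F) = 0

lemma linEval_germ_res {F G : Frame V n} (h : F.U ≤ G.U) (hF : π (genericPoint X) ∈ F.U)
    {P : Polynomial (MvPolynomial (Fin n) Γ(Y, G.U))} {Q : Polynomial (MvPolynomial (Fin n) Γ(Y, F.U))}
    (hPQ : P.map (MvPolynomial.map (Y.presheaf.map (homOfLE h).op).hom) =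
      Q.map (linSubst (Frame.transition h) : MvPolynomial _ _ →+* MvPolynomial _ _))
    (hQ : linEval ((algebraMap (BaseField π) (TopField X)).comp (germBase π F.U hF))
      (genComponents π σ F hF) Q = 0) :
    linEval ((algebraMap (BaseField π) (TopField X)).comp (germBase π G.U (h hF)))
      (genComponents π σ G (h hF)) P = 0 := by
  have e : (algebraMap (BaseField π) (TopField X)).comp (germBase π G.U (h hF)) =
      ((algebraMap (BaseField π) (TopField X)).comp (germBase π F.U hF)).comp
        (Y.presheaf.map (homOfLE h).op).hom :=
    RingHom.ext fun a => congrArg (algebraMap (BaseField π) (TopField X)) (germBase_res π h hF a).symm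
  have e2 := funext (genComponents_res π σ h hF)
  rw [e, ← linEval_map, hPQ, e2]
  exact (linEval_map_linSubst ((algebraMap (BaseField π) (TopField X)).comp (germBase π F.U hF))
    (Frame.transition h) (genComponents π σ F hF) Q).trans (by rw [hQ, map_zero])

variable {π σ M}

lemma SpectralPolynomial.VanishesAt.of_le {f : SpectralPolynomial V n r} {F G : Frame V n}
    {hF : π (genericPoint X) ∈ F.U} (hf : f.VanishesAt π σ F hF) (h : F.U ≤ G.U) :
    f.VanishesAt π σ G (h hF) :=
  linEval_germ_res π σ h hF (f.toPolynomial_res h) hf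

lemma SpectralPolynomial.VanishesAt.linEval_components {f : SpectralPolynomial V n r} {F : Frame V n}
    {hF : π (genericPoint X) ∈ F.U} (hf : f.VanishesAt π σ F hF) :
    linEval (π.app F.U).hom (components π σ F) (f.toPolynomial F) = 0 := by
  apply MvPolynomial.map_injective _ (germTop_injective π F.U hF)
  rw [map_linEval, map_zero]
  refine Eq.trans ?_ hf
  have : (germTop π F.U hF).comp (π.app F.U).hom =
      (algebraMap (BaseField π) (TopField X)).comp (germBase π F.U hF) :=
    RingHom.ext fun a => (algebraMap_germBase π F.U hF a).symm
  rw [this]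
  rfl

lemma SpectralPolynomial.vanishesAt_of_linEval_components {f : SpectralPolynomial V n r}
    {F : Frame V n} (hF : π (genericPoint X) ∈ F.U)
    (h : linEval (π.app F.U).hom (components π σ F) (f.toPolynomial F) = 0) :
    f.VanishesAt π σ F hF := by
  have h2 := congrArg (MvPolynomial.map (germTop π F.U hF)) h
  rw [map_linEval, map_zero] at h2
  refine Eq.trans ?_ h2
  have : (germTop π F.U hF).comp (π.app F.U).hom =
      (algebraMap (BaseField π) (TopField X)).comp (germBase π F.U hF) :=
    RingHom.ext fun a => (algebraMap_germBase π F.U hF a).symm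
  rw [this]
  rfl

/-- Frames over the empty set are allowed. There the functions form the zero ring, so every equation
between them holds. -/
lemma mem_or_subsingleton (π : X ⟶ Y) [Surjective π] (U : Y.Opens) :
    π (genericPoint X) ∈ U ∨ Subsingleton Γ(Y, U) := by
  rcases U.1.eq_empty_or_nonempty with h | h
  · right
    obtain rfl : U = ⊥ := TopologicalSpace.Opens.ext h
    infer_instance
  · exact Or.inl (map_genericPoint_mem_of_nonempty π h)

lemma SpectralPolynomial.annihilates_of_vanishesAt {f : SpectralPolynomial V n r}
    (h : ∀ F hF, f.VanishesAt π σ F hF) : f.Annihilates (pushforwardHiggs π M σ) := by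
  intro F
  rcases mem_or_subsingleton π F.U with hF | hF
  · let _ := (π.app F.U).hom.toAlgebra
    exact aeval_tensor_eq_zero (sectionMul π M F.U) (components π σ F) (f.toPolynomial F)
      (h F hF).linEval_components
  · have : Subsingleton (TensorProduct Γ(Y, F.U) (MvPolynomial (Fin n) Γ(Y, F.U))
        (Module.End Γ(Y, F.U) Γ((Scheme.Modules.pushforward π).obj M, F.U))) :=
      Module.subsingleton Γ(Y, F.U) _
    exact Subsingleton.elim _ _

variable [IsFinite π]

/-- A nonzero function `b` on the preimage of an affine open is integral over it, so `b` divides the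
pullback of some nonzero `a`. Then the preimage of the open set of `a` lies in that of `b`. -/
lemma exists_preimage_le {W : X.Opens} (hW : genericPoint X ∈ W) {U : Y.Opens}
    (hU : π (genericPoint X) ∈ U) :
    ∃ U' : Y.Opens, π (genericPoint X) ∈ U' ∧ U' ≤ U ∧ π ⁻¹ᵁ U' ≤ W := by
  obtain ⟨U₁, hU₁, hg, hle⟩ := exists_affine_le hU
  obtain ⟨b, hb, hgb⟩ := (hU₁.preimage π).exists_basicOpen_le (V := W) ⟨_, hW⟩ hg
  let _ := (π.app U₁).hom.toAlgebra
  have hint : IsIntegral Γ(Y, U₁) b := (π.finite_app U₁ hU₁).to_isIntegral b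
  have : Nonempty U₁ := ⟨⟨_, hg⟩⟩
  have : Nonempty (π ⁻¹ᵁ U₁ : X.Opens) := ⟨⟨_, hg⟩⟩
  have hb0 : b ≠ 0 := by
    rintro rfl
    simp at hgb
  obtain ⟨a, ha, c, hc⟩ := hint.isAlgebraic.exists_nonzero_dvd (mem_nonZeroDivisors_of_ne_zero hb0)
  refine ⟨Y.basicOpen a, ?_, (Y.basicOpen_le a).trans hle, ?_⟩
  · rw [Scheme.mem_basicOpen Y a _ hg]
    have : germBase π U₁ hg a ≠ 0 := (map_ne_zero_iff _ (germBase_injective π U₁ hg)).mpr ha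
    exact isUnit_iff_ne_zero.mpr this
  · rw [Scheme.preimage_basicOpen]
    refine le_trans ?_ hb
    rw [show π.app U₁ a = b * c from hc, Scheme.basicOpen_mul]
    exact inf_le_left

/-- `F` is shrunk until `M` has a frame on the whole preimage, where functions act faithfully. The
equation at the generic point then passes back to the larger frame. -/
lemma SpectralPolynomial.vanishesAt_of_annihilates {m : ℕ} (hm : 0 < m)
    (hM : IsLocallyFreeOfRank M m) {f : SpectralPolynomial V n r}
    (h : f.Annihilates (pushforwardHiggs π M σ)) (F : Frame V n) (hF : π (genericPoint X) ∈ F.U) :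
    f.VanishesAt π σ F hF := by
  obtain ⟨N, hN⟩ := hM (genericPoint X)
  obtain ⟨U, hU, hle, hUN⟩ := exists_preimage_le hN hF
  refine VanishesAt.of_le (F := F.restrict U hle) (hF := hU) ?_ hle
  apply vanishesAt_of_linEval_components
  let _ := (π.app U).hom.toAlgebra
  exact linEval_eq_zero_of_aeval_tensor (sectionMul π M U) (components π σ (F.restrict U hle)) _
    (sectionMul_injective π hm N hUN) (h (F.restrict U hle))

end Annihilates

/-! ### Existence and uniqueness of the annihilating polynomial -/

section ExistsUnique
variable {X Y : Scheme.{0}} [IsIntegral X] [IsIntegral Y] (π : X ⟶ Y) [Surjective π] {V : Y.Modules}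
  {n : ℕ} (σ : Γ((Scheme.Modules.pullback π).obj V, ⊤))

/-- `finrank` is `0` for infinite extensions, so a positive degree already forces finiteness. -/
lemma finiteDimensional_of_prime (hd : (degree π).Prime) :
    FiniteDimensional (BaseField π) (TopField X) :=
  Module.finite_of_finrank_pos hd.pos

/-- The expression of a polynomial over the functions on `U` at the generic point. -/
noncomputable def genericPoly {ι : Type*} (U : Y.Opens) (hU : π (genericPoint X) ∈ U) :
    Polynomial (MvPolynomial ι Γ(Y, U)) →+* Polynomial (MvPolynomial ι (BaseField π)) :=
  Polynomial.mapRingHom (MvPolynomial.map (germBase π U hU))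

lemma genericPoly_injective {ι : Type*} (U : Y.Opens) (hU : π (genericPoint X) ∈ U) :
    Function.Injective (genericPoly (ι := ι) π U hU) :=
  Polynomial.map_injective _ (MvPolynomial.map_injective _ (germBase_injective π U hU))

lemma linEval_genericPoly {ι : Type*} [Fintype ι] (U : Y.Opens) (hU : π (genericPoint X) ∈ U)
    (s : ι → TopField X) (P : Polynomial (MvPolynomial ι Γ(Y, U))) :
    linEval (algebraMap (BaseField π) (TopField X)) s (genericPoly π U hU P) =
      linEval ((algebraMap (BaseField π) (TopField X)).comp (germBase π U hU)) s P :=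
  linEval_map _ _ _ _

variable (s : Y ⟶ Spec (.of ℂ)) [Smooth s] [IsFinite π]
  [FiniteDimensional (BaseField π) (TopField X)]

omit [IsFinite π] [FiniteDimensional (BaseField π) (TopField X)] in
lemma genComponents_restrict (F : Frame V n) (W : Y.Opens) (h : W ≤ F.U)
    (hW : π (genericPoint X) ∈ W) :
    genComponents π σ (F.restrict W h) hW = genComponents π σ F (h hW) := by
  funext i
  refine (Eq.trans (genComponents_res π σ (F := F.restrict W h) (G := F) h hW i) ?_).symm
  simp [Frame.transition_eq_of_restrict F W h]

-- The coefficients of the norm are integral over the functions on every affine open inside `F.U`,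
-- hence regular by normality.
include s in
theorem exists_isConjPoly_genericPoly (F : Frame V n)
    (hF : π (genericPoint X) ∈ F.U) :
    ∃ g : Polynomial (MvPolynomial (Fin n) Γ(Y, F.U)),
      IsConjPoly (genComponents π σ F hF) (genericPoly π F.U hF g) := by
  have := charZero_baseField π s
  obtain ⟨f, hf⟩ := exists_isConjPoly (K := BaseField π) (genComponents π σ F hF)
  obtain ⟨g, hg⟩ := exists_map_map_eq (germBase π F.U hF) f fun i α =>
    mem_range_germBase_of_affine π hF _ fun W hW haff hWF => by
      refine mem_range_germBase_of_isIntegral π s haff hW ?_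
      let _ := (germBase π W hW).toAlgebra
      let _ := ((algebraMap (BaseField π) (TopField X)).comp (germBase π W hW)).toAlgebra
      have : IsScalarTower Γ(Y, W) (BaseField π) (TopField X) := .of_algebraMap_eq' rfl
      refine hf.isIntegral_coeff (A := Γ(Y, W)) (fun j => ?_) i α
      rw [← genComponents_restrict π σ F W hWF hW]
      exact isIntegral_germTop π haff hW _
  exact ⟨g, (show genericPoly π F.U hF g = f from hg) ▸ hf⟩

variable {π σ}

-- A polynomial which vanishes at `σ` is the norm, by uniqueness over `K`. Its splitting into
-- conjugate factors is used again for the surjectivity of `ψ`.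
include s in
theorem SpectralPolynomial.VanishesAt.isConjPoly {f : SpectralPolynomial V n (degree π)}
    (hV : IsLocallyFreeOfRank V n) (hd : (degree π).Prime)
    (hσ : ∀ t : Γ(V, ⊤), pullbackSection π t ≠ σ) {F : Frame V n} {hF : π (genericPoint X) ∈ F.U}
    (hf : f.VanishesAt π σ F hF) :
    IsConjPoly (genComponents π σ F hF) (genericPoly π F.U hF (f.toPolynomial F)) := by
  have := charZero_baseField π s
  obtain ⟨i, hi⟩ := exists_adjoin_eq_top π hV s hd σ hσ F hF
  obtain ⟨g, hg⟩ := exists_isConjPoly (K := BaseField π) (genComponents π σ F hF)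
  have : Nonempty F.U := ⟨⟨_, hF⟩⟩
  have h := eq_of_linEval_eq_zero hi ((f.monic_toPolynomial F).map _)
    (((f.monic_toPolynomial F).natDegree_map _).trans (f.natDegree_toPolynomial F))
    ((linEval_genericPoly π F.U hF _ _).trans hf) hg.monic hg.natDegree hg.linEval_eq_zero
  exact (show genericPoly π F.U hF (f.toPolynomial F) = g from h) ▸ hg

include s in
theorem SpectralPolynomial.eq_of_vanishesAt {f f' : SpectralPolynomial V n (degree π)}
    (hV : IsLocallyFreeOfRank V n) (hd : (degree π).Prime)
    (hσ : ∀ t : Γ(V, ⊤), pullbackSection π t ≠ σ)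
    (hf : ∀ F hF, f.VanishesAt π σ F hF) (hf' : ∀ F hF, f'.VanishesAt π σ F hF) : f = f' := by
  funext i
  refine SymSection.ext (funext fun F => ?_)
  rcases mem_or_subsingleton π F.U with hF | hF
  · have h1 := (hf F hF).isConjPoly s hV hd hσ
    have h2 := (hf' F hF).isConjPoly s hV hd hσ
    have : f.toPolynomial F = f'.toPolynomial F :=
      genericPoly_injective π F.U hF (Polynomial.map_injective _ map_algebraMap_injective
        (h1.trans h2.symm))
    rw [← coeff_toPolynomial, this, coeff_toPolynomial]
  · exact Subsingleton.elim _ _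

include s in
open Classical in
theorem SpectralPolynomial.exists_vanishesAt
    (hV : IsLocallyFreeOfRank V n) (hd : (degree π).Prime)
    (hσ : ∀ t : Γ(V, ⊤), pullbackSection π t ≠ σ) :
    ∃ f : SpectralPolynomial V n (degree π), ∀ F hF, f.VanishesAt π σ F hF := by
  have := charZero_baseField π s
  choose g hg using exists_isConjPoly_genericPoly π σ s
  have hvan (F : Frame V n) (hF) : linEval ((algebraMap (BaseField π) (TopField X)).comp
      (germBase π F.U hF)) (genComponents π σ F hF) (g F hF) = 0 :=
    (linEval_genericPoly π F.U hF _ _).symm.trans (hg F hF).linEval_eq_zero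
  have hmonic (F : Frame V n) (hF) : (g F hF).Monic :=
    Polynomial.monic_of_injective (MvPolynomial.map_injective _ (germBase_injective π F.U hF))
      (hg F hF).monic
  have hdeg (F : Frame V n) (hF) : (g F hF).natDegree = degree π :=
    (Polynomial.natDegree_map_eq_of_injective
      (MvPolynomial.map_injective _ (germBase_injective π F.U hF)) _).symm.trans
        (hg F hF).natDegree
  -- Over `K` both sides are monic of degree `r` with the same root, the linear form of `σ` in the
  -- frame `G`.
  have hres {F G : Frame V n} (h : F.U ≤ G.U) (hF : π (genericPoint X) ∈ F.U) :
      (g G (h hF)).map (MvPolynomial.map (Y.presheaf.map (homOfLE h).op).hom) =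
        (g F hF).map (linSubst (Frame.transition h) : MvPolynomial _ _ →+* MvPolynomial _ _) := by
    have hG := h hF
    have e : (algebraMap (BaseField π) (TopField X)).comp (germBase π G.U hG) =
        ((algebraMap (BaseField π) (TopField X)).comp (germBase π F.U hF)).comp
          (Y.presheaf.map (homOfLE h).op).hom :=
      RingHom.ext fun a =>
        congrArg (algebraMap (BaseField π) (TopField X)) (germBase_res π h hF a).symm
    have : Nonempty F.U := ⟨⟨_, hF⟩⟩
    obtain ⟨i, hi⟩ := exists_adjoin_eq_top π hV s hd σ hσ G hG
    apply genericPoly_injective π F.U hF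
    refine eq_of_linEval_eq_zero hi (((hmonic G hG).map _).map _) ?_ ?_
      (((hmonic F hF).map _).map _) ?_ ?_
    · exact (((hmonic G hG).map _).natDegree_map _).trans
        (((hmonic G hG).natDegree_map _).trans (hdeg G hG))
    · rw [linEval_genericPoly, linEval_map, ← e]
      exact hvan G hG
    · exact (((hmonic F hF).map _).natDegree_map _).trans
        (((hmonic F hF).natDegree_map _).trans (hdeg F hF))
    · rw [linEval_genericPoly, funext (genComponents_res π σ h hF)]
      exact (linEval_map_linSubst ((algebraMap (BaseField π) (TopField X)).comp (germBase π F.U hF))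
        (Frame.transition h) (genComponents π σ F hF) (g F hF)).trans (by rw [hvan, map_zero])
  let f : SpectralPolynomial V n (degree π) := fun i =>
    -- The value `0` is used only over the empty set, where the polynomial ring is trivial.
    { poly F := if hF : π (genericPoint X) ∈ F.U then (g F hF).coeff (degree π - 1 - i) else 0
      isHomogeneous F := by
        split_ifs with hF
        · apply MvPolynomial.IsHomogeneous.of_map (germBase_injective π F.U hF)
          have := (hg F hF).isHomogeneous (i := degree π - 1 - i) (d := i + 1) (by
            have := i.2
            rw [finrank_eq_degree]; omega)
          rwa [genericPoly, Polynomial.coe_mapRingHom, Polynomial.coeff_map] at this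
        · exact MvPolynomial.isHomogeneous_zero _ _ _
      poly_res {F G} h := by
        rcases mem_or_subsingleton π F.U with hF | hF
        · rw [dif_pos hF, dif_pos (h hF), ← Polynomial.coeff_map, hres h hF, Polynomial.coeff_map]
          rfl
        · exact Subsingleton.elim _ _ }
  have hf (F : Frame V n) (hF) : f.toPolynomial F = g F hF :=
    f.toPolynomial_eq_of_coeff F (hmonic F hF) (hdeg F hF) fun i => dif_pos hF
  exact ⟨f, fun F hF => by rw [VanishesAt, hf F hF, hvan]⟩

end ExistsUnique

/-! ### Vanishing of the tautological equation along morphisms to charts -/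

section ZeroAlong
variable {X Y T T' : Scheme.{0}} {V : Y.Modules} {n r : ℕ} (f : SpectralPolynomial V n r)

/-- The section `f(η)` vanishes along a morphism to a chart of `Tot V`. -/
def SpectralPolynomial.ZeroAlong {F : Frame V n} (u : T ⟶ 𝔸(Fin n; F.U)) : Prop :=
  MvPolynomial.map u.appTop.hom (f.evalTautological F) = 0

lemma SpectralPolynomial.evalTautological_eq (F : Frame V n) :
    f.evalTautological F =
      linEval (baseFunction n F.U) (AffineSpace.coord F.U.toScheme) (f.toPolynomial F) := rfl

lemma SpectralPolynomial.map_evalTautological {F : Frame V n} (u : T ⟶ 𝔸(Fin n; F.U)) :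
    MvPolynomial.map u.appTop.hom (f.evalTautological F) =
      linEval (u.appTop.hom.comp (baseFunction n F.U))
        (fun j => u.appTop (AffineSpace.coord F.U.toScheme j)) (f.toPolynomial F) := by
  rw [evalTautological_eq, map_linEval]
  rfl

lemma SpectralPolynomial.zeroAlong_iff_coeff {F : Frame V n} (u : T ⟶ 𝔸(Fin n; F.U)) :
    f.ZeroAlong u ↔ ∀ α, u.appTop ((f.evalTautological F).coeff α) = 0 := by
  rw [ZeroAlong, MvPolynomial.ext_iff]
  simp only [MvPolynomial.coeff_map, MvPolynomial.coeff_zero]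

variable {f}

lemma SpectralPolynomial.ZeroAlong.comp {F : Frame V n} {u : T ⟶ 𝔸(Fin n; F.U)}
    (h : f.ZeroAlong u) (v : T' ⟶ T) : f.ZeroAlong (v ≫ u) := by
  rw [zeroAlong_iff_coeff] at h ⊢
  intro α
  rw [Scheme.Hom.comp_appTop, CommRingCat.comp_apply, h, map_zero]

/-- Both the coefficients of `f` and the tautological section transform by the transition matrix, so
the values of `f(η)` differ by an invertible-in-practice linear substitution of the `v_j`. -/
lemma SpectralPolynomial.map_evalTautological_chartTransition {R G : Frame V n} (h : R.U ≤ G.U)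
    (u : T ⟶ 𝔸(Fin n; R.U)) :
    MvPolynomial.map (u ≫ chartTransition h).appTop.hom (f.evalTautological G) =
      linSubst (fun i j => u.appTop (baseFunction n R.U (Frame.transition h i j)))
        (MvPolynomial.map u.appTop.hom (f.evalTautological R)) := by
  rw [map_evalTautological, map_evalTautological]
  have e1 : ((u ≫ chartTransition h).appTop.hom.comp (baseFunction n G.U)) =
      (u.appTop.hom.comp (baseFunction n R.U)).comp (Y.presheaf.map (homOfLE h).op).hom := by
    ext a
    exact congrArg u.appTop (baseFunction_res h a)
  have e2 : (fun j => (u ≫ chartTransition h).appTop (AffineSpace.coord G.U.toScheme j)) =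
      fun i => ∑ j, (u.appTop.hom.comp (baseFunction n R.U)) (Frame.transition h i j) *
        u.appTop (AffineSpace.coord R.U.toScheme j) := by
    funext i
    rw [Scheme.Hom.comp_appTop, CommRingCat.comp_apply, chartTransition_coord, map_sum]
    simp only [map_mul]
    rfl
  rw [e1, e2, ← linEval_map, f.toPolynomial_res h]
  exact linEval_map_linSubst _ _ _ _

lemma SpectralPolynomial.ZeroAlong.chartTransition {R G : Frame V n} (h : R.U ≤ G.U)
    {u : T ⟶ 𝔸(Fin n; R.U)} (hu : f.ZeroAlong u) :
    f.ZeroAlong (u ≫ SpectralCover.chartTransition h) := by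
  rw [ZeroAlong, map_evalTautological_chartTransition, hu, map_zero]

lemma SpectralPolynomial.ZeroAlong.of_restrict {G : Frame V n} {W : Y.Opens} (h : W ≤ G.U)
    {u : T ⟶ 𝔸(Fin n; (G.restrict W h).U)}
    (hu : f.ZeroAlong (u ≫ SpectralCover.chartTransition (F := G.restrict W h) (G := G) h)) :
    f.ZeroAlong u := by
  have := map_evalTautological_chartTransition (f := f) (R := G.restrict W h) (G := G) h u
  simp only [Frame.transition_eq_of_restrict G W h, apply_ite, map_one, map_zero, linSubst_one] at this
  exact this.symm.trans hu

/-- Chart transitions are cartesian over inclusions of opens in `Y`. Two chart points with the same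
image in `Tot V` therefore come from a chart over the intersection. -/
lemma exists_lift_of_inf_le (hV : IsLocallyFreeOfRank V n) {F G R : Frame V n} (hF : R.U ≤ F.U)
    (hG : R.U ≤ G.U) (hR : F.U ⊓ G.U ≤ R.U)
    (u : T ⟶ 𝔸(Fin n; F.U)) (w : T ⟶ 𝔸(Fin n; G.U))
    (h : u ≫ Tot.chart hV F = w ≫ Tot.chart hV G) :
    ∃ w' : T ⟶ 𝔸(Fin n; R.U), w' ≫ chartTransition hG = w ∧ w' ≫ chartTransition hF = u := by
  have h2 : (u ≫ (𝔸(Fin n; F.U) ↘ F.U.toScheme)) ≫ F.U.ι =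
      (w ≫ (𝔸(Fin n; G.U) ↘ G.U.toScheme)) ≫ G.U.ι := by
    have := congr($h ≫ Tot.proj hV)
    simpa only [Category.assoc, Tot.chart_proj] using this
  let b : T ⟶ R.U := (isPullback_opens_inf F.U G.U).lift _ _ h2 ≫ Y.homOfLE hR
  have hb : w ≫ (𝔸(Fin n; G.U) ↘ G.U.toScheme) = b ≫ Y.homOfLE hG := by
    rw [← cancel_mono G.U.ι, ← (isPullback_opens_inf F.U G.U).lift_snd _ _ h2]
    simp [b]
  refine ⟨(isPullback_chartTransition hG).lift w b hb,
    (isPullback_chartTransition hG).lift_fst _ _ _, ?_⟩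
  rw [← cancel_mono (Tot.chart hV F), Category.assoc, Tot.chartTransition_chart, h]
  have e := (isPullback_chartTransition hG).lift_fst w b hb
  conv_rhs => rw [← e, Category.assoc, Tot.chartTransition_chart]

/-- Vanishing depends only on the morphism to `Tot V`, not on the chart through which it factors. -/
lemma SpectralPolynomial.ZeroAlong.of_chart_eq (hV : IsLocallyFreeOfRank V n) {F G : Frame V n}
    {u : T ⟶ 𝔸(Fin n; F.U)} {w : T ⟶ 𝔸(Fin n; G.U)}
    (h : u ≫ Tot.chart hV F = w ≫ Tot.chart hV G) (hw : f.ZeroAlong w) : f.ZeroAlong u := by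
  obtain ⟨w', rfl, rfl⟩ := exists_lift_of_inf_le hV
    (R := G.restrict (F.U ⊓ G.U) inf_le_right) inf_le_left inf_le_right le_rfl u w h
  exact (hw.of_restrict).chartTransition _

end ZeroAlong

section GraphZero
variable {X Y T : Scheme.{0}} {V : Y.Modules} {n r : ℕ} {f : SpectralPolynomial V n r} {π : X ⟶ Y}
  {σ : Γ((Scheme.Modules.pullback π).obj V, ⊤)}

lemma localGraph_appTop_coord (F : Frame V n) (j : Fin n) :
    (localGraph π σ F).appTop (AffineSpace.coord F.U.toScheme j) =
      (π ⁻¹ᵁ F.U).topIso.inv (components π σ F j) := by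
  simp only [localGraph, AffineSpace.homOfVector_appTop_coord]

lemma localGraph_appTop_baseFunction (F : Frame V n) (a : Γ(Y, F.U)) :
    (localGraph π σ F).appTop (baseFunction n F.U a) = (π ⁻¹ᵁ F.U).topIso.inv (π.app F.U a) := by
  rw [← restrict_baseFunction]
  have e1 : localGraph π σ F ≫ (𝔸(Fin n; F.U) ↘ F.U.toScheme) = π ∣_ F.U := by simp [localGraph]
  rw [← e1, Scheme.Hom.comp_appTop]
  rfl

lemma SpectralPolynomial.zeroAlong_localGraph {F : Frame V n}
    (h : linEval (π.app F.U).hom (components π σ F) (f.toPolynomial F) = 0) :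
    f.ZeroAlong (localGraph π σ F) := by
  have := congrArg (MvPolynomial.map (π ⁻¹ᵁ F.U).topIso.inv.hom) h
  rw [map_linEval, map_zero] at this
  rw [ZeroAlong, map_evalTautological]
  refine Eq.trans ?_ this
  congr 1
  congr 1
  · ext a; exact localGraph_appTop_baseFunction F a
  · funext j; exact localGraph_appTop_coord F j

lemma SpectralPolynomial.zeroAlong_of_graph (hV : IsLocallyFreeOfRank V n) {F : Frame V n}
    (h : f.ZeroAlong (localGraph π σ F)) {u : T ⟶ 𝔸(Fin n; F.U)} {v : T ⟶ X}
    (huv : v ≫ graph hV π σ = u ≫ Tot.chart hV F) : f.ZeroAlong u := by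
  have h1 : Set.range v ⊆ Set.range (π ⁻¹ᵁ F.U).ι := by
    rw [Scheme.Opens.range_ι]
    rintro _ ⟨t, rfl⟩
    have h2 : v ≫ π = (u ≫ (𝔸(Fin n; F.U) ↘ F.U.toScheme)) ≫ F.U.ι := by
      have := congr($huv ≫ Tot.proj hV)
      simpa only [Category.assoc, Tot.chart_proj, graph_proj] using this
    change π (v t) ∈ F.U
    rw [← Scheme.Hom.comp_apply, h2, Scheme.Hom.comp_apply]
    exact Subtype.property _
  let v' := IsOpenImmersion.lift (π ⁻¹ᵁ F.U).ι v h1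
  have hv' : v' ≫ (π ⁻¹ᵁ F.U).ι = v := IsOpenImmersion.lift_fac _ _ _
  have : u = v' ≫ localGraph π σ F := by
    rw [← cancel_mono (Tot.chart hV F), ← huv, ← hv', Category.assoc, Category.assoc, ι_graph]
  rw [this]
  exact h.comp v'

end GraphZero

/-! ### The ideal sheaf of the spectral cover -/

lemma app_res_appIso_inv {A T : Scheme.{0}} (j : A ⟶ T) [IsOpenImmersion j] (c : Γ(A, ⊤))
    {W : T.Opens} (hW : W ≤ j ''ᵁ ⊤) :
    j.app W (T.presheaf.map (homOfLE hW).op ((j.appIso ⊤).inv c)) =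
      A.presheaf.map (homOfLE le_top).op c := by
  simp only [← CommRingCat.comp_apply]
  congr 2
  rw [Category.assoc, j.naturality, Scheme.Hom.appIso_inv_app_assoc, ← Functor.map_comp]
  rfl

lemma comp_app_apply {A S T : Scheme.{0}} (u : S ⟶ A) (j : A ⟶ T) (W : T.Opens) (x : Γ(T, W)) :
    (u ≫ j).app W x = u.app (j ⁻¹ᵁ W) (j.app W x) := by
  rw [Scheme.Hom.comp_app]
  rfl

lemma comp_app_res_appIso_inv {A T S : Scheme.{0}} (j : A ⟶ T) [IsOpenImmersion j] (c : Γ(A, ⊤))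
    {W : T.Opens} (hW : W ≤ j ''ᵁ ⊤) (u : S ⟶ A) :
    (u ≫ j).app W (T.presheaf.map (homOfLE hW).op ((j.appIso ⊤).inv c)) =
      S.presheaf.map (homOfLE le_top).op (u.appTop c) := by
  rw [comp_app_apply, app_res_appIso_inv]
  exact congr($(u.naturality (homOfLE (le_top : j ⁻¹ᵁ W ≤ ⊤)).op) c)

section IdealSheaf
variable {X Y : Scheme.{0}} {V : Y.Modules} {n r : ℕ} (hV : IsLocallyFreeOfRank V n)
  (f : SpectralPolynomial V n r)

/-- The ideal sheaves which contain the coefficients of `f(η)`. -/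
def SpectralPolynomial.zeroIdeals : Set (Tot hV).IdealSheafData :=
  {I | ∀ (F : Frame V n) (α : Fin n →₀ ℕ) (W : (Tot hV).affineOpens)
    (hW : W.1 ≤ Tot.chart hV F ''ᵁ ⊤),
    (Tot hV).presheaf.map (homOfLE hW).op
      (((Tot.chart hV F).appIso ⊤).inv ((f.evalTautological F).coeff α)) ∈ I.ideal W}

variable {hV f}

/-- The coefficients restrict to zero on the subscheme over small affine opens, whose preimages
cover `T`. -/
theorem SpectralPolynomial.zeroAlong_of_mem {I : (Tot hV).IdealSheafData}
    (hI : I ∈ f.zeroIdeals hV) {T : Scheme.{0}} {F : Frame V n} {u : T ⟶ 𝔸(Fin n; F.U)}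
    {v : T ⟶ I.subscheme} (h : v ≫ I.subschemeι = u ≫ Tot.chart hV F) : f.ZeroAlong u := by
  rw [zeroAlong_iff_coeff]
  intro α
  have hx (t : T) : (u ≫ Tot.chart hV F) t ∈ Tot.chart hV F ''ᵁ ⊤ := ⟨u t, trivial, rfl⟩
  choose W hWa hWt hW using fun t => exists_affine_le (hx t)
  refine T.sheaf.eq_of_locally_eq' (fun t => (u ≫ Tot.chart hV F) ⁻¹ᵁ W t) ⊤
    (fun t => homOfLE le_top) (fun t _ => TopologicalSpace.Opens.mem_iSup.mpr ⟨t, hWt t⟩) _ _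
    fun t => ?_
  have h0 : (u ≫ Tot.chart hV F).app (W t) ((Tot hV).presheaf.map (homOfLE (hW t)).op
      (((Tot.chart hV F).appIso ⊤).inv ((f.evalTautological F).coeff α))) = 0 := by
    rw [← h, comp_app_apply]
    have := hI F α ⟨W t, hWa t⟩ (hW t)
    rw [← I.ker_subschemeι_app, RingHom.mem_ker] at this
    exact (congrArg _ this).trans (map_zero _)
  rw [comp_app_res_appIso_inv] at h0
  exact h0.trans (map_zero _).symm

/-- Converse of `zeroAlong_of_mem`. For quasi-compact `h` the sections of `h.ker` over an affine `W`
are the functions that pull back to zero; over `W` inside a chart, `h` lifts to that chart. -/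
theorem SpectralPolynomial.ker_mem_zeroIdeals {Z : Scheme.{0}} (h : Z ⟶ Tot hV) [QuasiCompact h]
    (hz : ∀ (T : Scheme.{0}) (F : Frame V n) (u : T ⟶ 𝔸(Fin n; F.U)) (v : T ⟶ Z),
      v ≫ h = u ≫ Tot.chart hV F → f.ZeroAlong u) : h.ker ∈ f.zeroIdeals hV := by
  intro F α W hW
  rw [Scheme.Hom.ker_apply, RingHom.mem_ker]
  let v : (h ⁻¹ᵁ W.1).toScheme ⟶ Z := (h ⁻¹ᵁ W.1).ι
  have hr : Set.range (v ≫ h) ⊆ Set.range (Tot.chart hV F) := by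
    rintro _ ⟨t, rfl⟩
    obtain ⟨a, -, ha⟩ := hW (show (v ≫ h) t ∈ W.1 from t.2)
    exact ⟨a, ha⟩
  let u := IsOpenImmersion.lift (Tot.chart hV F) (v ≫ h) hr
  have hu : u ≫ Tot.chart hV F = v ≫ h := IsOpenImmersion.lift_fac _ _ _
  have hzero := (f.zeroAlong_iff_coeff u).mp (hz _ F u v hu.symm) α
  set x := (Tot hV).presheaf.map (homOfLE hW).op
      (((Tot.chart hV F).appIso ⊤).inv ((f.evalTautological F).coeff α)) with hxdef
  have h0 : (v ≫ h).app W.1 x = 0 := by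
    rw [← hu, hxdef, comp_app_res_appIso_inv, hzero, map_zero]
  rw [comp_app_apply] at h0
  have hinj : Function.Injective (v.app (h ⁻¹ᵁ W.1)) := by
    have : IsIso (v.app (h ⁻¹ᵁ W.1)) := by
      apply Scheme.Hom.isIso_app
      simp [v]
    exact (ConcreteCategory.bijective_of_isIso _).1
  exact hinj (h0.trans (map_zero _).symm)

lemma SpectralPolynomial.idealSheaf_le {I : (Tot hV).IdealSheafData}
    (hI : I ∈ f.zeroIdeals hV) : f.idealSheaf hV ≤ I := sInf_le hI

end IdealSheaf

lemma exists_finite_affine_frames {Y : Scheme.{0}} [CompactSpace Y] {V : Y.Modules} {n : ℕ}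
    (hV : IsLocallyFreeOfRank V n) : ∃ (κ : Type) (_ : Finite κ) (F : κ → Frame V n),
      (∀ i, IsAffineOpen (F i).U) ∧ ∀ y, ∃ i, y ∈ (F i).U := by
  choose G hG using hV
  choose W hWa hyW hW using fun y => exists_affine_le (hG y)
  obtain ⟨t, ht⟩ := isCompact_univ.elim_finite_subcover (fun y => (W y : Set Y))
    (fun y => (W y).2) (fun y _ => Set.mem_iUnion.mpr ⟨y, hyW y⟩)
  refine ⟨t, inferInstance, fun y => (G y).restrict (W y) (hW y), fun y => hWa y, fun y => ?_⟩
  obtain ⟨z, hz, hyz⟩ := Set.mem_iUnion₂.mp (ht (Set.mem_univ y))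
  exact ⟨⟨z, hz⟩, hyz⟩

section Minimal
variable {Y : Scheme.{0}} [IsLocallyNoetherian Y] {V : Y.Modules} {n r : ℕ}
  (hV : IsLocallyFreeOfRank V n) (f : SpectralPolynomial V n r)

instance (F : Frame V n) : QuasiCompact (Tot.chart hV F) :=
  MorphismProperty.of_isPullback (Tot.isPullback_chart hV F) inferInstance

/-- The cover of `Tot V` by the charts of a family of frames whose domains cover `Y`. -/
noncomputable def chartCover {κ : Type} (F : κ → Frame V n) (hF : ∀ y, ∃ i, y ∈ (F i).U) :
    (Tot hV).OpenCover where
  I₀ := κ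
  X i := 𝔸(Fin n; (F i).U)
  f i := Tot.chart hV (F i)
  mem₀ := by
    rw [Scheme.presieve₀_mem_precoverage_iff]
    refine ⟨fun x ↦ ?_, inferInstance⟩
    obtain ⟨i, hi⟩ := hF (Tot.proj hV x)
    refine ⟨i, ?_⟩
    obtain ⟨a, -, ha⟩ := Scheme.exists_preimage_of_isPullback (Tot.isPullback_chart hV (F i))
      ⟨_, hi⟩ x rfl
    exact ⟨a, ha⟩

/-- The zero scheme of `f(η)` in a chart. -/
noncomputable def SpectralPolynomial.chartIdeal (F : Frame V n) :
    (𝔸(Fin n; F.U)).IdealSheafData :=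
  .ofIdealTop (Ideal.span (Set.range fun α => (f.evalTautological F).coeff α))

variable {f}

omit [IsLocallyNoetherian Y] in
lemma SpectralPolynomial.chartIdeal_le_ker {F : Frame V n} (hF : IsAffineOpen F.U)
    {T : Scheme.{0}} {u : T ⟶ 𝔸(Fin n; F.U)} (hu : f.ZeroAlong u) : f.chartIdeal F ≤ u.ker := by
  have : IsAffine F.U := hF
  rw [Scheme.ker_of_isAffine, chartIdeal]
  apply Scheme.IdealSheafData.le_of_isAffine
  simp only [Scheme.IdealSheafData.ofIdealTop_ideal]
  refine Ideal.map_mono (Ideal.span_le.mpr ?_)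
  rintro _ ⟨α, rfl⟩
  exact (f.zeroAlong_iff_coeff u).mp hu α

omit [IsLocallyNoetherian Y] in
lemma SpectralPolynomial.zeroAlong_subschemeι {F : Frame V n} (hF : IsAffineOpen F.U) :
    f.ZeroAlong (f.chartIdeal F).subschemeι := by
  have : IsAffine F.U := hF
  rw [zeroAlong_iff_coeff]
  intro α
  have h := (f.chartIdeal F).ker_subschemeι
  rw [Scheme.ker_of_isAffine] at h
  have h2 := Scheme.IdealSheafData.equivOfIsAffine.symm.injective h
  rw [← RingHom.mem_ker, h2]
  exact Ideal.subset_span ⟨α, rfl⟩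

/-- An infinite infimum of ideal sheaves need not be computed on sections, so the infimum is
replaced by the finite intersection `J` of the kernels of the zero schemes in finitely many affine
charts. -/
theorem SpectralPolynomial.idealSheaf_mem_zeroIdeals [CompactSpace Y] :
    f.idealSheaf hV ∈ f.zeroIdeals hV := by
  obtain ⟨κ, _, F, haff, hF⟩ := exists_finite_affine_frames hV
  let h (i : κ) : (f.chartIdeal (F i)).subscheme ⟶ Tot hV :=
    (f.chartIdeal (F i)).subschemeι ≫ Tot.chart hV (F i)
  let J : (Tot hV).IdealSheafData := ⨅ i, (h i).ker
  have hJ : J ∈ f.zeroIdeals hV := by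
    intro G α W hW
    rw [Scheme.IdealSheafData.ideal_iInf, iInf_apply]
    refine Ideal.mem_iInf.mpr fun i => ker_mem_zeroIdeals (h i) (fun T F' u v huv => ?_) G α W hW
    exact ((zeroAlong_subschemeι (haff i)).comp v).of_chart_eq hV
      (huv.symm.trans (Category.assoc _ _ _).symm)
  have hle (I : (Tot hV).IdealSheafData) (hI : I ∈ f.zeroIdeals hV) : J ≤ I := by
    -- The part in each chart of the subscheme of `I` lies in the zero scheme of that chart, and the
    -- kernel is the intersection over the charts.
    rw [← I.ker_subschemeι, ← I.subschemeι.iInf_ker_openCover_map_comp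
      ((chartCover hV F hF).pullback₁ I.subschemeι)]
    refine le_iInf fun i => (iInf_le _ i).trans ?_
    let u : pullback I.subschemeι (Tot.chart hV (F i)) ⟶ 𝔸(Fin n; (F i).U) := pullback.snd _ _
    have hu : f.ZeroAlong u := zeroAlong_of_mem hI pullback.condition
    let w := IsClosedImmersion.lift (f.chartIdeal (F i)).subschemeι u (by
      rw [Scheme.IdealSheafData.ker_subschemeι]
      exact chartIdeal_le_ker (haff i) hu)
    have hw : pullback.fst I.subschemeι (Tot.chart hV (F i)) ≫ I.subschemeι = w ≫ h i := by
      rw [pullback.condition]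
      exact ((IsClosedImmersion.lift_fac _ _ _) =≫ _).symm.trans (Category.assoc _ _ _)
    change (h i).ker ≤ (pullback.fst I.subschemeι (Tot.chart hV (F i)) ≫ I.subschemeι).ker
    rw [hw]
    exact Scheme.Hom.le_ker_comp _ _
  rwa [show f.idealSheaf hV = J from le_antisymm (idealSheaf_le hJ) (le_sInf hle)]

end Minimal

/-! ### Functions on charts and on the graph -/

section ChartFunctions
variable {Y : Scheme.{0}} {V : Y.Modules} {n r : ℕ}

/-- Polynomials in the fibre coordinates as functions on a chart. -/
noncomputable def chartFunction (F : Frame V n) :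
    MvPolynomial (Fin n) Γ(Y, F.U) →+* Γ(𝔸(Fin n; F.U), ⊤) :=
  MvPolynomial.eval₂Hom (baseFunction n F.U) (AffineSpace.coord F.U.toScheme)

lemma chartFunction_surjective (F : Frame V n) (hF : IsAffineOpen F.U) :
    Function.Surjective (chartFunction F) := by
  have : IsAffine F.U := hF
  have h1 : Function.Surjective (MvPolynomial.eval₂Hom
      ((𝔸(Fin n; F.U) ↘ F.U.toScheme).appTop).hom (AffineSpace.coord F.U.toScheme)) := by
    have : IsIso (AffineSpace.isoOfIsAffine (Fin n) F.U.toScheme).hom := inferInstance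
    have : IsIso ((AffineSpace.isoOfIsAffine (Fin n) F.U.toScheme).hom.app ⊤) := inferInstance
    have h : Function.Surjective (AffineSpace.isoOfIsAffine (Fin n) F.U.toScheme).hom.appTop :=
      (ConcreteCategory.bijective_of_isIso
        ((AffineSpace.isoOfIsAffine (Fin n) F.U.toScheme).hom.app ⊤)).2
    rw [AffineSpace.isoOfIsAffine_hom_appTop] at h
    intro a
    obtain ⟨b, hb⟩ := h a
    exact ⟨_, hb⟩
  have h2 : Function.Surjective (MvPolynomial.map (σ := Fin n) F.U.topIso.inv.hom) :=
    MvPolynomial.map_surjective _ (ConcreteCategory.bijective_of_isIso F.U.topIso.inv).2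
  have h3 : chartFunction F = (MvPolynomial.eval₂Hom
      ((𝔸(Fin n; F.U) ↘ F.U.toScheme).appTop).hom (AffineSpace.coord F.U.toScheme)).comp
        (MvPolynomial.map F.U.topIso.inv.hom) := by
    apply MvPolynomial.ringHom_ext
    · intro a; simp [chartFunction, baseFunction]
    · intro j; simp [chartFunction]
  rw [h3]
  exact h1.comp h2

lemma appTop_chartFunction {T : Scheme.{0}} {F : Frame V n} (u : T ⟶ 𝔸(Fin n; F.U))
    (p : MvPolynomial (Fin n) Γ(Y, F.U)) :
    u.appTop (chartFunction F p) = MvPolynomial.eval₂ (u.appTop.hom.comp (baseFunction n F.U))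
      (fun j => u.appTop (AffineSpace.coord F.U.toScheme j)) p :=
  MvPolynomial.eval₂_comp_left u.appTop.hom (baseFunction n F.U) (AffineSpace.coord F.U.toScheme) p

lemma map_chartFunction_linEval (f : SpectralPolynomial V n r) (F : Frame V n) :
    MvPolynomial.map (chartFunction F) (linEval MvPolynomial.C MvPolynomial.X (f.toPolynomial F)) =
      f.evalTautological F := by
  rw [map_linEval, SpectralPolynomial.evalTautological_eq]
  congr 1
  congr 1
  · ext a; simp [chartFunction]
  · funext j; simp [chartFunction]

variable {X : Scheme.{0}} {π : X ⟶ Y} {σ : Γ((Scheme.Modules.pullback π).obj V, ⊤)}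

lemma localGraph_appTop_chartFunction (F : Frame V n) (p : MvPolynomial (Fin n) Γ(Y, F.U)) :
    (localGraph π σ F).appTop (chartFunction F p) = (π ⁻¹ᵁ F.U).topIso.inv
      (MvPolynomial.eval₂ (π.app F.U).hom (components π σ F) p) := by
  rw [appTop_chartFunction]
  refine Eq.trans ?_ (MvPolynomial.eval₂_comp_left (π ⁻¹ᵁ F.U).topIso.inv.hom (π.app F.U).hom
    (components π σ F) p).symm
  congr 1
  · ext a; exact localGraph_appTop_baseFunction F a
  · funext j; exact localGraph_appTop_coord F j

variable [IsIntegral X] [IsIntegral Y] [Surjective π]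

lemma germTop_eval₂ (F : Frame V n) (hF : π (genericPoint X) ∈ F.U)
    (p : MvPolynomial (Fin n) Γ(Y, F.U)) :
    germTop π F.U hF (MvPolynomial.eval₂ (π.app F.U).hom (components π σ F) p) =
      MvPolynomial.eval₂ ((algebraMap (BaseField π) (TopField X)).comp (germBase π F.U hF))
        (genComponents π σ F hF) p := by
  refine (MvPolynomial.eval₂_comp_left (germTop π F.U hF) _ _ p).trans ?_
  congr 1
  ext a
  exact (algebraMap_germBase π F.U hF a).symm

lemma localGraph_appTop_eq_zero_iff (F : Frame V n) (hF : π (genericPoint X) ∈ F.U)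
    (p : MvPolynomial (Fin n) Γ(Y, F.U)) :
    (localGraph π σ F).appTop (chartFunction F p) = 0 ↔
      MvPolynomial.eval₂ ((algebraMap (BaseField π) (TopField X)).comp (germBase π F.U hF))
        (genComponents π σ F hF) p = 0 := by
  rw [localGraph_appTop_chartFunction, map_eq_zero_iff _
    (ConcreteCategory.bijective_of_isIso (π ⁻¹ᵁ F.U).topIso.inv).1, ← germTop_eval₂,
    map_eq_zero_iff _ (germTop_injective π F.U hF)]

lemma SpectralPolynomial.linEval_components {f : SpectralPolynomial V n r}
    (hf : ∀ F hF, f.VanishesAt π σ F hF) (F : Frame V n) :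
    linEval (π.app F.U).hom (components π σ F) (f.toPolynomial F) = 0 := by
  rcases mem_or_subsingleton π F.U with hF | hF
  · exact (hf F hF).linEval_components
  · rw [Subsingleton.elim (f.toPolynomial F) 0, map_zero]

end ChartFunctions

/-! ### The morphism to the spectral cover -/

instance {Y : Scheme.{0}} {V : Y.Modules} {n r : ℕ} (hV : IsLocallyFreeOfRank V n)
    (f : SpectralPolynomial V n r) : IsClosedImmersion (f.spectralCoverι hV) :=
  inferInstanceAs (IsClosedImmersion (f.idealSheaf hV).subschemeι)

lemma SpectralPolynomial.ker_spectralCoverι {Y : Scheme.{0}} {V : Y.Modules} {n r : ℕ}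
    (hV : IsLocallyFreeOfRank V n) (f : SpectralPolynomial V n r) :
    (f.spectralCoverι hV).ker = f.idealSheaf hV :=
  (f.idealSheaf hV).ker_subschemeι

section Cover
variable {X Y : Scheme.{0}} {π : X ⟶ Y} [IsFinite π] [CompactSpace Y] [IsLocallyNoetherian Y]
  {V : Y.Modules} {n : ℕ} (hV : IsLocallyFreeOfRank V n)
  {σ : Γ((Scheme.Modules.pullback π).obj V, ⊤)}

instance : QuasiCompact (graph hV π σ) := by
  have : IsLocallyNoetherian X := LocallyOfFiniteType.isLocallyNoetherian π
  have : CompactSpace X := QuasiCompact.compactSpace_of_compactSpace π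
  have : IsNoetherian X := {}
  infer_instance

variable [IsIntegral X] [IsIntegral Y] [Surjective π] {f : SpectralPolynomial V n (degree π)}

theorem SpectralPolynomial.idealSheaf_le_ker_graph (hf : ∀ F hF, f.VanishesAt π σ F hF) :
    f.idealSheaf hV ≤ (graph hV π σ).ker :=
  idealSheaf_le (ker_mem_zeroIdeals _ fun _ F _ _ h =>
    zeroAlong_of_graph hV (zeroAlong_localGraph (linEval_components hf F)) h)

/-- The morphism from `X` to the spectral cover. -/
noncomputable def SpectralPolynomial.toCover (hf : ∀ F hF, f.VanishesAt π σ F hF) :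
    X ⟶ f.spectralCover hV :=
  IsClosedImmersion.lift (f.spectralCoverι hV) (graph hV π σ)
    ((f.ker_spectralCoverι hV).le.trans (idealSheaf_le_ker_graph hV hf))

lemma SpectralPolynomial.toCover_ι (hf : ∀ F hF, f.VanishesAt π σ F hF) :
    f.toCover hV hf ≫ f.spectralCoverι hV = graph hV π σ :=
  IsClosedImmersion.lift_fac _ _ _

end Cover

/-! ### Surjectivity of the morphism to the spectral cover -/

section Surjective
variable {X Y : Scheme.{0}} [IsIntegral X] [IsIntegral Y] {π : X ⟶ Y} [Surjective π] [IsFinite π]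
  [FiniteDimensional (BaseField π) (TopField X)] (s : Y ⟶ Spec (.of ℂ)) [Smooth s]
  {V : Y.Modules} {n : ℕ} (hV : IsLocallyFreeOfRank V n) (hd : (degree π).Prime)
  {σ : Γ((Scheme.Modules.pullback π).obj V, ⊤)} (hσ : ∀ t : Γ(V, ⊤), pullbackSection π t ≠ σ)
  {f : SpectralPolynomial V n (degree π)}

include s hV hd hσ in
theorem SpectralPolynomial.VanishesAt.eval₂_eq_zero {F : Frame V n}
    {hF : π (genericPoint X) ∈ F.U} (hf : f.VanishesAt π σ F hF) (haff : IsAffineOpen F.U)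
    {k : Type*} [Field k] (φ : Γ(Y, F.U) →+* k) (x : Fin n → k)
    (hx : linEval φ x (f.toPolynomial F) = 0) (p : MvPolynomial (Fin n) Γ(Y, F.U))
    (hp : MvPolynomial.eval₂ ((algebraMap (BaseField π) (TopField X)).comp (germBase π F.U hF))
        (genComponents π σ F hF) p = 0) : MvPolynomial.eval₂ φ x p = 0 := by
  let _ := (germBase π F.U hF).toAlgebra
  let _ := ((algebraMap (BaseField π) (TopField X)).comp (germBase π F.U hF)).toAlgebra
  have : IsScalarTower Γ(Y, F.U) (BaseField π) (TopField X) := .of_algebraMap_eq' rfl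
  have : FaithfulSMul Γ(Y, F.U) (BaseField π) :=
    (faithfulSMul_iff_algebraMap_injective _ _).mpr (germBase_injective π F.U hF)
  exact eval₂_eq_zero_of_linEval_eq_zero (hf.isConjPoly s hV hd hσ)
    (fun j => isIntegral_germTop π haff hF _) φ x hx p hp

variable [CompactSpace Y] [IsLocallyNoetherian Y]

-- The local graph is finite because its composite with the projection is, so its image is closed
-- and is the zero locus of its kernel. Functions in the kernel are relations of `s`, and these hold
-- at every field-valued zero of `f(η)`.
omit [CompactSpace Y] [IsLocallyNoetherian Y] in
include s hV hd hσ in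
lemma mem_range_localGraph (hf : ∀ F hF, f.VanishesAt π σ F hF) (F : Frame V n)
    (haff : IsAffineOpen F.U) (hF : π (genericPoint X) ∈ F.U) {k : Type} [Field k]
    (u : Spec (.of k) ⟶ 𝔸(Fin n; F.U)) (hu : f.ZeroAlong u) (x : Spec (.of k)) :
    u x ∈ Set.range (localGraph π σ F) := by
  have : IsAffine F.U := haff
  have hfin : IsFinite (localGraph π σ F) := by
    have h : localGraph π σ F ≫ (𝔸(Fin n; F.U) ↘ F.U.toScheme) = π ∣_ F.U := by simp [localGraph]
    have : IsFinite (localGraph π σ F ≫ (𝔸(Fin n; F.U) ↘ F.U.toScheme)) := by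
      rw [h]; infer_instance
    exact IsFinite.of_comp _ (𝔸(Fin n; F.U) ↘ F.U.toScheme)
  have hcl : IsClosed (Set.range (localGraph π σ F)) :=
    (localGraph π σ F).isClosedMap.isClosed_range
  rw [← hcl.closure_eq, ← Scheme.Hom.support_ker]
  refine (Scheme.IdealSheafData.mem_support_iff_of_mem (U := ⟨⊤, isAffineOpen_top _⟩)
    (show u x ∈ (⊤ : (𝔸(Fin n; F.U)).Opens) from trivial)).mpr ?_
  rw [Scheme.mem_zeroLocus_iff]
  intro a ha hx
  obtain ⟨p, rfl⟩ := chartFunction_surjective F haff a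
  rw [SetLike.mem_coe, Scheme.Hom.ker_apply, RingHom.mem_ker] at ha
  have hp := (localGraph_appTop_eq_zero_iff F hF p).mp ha
  let e := (Scheme.ΓSpecIso (.of k)).hom
  have he : Function.Injective e := (ConcreteCategory.bijective_of_isIso e).1
  have h0 : u.appTop (chartFunction F p) = 0 := by
    apply he
    rw [map_zero, appTop_chartFunction]
    refine (MvPolynomial.eval₂_comp_left e.hom _ _ p).trans ?_
    refine (hf F hF).eval₂_eq_zero s hV hd hσ haff _ _ ?_ p hp
    have := congrArg (MvPolynomial.map e.hom) hu
    rwa [SpectralPolynomial.map_evalTautological, map_linEval, map_zero] at this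
  have hx' : x ∈ (Spec (.of k)).basicOpen (u.appTop (chartFunction F p)) := by
    rw [← Scheme.preimage_basicOpen_top]
    exact hx
  rw [h0] at hx'
  simp at hx'

-- This excludes components of the spectral cover that miss `X`. A point `z` is tested through its
-- residue field, after lifting to a chart over an affine open.
include s hd hσ in
theorem SpectralPolynomial.toCover_surjective (hf : ∀ F hF, f.VanishesAt π σ F hF) :
    Surjective (f.toCover hV hf) := by
  refine ⟨fun z => ?_⟩
  obtain ⟨G, hG⟩ := hV (Tot.proj hV (f.spectralCoverι hV z))
  obtain ⟨W, hWa, hyW, hWG⟩ := exists_affine_le hG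
  let F := G.restrict W hWG
  have hF : π (genericPoint X) ∈ F.U := map_genericPoint_mem_of_nonempty π ⟨_, hyW⟩
  obtain ⟨a, -, ha⟩ := Scheme.exists_preimage_of_isPullback (Tot.isPullback_chart hV F)
    ⟨_, hyW⟩ (f.spectralCoverι hV z) rfl
  let v : Spec ((f.spectralCover hV).residueField z) ⟶ f.spectralCover hV :=
    (f.spectralCover hV).fromSpecResidueField z
  have hr : Set.range (v ≫ f.spectralCoverι hV) ⊆ Set.range (Tot.chart hV F) := by
    rintro _ ⟨t, rfl⟩
    refine ⟨a, ha.trans ?_⟩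
    rw [Scheme.Hom.comp_apply, Scheme.fromSpecResidueField_apply]
  let u := IsOpenImmersion.lift (Tot.chart hV F) (v ≫ f.spectralCoverι hV) hr
  have hu : u ≫ Tot.chart hV F = v ≫ f.spectralCoverι hV := IsOpenImmersion.lift_fac _ _ _
  have hz : f.ZeroAlong u := zeroAlong_of_mem (f.idealSheaf_mem_zeroIdeals hV) hu.symm
  let pt : Spec ((f.spectralCover hV).residueField z) := IsLocalRing.closedPoint _
  obtain ⟨x, hx⟩ := mem_range_localGraph s hV hd hσ hf F hWa hF u hz pt
  refine ⟨(π ⁻¹ᵁ F.U).ι x, (f.spectralCoverι hV).isClosedEmbedding.injective ?_⟩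
  rw [← Scheme.Hom.comp_apply, toCover_ι, ← Scheme.Hom.comp_apply, ι_graph, Scheme.Hom.comp_apply,
    hx]
  have h : (u ≫ Tot.chart hV F) pt = f.spectralCoverι hV z := by
    rw [hu, Scheme.Hom.comp_apply, Scheme.fromSpecResidueField_apply]
  exact h

end Surjective

/-! ### Inverting the denominators -/

section Localization
variable {ι A B A' B' : Type*} [Fintype ι] [CommRing A] [CommRing B] [CommRing A'] [CommRing B']
  [Algebra A A'] [Algebra B B'] (α : A →+* B) (θ : A' →+* B')
  (h : θ.comp (algebraMap A A') = (algebraMap B B').comp α) (a : A)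
include h

omit [Fintype ι] in
lemma eval₂_map_algebraMap (s : ι → B) (p : MvPolynomial ι A) :
    MvPolynomial.eval₂ θ (algebraMap B B' ∘ s) (MvPolynomial.map (algebraMap A A') p) =
      algebraMap B B' (MvPolynomial.eval₂ α s p) := by
  rw [MvPolynomial.eval₂_map, h, ← MvPolynomial.eval₂_comp_left]

omit [Fintype ι] in
theorem exists_eval₂_eq_of_isLocalization [IsLocalization.Away a A']
    [IsLocalization.Away (α a) B'] (s : ι → B)
    (hs : ∀ b, ∃ p : MvPolynomial ι A, MvPolynomial.eval₂ α s p = α a * b) (b : B') :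
    ∃ p : MvPolynomial ι A', MvPolynomial.eval₂ θ (algebraMap B B' ∘ s) p = b := by
  obtain ⟨k, c, hc⟩ := IsLocalization.Away.surj (α a) b
  obtain ⟨p, hp⟩ := hs c
  obtain ⟨u, hu⟩ := (IsLocalization.Away.algebraMap_isUnit (S := A') a)
  have hua : θ u = algebraMap B B' (α a) := by rw [hu]; exact congr($h a)
  -- The power `k` is the denominator of `b`, and one more factor comes from the hypothesis `hs`.
  refine ⟨MvPolynomial.C ((u⁻¹ ^ (k + 1) : A'ˣ) : A') * MvPolynomial.map (algebraMap A A') p, ?_⟩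
  rw [MvPolynomial.eval₂_mul, MvPolynomial.eval₂_C, eval₂_map_algebraMap α θ h, hp, map_mul, ← hc,
    ← hua]
  have : θ ((u⁻¹ ^ (k + 1) : A'ˣ) : A') * θ u ^ (k + 1) = 1 := by
    rw [← map_pow, ← map_mul, ← Units.val_pow_eq_pow_val, ← Units.val_mul]
    simp
  calc _ = θ ((u⁻¹ ^ (k + 1) : A'ˣ) : A') * θ u ^ (k + 1) * b := by ring
    _ = b := by rw [this, one_mul]

omit h in
lemma map_mem_coeffIdeal {R S : Type*} [CommRing R] [CommRing S] (φ : R →+* S)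
    {f : Polynomial (MvPolynomial ι R)} {p : MvPolynomial ι R} (hp : p ∈ coeffIdeal f) :
    MvPolynomial.map φ p ∈ coeffIdeal (f.map (MvPolynomial.map φ)) := by
  rw [← Ideal.mem_comap]
  refine (Ideal.span_le (I := Ideal.comap (MvPolynomial.map φ) _)).mpr ?_ hp
  rintro _ ⟨β, rfl⟩
  refine Ideal.subset_span ⟨β, ?_⟩
  simp only
  rw [linEval_map, ← MvPolynomial.coeff_map, map_linEval]
  congr 2
  · congr 1
    · ext; simp
    · funext; simp

/-- After clearing the denominators of `p` the hypothesis applies, and both factors of `a` that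
arise become units in `A'`. -/
theorem mem_coeffIdeal_of_isLocalization [IsLocalization.Away a A']
    (hB : Function.Injective (algebraMap B B')) (s : ι → B)
    (f : Polynomial (MvPolynomial ι A))
    (hf : ∀ p, MvPolynomial.eval₂ α s p = 0 → MvPolynomial.C a * p ∈ coeffIdeal f)
    (p : MvPolynomial ι A') (hp : MvPolynomial.eval₂ θ (algebraMap B B' ∘ s) p = 0) :
    p ∈ coeffIdeal (f.map (MvPolynomial.map (algebraMap A A'))) := by
  let _ := MvPolynomial.algebraMvPolynomial (σ := ι) (R := A) (S := A')
  obtain ⟨⟨q, _, _, ⟨k, rfl⟩, rfl⟩, hq⟩ := IsLocalization.surj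
    ((Submonoid.powers a).map (MvPolynomial.C (σ := ι))) p
  simp only [MvPolynomial.algebraMap_def, MvPolynomial.map_C] at hq
  have h0 : MvPolynomial.eval₂ α s q = 0 := by
    apply hB
    rw [← eval₂_map_algebraMap α θ h, ← hq, MvPolynomial.eval₂_mul, hp, zero_mul, map_zero]
  have h1 := map_mem_coeffIdeal (algebraMap A A') (hf q h0)
  have hu : IsUnit (MvPolynomial.C (σ := ι) (algebraMap A A' (a ^ (k + 1)))) := by
    rw [map_pow]
    exact ((IsLocalization.Away.algebraMap_isUnit a).pow _).map MvPolynomial.C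
  have e : MvPolynomial.map (algebraMap A A') (MvPolynomial.C a * q) =
      MvPolynomial.C (algebraMap A A' (a ^ (k + 1))) * p := by
    rw [map_mul, ← hq, MvPolynomial.map_C, pow_succ, map_mul, map_mul]
    ring
  rw [e] at h1
  exact (Ideal.unit_mul_mem_iff_mem _ hu).mp h1

end Localization

/-! ### An open set over which the graph is the zero scheme -/

section Restrict
variable {X Y : Scheme.{0}} {V : Y.Modules} {n r : ℕ} (F : Frame V n) {W : Y.Opens} (hW : W ≤ F.U)

lemma components_restrict (π : X ⟶ Y) (σ : Γ((Scheme.Modules.pullback π).obj V, ⊤)) (i : Fin n) :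
    components π σ (F.restrict W hW) i = X.presheaf.map
      (homOfLE (show π ⁻¹ᵁ W ≤ π ⁻¹ᵁ F.U from fun _ hx => hW hx)).op (components π σ F i) := by
  refine Eq.trans ?_ (components_res π σ (F := F.restrict W hW) (G := F) hW i).symm
  simp [Frame.transition_eq_of_restrict]

lemma SpectralPolynomial.toPolynomial_restrict (f : SpectralPolynomial V n r) :
    f.toPolynomial (F.restrict W hW) =
      (f.toPolynomial F).map (MvPolynomial.map (Y.presheaf.map (homOfLE hW).op).hom) := by
  refine Eq.trans ?_ (f.toPolynomial_res (F := F.restrict W hW) (G := F) hW).symm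
  have : Frame.transition (F := F.restrict W hW) (G := F) hW = fun i j => if i = j then 1 else 0 := by
    funext i j
    exact F.transition_eq_of_restrict W hW i j
  rw [this, linSubst_one]
  exact Polynomial.map_id.symm

end Restrict

section Shrinking
variable {X Y : Scheme.{0}} [IsIntegral X] [IsIntegral Y] {π : X ⟶ Y} [Surjective π] [IsFinite π]
  [FiniteDimensional (BaseField π) (TopField X)] [IsLocallyNoetherian Y] (s : Y ⟶ Spec (.of ℂ))
  [Smooth s] {V : Y.Modules} {n : ℕ} (hV : IsLocallyFreeOfRank V n) (hd : (degree π).Prime)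
  {σ : Γ((Scheme.Modules.pullback π).obj V, ⊤)} (hσ : ∀ t : Γ(V, ⊤), pullbackSection π t ≠ σ)
  {f : SpectralPolynomial V n (degree π)}

include s hV hd hσ

theorem SpectralPolynomial.VanishesAt.exists_denominator {F : Frame V n}
    {hF : π (genericPoint X) ∈ F.U} (hf : f.VanishesAt π σ F hF) (haff : IsAffineOpen F.U) :
    ∃ a : Γ(Y, F.U), a ≠ 0 ∧
      (∀ b, ∃ p, MvPolynomial.eval₂ (π.app F.U).hom (components π σ F) p = π.app F.U a * b) ∧
      ∀ p, MvPolynomial.eval₂ (π.app F.U).hom (components π σ F) p = 0 →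
        MvPolynomial.C a * p ∈ coeffIdeal (f.toPolynomial F) := by
  obtain ⟨i, hi⟩ := exists_adjoin_eq_top π hV s hd σ hσ F hF
  let _ := (germBase π F.U hF).toAlgebra
  let _ := ((algebraMap (BaseField π) (TopField X)).comp (germBase π F.U hF)).toAlgebra
  let _ := (germTop π F.U hF).toAlgebra
  let _ := (π.app F.U).hom.toAlgebra
  have : IsScalarTower Γ(Y, F.U) (BaseField π) (TopField X) := .of_algebraMap_eq' rfl
  have : IsScalarTower Γ(Y, F.U) Γ(X, π ⁻¹ᵁ F.U) (TopField X) :=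
    .of_algebraMap_eq fun a => algebraMap_germBase π F.U hF a
  have := isFractionRing_germBase π haff hF
  have := charZero_baseField π s
  have : Nonempty F.U := ⟨⟨_, hF⟩⟩
  have : IsNoetherianRing Γ(Y, F.U) := IsLocallyNoetherian.component_noetherian ⟨F.U, haff⟩
  have : Module.Finite Γ(Y, F.U) Γ(X, π ⁻¹ᵁ F.U) := π.finite_app F.U haff
  obtain ⟨a, ha, h⟩ := exists_smul_mem_coeffIdeal (K := BaseField π) hi (f.monic_toPolynomial F)
    (f.natDegree_toPolynomial F) hf
  obtain ⟨b, hb, h'⟩ := exists_smul_mem_range (A := Γ(Y, F.U)) (K := BaseField π)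
    (germTop_injective π F.U hF) (s := components π σ F) hi
  -- Here `a` moves relations into the coefficient ideal, and `b` makes functions on the preimage
  -- polynomials in the components.
  refine ⟨a * b, mul_ne_zero ha hb, fun c => ?_, fun p hp => ?_⟩
  · obtain ⟨p, hp⟩ := h' (π.app F.U a * c)
    refine ⟨p, Eq.trans hp ?_⟩
    rw [Algebra.smul_def, map_mul, mul_comm (π.app F.U a) (π.app F.U b), mul_assoc]
    rfl
  · have := h p (by
      have := germTop_eval₂ (σ := σ) F hF p
      rw [hp, map_zero] at this
      exact this.symm)
    rw [map_mul, mul_comm (MvPolynomial.C a), mul_assoc]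
    exact Ideal.mul_mem_left _ _ this

/-- On the basic open of the denominator both defects disappear: the components generate the
functions upstairs, and `f(η)` gives all their relations. -/
theorem SpectralPolynomial.exists_frame (hf : ∀ F hF, f.VanishesAt π σ F hF) :
    ∃ F : Frame V n, IsAffineOpen F.U ∧ π (genericPoint X) ∈ F.U ∧
      Function.Surjective (MvPolynomial.eval₂ (π.app F.U).hom (components π σ F)) ∧
      ∀ p, MvPolynomial.eval₂ (π.app F.U).hom (components π σ F) p = 0 →
        p ∈ coeffIdeal (f.toPolynomial F) := by
  obtain ⟨G, hG⟩ := hV (π (genericPoint X))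
  obtain ⟨W, hWa, hW, hWG⟩ := exists_affine_le hG
  let F := G.restrict W hWG
  obtain ⟨a, ha, h1, h2⟩ := (hf F hW).exists_denominator s hV hd hσ hWa
  have hle : Y.basicOpen a ≤ F.U := Y.basicOpen_le a
  have hmem : π (genericPoint X) ∈ Y.basicOpen a := by
    rw [Scheme.mem_basicOpen Y a _ hW]
    have : germBase π F.U hW a ≠ 0 := (map_ne_zero_iff _ (germBase_injective π F.U hW)).mpr ha
    exact isUnit_iff_ne_zero.mpr this
  have hle' : π ⁻¹ᵁ Y.basicOpen a ≤ π ⁻¹ᵁ F.U := fun _ hx => hle hx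
  let ρ : Γ(Y, F.U) →+* Γ(Y, Y.basicOpen a) := (Y.presheaf.map (homOfLE hle).op).hom
  let ρ' : Γ(X, π ⁻¹ᵁ F.U) →+* Γ(X, π ⁻¹ᵁ Y.basicOpen a) := (X.presheaf.map (homOfLE hle').op).hom
  let _ := ρ.toAlgebra
  let _ := ρ'.toAlgebra
  have hl : IsLocalization.Away a Γ(Y, Y.basicOpen a) :=
    IsAffineOpen.isLocalization_of_eq_basicOpen hWa a (homOfLE hle) rfl
  have hl' : IsLocalization.Away ((π.app F.U).hom a) Γ(X, π ⁻¹ᵁ Y.basicOpen a) :=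
    IsAffineOpen.isLocalization_of_eq_basicOpen (hWa.preimage π) _ (homOfLE hle')
      (Scheme.preimage_basicOpen _ _)
  have hc : (π.app (Y.basicOpen a)).hom.comp ρ = ρ'.comp (π.app F.U).hom := by
    ext x
    exact congr($(π.naturality (homOfLE hle).op) x)
  have hcomp : components π σ (F.restrict _ hle) = ρ' ∘ components π σ F :=
    funext fun i => components_restrict F hle π σ i
  have hinj : Function.Injective ρ' := by
    intro x y hxy
    apply germTop_injective π F.U hW
    rw [← germTop_res π hle hmem, ← germTop_res π hle hmem]
    exact congrArg _ hxy
  refine ⟨F.restrict _ hle, hWa.basicOpen a, hmem, fun b => ?_, fun p hp => ?_⟩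
  · rw [hcomp]
    exact exists_eval₂_eq_of_isLocalization (π.app F.U).hom (π.app (Y.basicOpen a)).hom hc a
      (components π σ F) h1 b
  · rw [hcomp] at hp
    rw [toPolynomial_restrict]
    exact mem_coeffIdeal_of_isLocalization (π.app F.U).hom (π.app (Y.basicOpen a)).hom hc a hinj
      (components π σ F) _ h2 p hp

end Shrinking

/-! ### The local graph as a closed subscheme of the chart -/

section LocalGraph
variable {X Y : Scheme.{0}} {π : X ⟶ Y} [IsAffineHom π] {V : Y.Modules} {n r : ℕ}
  {σ : Γ((Scheme.Modules.pullback π).obj V, ⊤)} {f : SpectralPolynomial V n r} {F : Frame V n}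
  (haff : IsAffineOpen F.U)
include haff

lemma isClosedImmersion_localGraph
    (h : Function.Surjective (MvPolynomial.eval₂ (π.app F.U).hom (components π σ F))) :
    IsClosedImmersion (localGraph π σ F) := by
  have : IsAffine F.U := haff
  have : IsAffine (π ⁻¹ᵁ F.U) := haff.preimage π
  apply IsClosedImmersion.of_surjective_of_isAffine
  intro b
  obtain ⟨c, rfl⟩ := (ConcreteCategory.bijective_of_isIso (π ⁻¹ᵁ F.U).topIso.inv).2 b
  obtain ⟨p, rfl⟩ := h c
  exact ⟨chartFunction F p, localGraph_appTop_chartFunction F p⟩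

omit [IsAffineHom π] in
lemma ker_localGraph_le
    (h : ∀ p, MvPolynomial.eval₂ (π.app F.U).hom (components π σ F) p = 0 →
        p ∈ coeffIdeal (f.toPolynomial F)) :
    (localGraph π σ F).ker ≤ f.chartIdeal F := by
  have : IsAffine F.U := haff
  rw [Scheme.ker_of_isAffine, SpectralPolynomial.chartIdeal]
  apply Scheme.IdealSheafData.le_of_isAffine
  simp only [Scheme.IdealSheafData.ofIdealTop_ideal]
  refine Ideal.map_mono fun b hb => ?_
  obtain ⟨p, rfl⟩ := chartFunction_surjective F haff b
  have hb : (localGraph π σ F).appTop (chartFunction F p) = 0 := hb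
  rw [localGraph_appTop_chartFunction, map_eq_zero_iff _
    (ConcreteCategory.bijective_of_isIso (π ⁻¹ᵁ F.U).topIso.inv).1] at hb
  have := h p hb
  rw [← Ideal.mem_comap]
  refine (Ideal.span_le (I := Ideal.comap (chartFunction F) _)).mpr ?_ this
  rintro _ ⟨α, rfl⟩
  refine Ideal.subset_span ⟨α, ?_⟩
  simp only
  rw [← map_chartFunction_linEval, MvPolynomial.coeff_map]

end LocalGraph

/-! ### Birationality -/

section Birational
variable {X Y : Scheme.{0}} [IsIntegral X] [IsIntegral Y] {π : X ⟶ Y} [Surjective π] [IsFinite π]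
  [CompactSpace Y] [IsLocallyNoetherian Y]
  {V : Y.Modules} {n : ℕ} (hV : IsLocallyFreeOfRank V n)
  {σ : Γ((Scheme.Modules.pullback π).obj V, ⊤)}
  {f : SpectralPolynomial V n (degree π)}

/-- A morphism to the chart that also lands in the spectral cover makes `f(η)` vanish, so it factors
uniquely through the closed immersion of the graph. -/
theorem SpectralPolynomial.isPullback_localGraph (hf : ∀ F hF, f.VanishesAt π σ F hF)
    {F : Frame V n} (haff : IsAffineOpen F.U)
    (h₁ : Function.Surjective (MvPolynomial.eval₂ (π.app F.U).hom (components π σ F)))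
    (h₂ : ∀ p, MvPolynomial.eval₂ (π.app F.U).hom (components π σ F) p = 0 →
        p ∈ coeffIdeal (f.toPolynomial F)) :
    IsPullback (localGraph π σ F) ((π ⁻¹ᵁ F.U).ι ≫ f.toCover hV hf) (Tot.chart hV F)
      (f.spectralCoverι hV) := by
  have := isClosedImmersion_localGraph haff h₁
  have hw : localGraph π σ F ≫ Tot.chart hV F =
      ((π ⁻¹ᵁ F.U).ι ≫ f.toCover hV hf) ≫ f.spectralCoverι hV := by
    rw [Category.assoc, toCover_ι, ι_graph]
  refine ⟨⟨hw⟩, ⟨PullbackCone.IsLimit.mk hw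
    (fun c => IsClosedImmersion.lift (localGraph π σ F) c.fst
      ((ker_localGraph_le haff h₂).trans (chartIdeal_le_ker haff
        (zeroAlong_of_mem (f.idealSheaf_mem_zeroIdeals hV) (v := c.snd) c.condition.symm))))
    (fun c => IsClosedImmersion.lift_fac _ _ _)
    (fun c => ?_) (fun c l hl _ => ?_)⟩⟩
  · rw [← cancel_mono (f.spectralCoverι hV), Category.assoc, ← hw,
      IsClosedImmersion.lift_fac_assoc]
    exact c.condition
  · rw [← cancel_mono (localGraph π σ F), IsClosedImmersion.lift_fac, hl]

variable [FiniteDimensional (BaseField π) (TopField X)] (s : Y ⟶ Spec (.of ℂ)) [Smooth s]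
  (hd : (degree π).Prime) (hσ : ∀ t : Γ(V, ⊤), pullbackSection π t ≠ σ)
include s hd hσ

theorem SpectralPolynomial.isBirationalMorphism_toCover (hf : ∀ F hF, f.VanishesAt π σ F hF) :
    IsBirationalMorphism (f.toCover hV hf) := by
  obtain ⟨F, haff, hF, h₁, h₂⟩ := exists_frame s hV hd hσ hf
  -- It is the base change of the open immersion of the chart.
  have : IsOpenImmersion ((π ⁻¹ᵁ F.U).ι ≫ f.toCover hV hf) :=
    MorphismProperty.of_isPullback (isPullback_localGraph hV hf haff h₁ h₂) inferInstance
  have hne : (π ⁻¹ᵁ F.U : Set X).Nonempty := ⟨genericPoint X, hF⟩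
  have hdense : Dense (π ⁻¹ᵁ F.U : Set X) := (π ⁻¹ᵁ F.U).isOpen.dense hne
  have hr : Set.range ((π ⁻¹ᵁ F.U).ι ≫ f.toCover hV hf) = f.toCover hV hf '' (π ⁻¹ᵁ F.U : Set X) := by
    rw [Scheme.Hom.comp_base, TopCat.coe_comp, Set.range_comp, Scheme.Opens.range_ι]
  have := toCover_surjective s hV hd hσ hf
  exact ⟨{
    source := π ⁻¹ᵁ F.U
    dense_source := hdense
    target := ((π ⁻¹ᵁ F.U).ι ≫ f.toCover hV hf).opensRange
    dense_target := by
      -- A continuous surjection maps dense sets to dense sets; this is where surjectivity of `ψ`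
      -- enters.
      rw [Scheme.Hom.coe_opensRange, hr]
      exact (f.toCover hV hf).surjective.denseRange.dense_image (f.toCover hV hf).continuous hdense
    iso := ((π ⁻¹ᵁ F.U).ι ≫ f.toCover hV hf).isoOpensRange },
    Scheme.Hom.isoOpensRange_hom_ι _⟩

end Birational

lemma birationalOver_of_isBirationalMorphism {S X Z : Scheme.{0}} {ψ : X ⟶ Z}
    (hψ : IsBirationalMorphism ψ) (s : Z ⟶ S) : Scheme.BirationalOver s (ψ ≫ s) := by
  obtain ⟨e, he⟩ := hψ
  refine Scheme.BirationalOver.symm ⟨e, ?_⟩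
  rw [Scheme.PartialIso.IsOver, reassoc_of% he]

/-! ### Compactness of projective schemes -/

section Projective
attribute [local instance] MvPolynomial.gradedAlgebra

instance (N : ℕ) : QuasiCompact (projectiveSpaceToSpec N) := by
  have : IsScalarTower ℂ (MvPolynomial.homogeneousSubmodule (Fin (N + 1)) ℂ 0)
      (MvPolynomial (Fin (N + 1)) ℂ) := ⟨fun x y z => smul_mul_assoc x (y : MvPolynomial (Fin (N + 1)) ℂ) z⟩
  have : Algebra.FiniteType (MvPolynomial.homogeneousSubmodule (Fin (N + 1)) ℂ 0)
      (MvPolynomial (Fin (N + 1)) ℂ) :=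
    Algebra.FiniteType.of_restrictScalars_finiteType ℂ _ _
  unfold projectiveSpaceToSpec projectiveSpace
  infer_instance

lemma IsSmoothProjective.compactSpace {X : Scheme.{0}} {s : X ⟶ Spec (.of ℂ)}
    (h : IsSmoothProjective s) : CompactSpace X := by
  obtain ⟨N, i, _, rfl⟩ := h.projective
  exact QuasiCompact.compactSpace_of_compactSpace (i ≫ projectiveSpaceToSpec N)

end Projective
end SpectralCover

/-! ### The main theorem -/

open SpectralCover
theorem mainTheorem3 (X Y : Scheme.{0}) [IsIntegral X] [IsIntegral Y]
    (sX : X ⟶ Spec (.of ℂ)) (sY : Y ⟶ Spec (.of ℂ))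
    (hX : IsSmoothProjective sX) (hY : IsSmoothProjective sY)
    (π : X ⟶ Y) (hπ : π ≫ sY = sX) [IsFinite π] [Surjective π]
    (r : ℕ) (hr : r.Prime) (hdeg : degree π = r)
    (n : ℕ) (V : Y.Modules) (hV : IsLocallyFreeOfRank V n)
    (m : ℕ) (hm : 0 < m) (M : X.Modules) (hM : IsLocallyFreeOfRank M m)
    (σ : Γ((Scheme.Modules.pullback π).obj V, ⊤))
    (hσ : ∀ s : Γ(V, ⊤), pullbackSection π s ≠ σ) :
    (∃! f : SpectralPolynomial V n r, f.Annihilates (pushforwardHiggs π M σ)) ∧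
    ∀ f : SpectralPolynomial V n r, f.Annihilates (pushforwardHiggs π M σ) →
      (∃ ψ : X ⟶ f.spectralCover hV,
        ψ ≫ f.spectralCoverι hV = graph hV π σ ∧ IsBirationalMorphism ψ) ∧
      Scheme.BirationalOver (f.spectralCoverι hV ≫ Tot.proj hV ≫ sY) sX := by
  subst hdeg
  have := hY.smooth
  have := finiteDimensional_of_prime π hr
  refine ⟨?_, fun f hf => ?_⟩
  · obtain ⟨f, hf⟩ := SpectralPolynomial.exists_vanishesAt (σ := σ) sY hV hr hσ
    exact ⟨f, SpectralPolynomial.annihilates_of_vanishesAt hf, fun f' hf' =>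
      SpectralPolynomial.eq_of_vanishesAt sY hV hr hσ
        (SpectralPolynomial.vanishesAt_of_annihilates hm hM hf') hf⟩
  · have := hY.compactSpace
    have : IsLocallyNoetherian Y := LocallyOfFiniteType.isLocallyNoetherian sY
    have hf' := SpectralPolynomial.vanishesAt_of_annihilates hm hM hf
    have hbir := SpectralPolynomial.isBirationalMorphism_toCover hV sY hr hσ hf'
    refine ⟨⟨f.toCover hV hf', f.toCover_ι hV hf', hbir⟩, ?_⟩
    have h := birationalOver_of_isBirationalMorphism hbir
      (f.spectralCoverι hV ≫ Tot.proj hV ≫ sY)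
    -- The composite of `ψ` with the projection to `Y` is `π`, so the structure morphism induced on
    -- `X` is `sX`.
    rwa [← Category.assoc (f.toCover hV hf'), SpectralPolynomial.toCover_ι,
      ← Category.assoc (graph hV π σ), graph_proj, hπ] at h
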